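/- **Setting.** Let $d\in\{2,3\}$ and let $\sigma$ be the $(d-1)$-dimensional (Hausdorff) surface measure. A *bounded open set with piecewise $C^2$ boundary* is a bounded open set $S\subset\mathbb R^d$ such that $\sigma(\partial S)<\infty$ and $\sigma$-almost every point of $\partial S$ has a neighbourhood in which $S=\{\rho<0\}$ for a real function $\rho$ that is $C^2$ there and whose gradient does not vanish at the point; there $\mathbf n_S=\nabla\rho/|\nabla\rho|$. Let $\Omega\subset\mathbb R^d$ be such a set. A mesh of $\Omega$ consists of * a finite set $\mathcal T_h$ of pairwise disjoint nonempty cells $K\subset\Omega$, each a bounded open set with piecewise $C^2$ boundary, with $\overline\Omega=\bigcup_K\overline K$; and * a finite set $\mathcal F_h^{\rm i}$ of closed planar interior faces $F$ with $\sigma(F)>0$, which overlap pairwise in $\sigma$-null sets. Each $F$ carries a fixed unit normal $\mathbf n_F$ and lies in the boundary of exactly two cells; these lie on opposite sides of $F$, so that $\mathbf n_K=\pm\mathbf n_F$ $\sigma$-a.e. on $F$ with opposite signs for the two cells. For each cell $K$, let $\mathcal F_{\partial K^{\rm i}}$ be the set of interior faces contained in $\partial K$; it is required that $\partial K^{\rm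 i}:=\overline{\partial K\cap\Omega}$ is the union of these faces. Let $\partial K^{\rm b}:=\partial K\cap\partial\Omega$, let $h_K$ be the diameter of $K$, let $\varepsilon\ge0$, and let $\sigma_K:=\max\{1,\varepsilon h_K^{-2}\}$. Write $(\cdot,\cdot)_S$ for $L^2$ inner products, $(\nabla v,\nabla w)_{K,\varepsilon}:=\varepsilon(\nabla^2v,\nabla^2w)_K+(\nabla v,\nabla w)_K$, and $\partial_n w=\mathbf n\cdot\nabla w$, $\partial_{nn}w=\mathbf n\cdot\nabla^2w\,\mathbf n$, while $\partial_tw$ and $\partial_{nt}w$ are the components of $\nabla w$ and $\nabla^2w\,\mathbf n$ orthogonal to $\mathbf n$, and $\nabla\partial_nw:=\nabla^2w\,\mathbf n$, where $\mathbf n=\mathbf n_K$ on $\partial K$. **Discrete problem.** Let $k\ge0$ be an integer. The global HHO space is $$\hat V_h^k:=\prod_{K\in\mathcal T_h}\mathbb P^{k+2}(K)\times\prod_{F\in\mathcal F_h^{\rm i}}\mathbb P^{k+2}(F)\times\prod_{F\in\mathcal F_h^{\rm i}}\mathbb P^{k}(F),$$ and $\hat v_h=((v_K)_K,(v_F)_F,(\gamma_F)_F)$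 has in the cell $K$ the local components $\hat v_K=(v_K,v_{\partial K},\gamma_{\partial K})$ with $v_{\partial K}|_F=v_F$ and $\gamma_{\partial K}|_F=(\mathbf n_F\cdot\mathbf n_K)\gamma_F$ for $F\in\mathcal F_{\partial K^{\rm i}}$. The local reconstruction of a local triple $\hat v_K\in\mathbb P^{k+2}(K)\times\prod_{F\in\mathcal F_{\partial K^{\rm i}}}\mathbb P^{k+2}(F)\times\prod_{F\in\mathcal F_{\partial K^{\rm i}}}\mathbb P^{k}(F)$ is the polynomial $R_K(\hat v_K)\in\mathbb P^{k+2}(K)$ such that $(R_K(\hat v_K),1)_K=(v_K,1)_K$ and, for all $w\in\mathbb P^{k+2}(K)$ with $(w,1)_K=0$, $$(\nabla R_K(\hat v_K),\nabla w)_{K,\varepsilon}=(v_K,\varepsilon\Delta^2w)_K-(v_K,\Delta w)_K+(v_{\partial K},\partial_nw)_{\partial K^{\rm i}}-\varepsilon\big\{(v_{\partial K},\partial_n\Delta w)_{\partial K^{\rm i}}-(\gamma_{\partial K},\partial_{nn}w)_{\partial K^{\rm i}}-(\partial_tv_{\partial K},\partial_{nt}w)_{\partial K^{\rm i}}\big\}.$$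 With $\Pi^k$ the $L^2$-orthogonal projection onto the piecewise polynomials of degree at most $k$ on the faces in $\mathcal F_{\partial K^{\rm i}}$, and $\hat w_K=(w_K,w_{\partial K},\chi_{\partial K})$, let $\hat a_h(\hat v_h,\hat w_h):=\sum_K\hat a_K(\hat v_K,\hat w_K)$ with $$\begin{aligned}\hat a_K(\hat v_K,\hat w_K):={}&(\nabla R_K(\hat v_K),\nabla R_K(\hat w_K))_{K,\varepsilon}+\sigma_Kh_K^{-1}(v_{\partial K}-v_K,w_{\partial K}-w_K)_{\partial K^{\rm i}}\\&+\sigma_Kh_K(\Pi^k(\gamma_{\partial K}-\partial_nv_K),\chi_{\partial K}-\partial_nw_K)_{\partial K^{\rm i}}+\sigma_Kh_K^{-1}(v_K,w_K)_{\partial K^{\rm b}}+\varepsilon h_K^{-1}(\nabla v_K,\nabla w_K)_{\partial K^{\rm b}}.\end{aligned}$$ The data are $f\in L^2(\Omega)$, $g_{\rm D}\in L^2(\partial\Omega)$ and, if $\varepsilon>0$, $g_{\rm N}\in L^2(\partial\Omega)$, where moreover $g_{\rm D}$ has at a.e. point of $\partial\Omega$ a tangential gradient $(\partial_tg_{\rm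 D})\mathbf t$ along $\partial\Omega$, and this gradient lies in $L^2(\partial\Omega)$. Let $$\begin{aligned}\ell_h(\hat w_h):=\sum_{K}\Big\{&(f,w_K)_K+\big(g_{\rm D},\sigma_Kh_K^{-1}w_K+\varepsilon\partial_n\Delta R_K(\hat w_K)-\partial_nR_K(\hat w_K)\big)_{\partial K^{\rm b}}\\&+\varepsilon\big(g_{\rm N}\mathbf n+(\partial_tg_{\rm D})\mathbf t,\;h_K^{-1}\nabla w_K-\nabla\partial_nR_K(\hat w_K)\big)_{\partial K^{\rm b}}\Big\}.\end{aligned}$$ The space $\hat V_h^k$ is equipped with the norm $$\begin{aligned}\|\hat v_h\|^2:=\sum_K\Big\{&(\nabla v_K,\nabla v_K)_{K,\varepsilon}+\sigma_Kh_K^{-1}\|v_{\partial K}-v_K\|^2_{\partial K^{\rm i}}+\sigma_Kh_K\|\gamma_{\partial K}-\partial_nv_K\|^2_{\partial K^{\rm i}}\\&+\sigma_Kh_K^{-1}\|v_K\|^2_{\partial K^{\rm b}}+\varepsilon h_K^{-1}\|\nabla v_K\|^2_{\partial K^{\rm b}}\Big\}.\end{aligned}$$ **Statement.** For every mesh of $\Omega$,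 every $k\ge0$ and every $\varepsilon\ge0$, including $\varepsilon=0$, the local reconstructions $R_K(\hat v_K)$ exist and are unique, and the discrete problem $$\text{find }\hat u_h\in\hat V_h^k\text{ such that}\quad\hat a_h(\hat u_h,\hat w_h)=\ell_h(\hat w_h)\quad\text{for all }\hat w_h\in\hat V_h^k$$ is well-posed: for all data as above it has exactly one solution, and there is a constant $C>0$, independent of the data, such that $\|\hat u_h\|\le C\,m$ for every $m\ge0$ with $|\ell_h(\hat w_h)|\le m\|\hat w_h\|$ for all $\hat w_h\in\hat V_h^k$. -/

import Mathlib

open MeasureTheory Topology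
open scoped InnerProductSpace

noncomputable section

namespace HHO

/-- The Euclidean space `ℝᵈ`. -/
abbrev Pt (d : ℕ) : Type := EuclideanSpace ℝ (Fin d)

/-- The surface measure in `ℝᵈ`: the `(d-1)`-dimensional Hausdorff measure, normalised so as to
agree with Lebesgue measure on hyperplanes. -/
def surf (d : ℕ) : Measure (Pt d) := μHE[d - 1]

/-! ### Domains with piecewise `C²` boundary and their outward normal -/

/-- `ν` is the unit outward normal to the open set `S` at its boundary point `x`: near `x`, the set
`S` is the strict sublevel set `{ρ < 0}` of a `C²` function `ρ` with `ρ(x) = 0` whose gradient at `x`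
is a positive multiple of the unit vector `ν`. -/
def IsOutwardNormalAt {d : ℕ} (S : Set (Pt d)) (x ν : Pt d) : Prop :=
  ‖ν‖ = 1 ∧ ∃ ρ : Pt d → ℝ, ContDiffAt ℝ 2 ρ x ∧ ρ x = 0 ∧
    (∃ c : ℝ, 0 < c ∧ gradient ρ x = c • ν) ∧ ∀ᶠ y in 𝓝 x, (y ∈ S ↔ ρ y < 0)

open Classical in
/-- The unit outward normal `n_S(x)` (with value `0` at the exceptional boundary points, such as
corners and edges, where there is none). -/
def outwardNormal {d : ℕ} (S : Set (Pt d)) (x : Pt d) : Pt d :=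
  if h : ∃ ν, IsOutwardNormalAt S x ν then h.choose else 0

/-- A bounded open set with piecewise `C²` boundary: the boundary has finite area and, up to a set of
zero area, consists of points near which it is a `C²` hypersurface with the set on one side of it. -/
structure IsPiecewiseC2Domain {d : ℕ} (S : Set (Pt d)) : Prop where
  isOpen : IsOpen S
  bounded : Bornology.IsBounded S
  area_lt_top : surf d (frontier S) < ⊤
  ae_normal : ∀ᵐ x ∂(surf d).restrict (frontier S), ∃ ν, IsOutwardNormalAt S x ν

/-! ### Meshes -/

/-- A polytopal mesh of `Ω`, whose cells may have curved faces on the boundary of `Ω` but have planar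
faces inside `Ω`. -/
structure Mesh (d : ℕ) (Ω : Set (Pt d)) where
  /-- the mesh cells -/
  cells : Finset (Set (Pt d))
  /-- the interior mesh faces -/
  intFaces : Finset (Set (Pt d))
  /-- the fixed unit normal `n_F` that orients an interior face `F` -/
  normal : intFaces → Pt d
  /-- the cell sharing `F` out of which `n_F` points -/
  left : intFaces → cells
  /-- the cell sharing `F` into which `n_F` points -/
  right : intFaces → cells
  cell_nonempty : ∀ K ∈ cells, K.Nonempty
  cell_domain : ∀ K ∈ cells, IsPiecewiseC2Domain K
  cell_subset : ∀ K ∈ cells, K ⊆ Ω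
  cell_disjoint : ∀ K ∈ cells, ∀ K' ∈ cells, K ≠ K' → Disjoint K K'
  cover : closure Ω = ⋃ K ∈ cells, closure K
  face_closed : ∀ F ∈ intFaces, IsClosed F
  face_pos : ∀ F ∈ intFaces, 0 < surf d F
  face_overlap : ∀ F ∈ intFaces, ∀ F' ∈ intFaces, F ≠ F' → surf d (F ∩ F') = 0
  norm_normal : ∀ F, ‖normal F‖ = 1
  /-- interior faces are planar -/
  planar : ∀ F : intFaces, ∃ c : ℝ, ∀ x ∈ (F : Set (Pt d)), ⟪normal F, x⟫_ℝ = c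
  /-- an interior face is shared by two distinct cells, and by no other cell -/
  left_ne_right : ∀ F, left F ≠ right F
  subset_frontier_iff : ∀ (F : intFaces) (K : cells),
    (F : Set (Pt d)) ⊆ frontier (K : Set (Pt d)) ↔ K = left F ∨ K = right F
  /-- the two cells that share `F` lie on opposite sides of it -/
  ae_normal : ∀ F : intFaces, ∀ᵐ x ∂(surf d).restrict (F : Set (Pt d)),
    IsOutwardNormalAt (left F : Set (Pt d)) x (normal F) ∧
    IsOutwardNormalAt (right F : Set (Pt d)) x (-normal F)
  /-- the interior part `closure (∂K ∩ Ω)` of the boundary of a cell is composed of its interior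
  faces -/
  interior_boundary : ∀ K ∈ cells,
    closure (frontier K ∩ Ω) = ⋃ F ∈ intFaces, ⋃ _ : F ⊆ frontier K, F

/-! ### Polynomial spaces and differential operators -/

/-- `ℙˡ(ℝᵈ)`, the polynomial functions of total degree at most `l`. A polynomial on a nonempty open
set `K` is identified with the polynomial function on `ℝᵈ` that extends it. -/
def poly (d l : ℕ) : Submodule ℝ (Pt d → ℝ) where
  carrier := {v | ∃ p : MvPolynomial (Fin d) ℝ, p.totalDegree ≤ l ∧
    ∀ x, v x = MvPolynomial.eval (fun i => x i) p}
  add_mem' := by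
    rintro v w ⟨p, hp, hv⟩ ⟨q, hq, hw⟩
    exact ⟨p + q, (MvPolynomial.totalDegree_add p q).trans (max_le hp hq), fun x => by
      simp [hv, hw]⟩
  zero_mem' := ⟨0, by simp, fun x => by simp⟩
  smul_mem' := by
    rintro c v ⟨p, hp, hv⟩
    exact ⟨c • p, (MvPolynomial.totalDegree_smul_le c p).trans hp, fun x => by
      simp [hv, MvPolynomial.smul_eval]⟩

/-- `ℙˡ(F)` for a planar face `F` with unit normal `n`. A polynomial on the hyperplane that supports
`F` is identified with the polynomial function on `ℝᵈ` that extends it and is constant along `n`. -/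
def facePoly (d l : ℕ) (n : Pt d) : Submodule ℝ (Pt d → ℝ) where
  carrier := {v | v ∈ poly d l ∧ ∀ x (t : ℝ), v (x + t • n) = v x}
  add_mem' := by
    rintro v w ⟨hv, hv'⟩ ⟨hw, hw'⟩
    exact ⟨add_mem hv hw, fun x t => by simp [hv', hw']⟩
  zero_mem' := ⟨zero_mem _, fun x t => rfl⟩
  smul_mem' := by
    rintro c v ⟨hv, hv'⟩
    exact ⟨Submodule.smul_mem _ c hv, fun x t => by simp [hv']⟩

variable {d : ℕ}

/-- The Laplacian `Δw`. -/
def lap (w : Pt d → ℝ) : Pt d → ℝ := Laplacian.laplacian w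

/-- The Hessian `∇²w(x)`, as a linear map. -/
def hess (w : Pt d → ℝ) (x : Pt d) : Pt d →L[ℝ] Pt d := fderiv ℝ (gradient w) x

/-- The Frobenius inner product `∇²v(x) : ∇²w(x)`. -/
def hessInner (v w : Pt d → ℝ) (x : Pt d) : ℝ :=
  ∑ i, ⟪hess v x (EuclideanSpace.single i 1), hess w x (EuclideanSpace.single i 1)⟫_ℝ

/-- The derivative `∂ₙw` in the direction of the vector `n`. -/
def dn (n : Pt d) (w : Pt d → ℝ) (x : Pt d) : ℝ := ⟪n, gradient w x⟫_ℝ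

/-- The normal-normal second derivative `∂ₙₙw`. -/
def dnn (n : Pt d) (w : Pt d → ℝ) (x : Pt d) : ℝ := ⟪n, hess w x n⟫_ℝ

/-- The tangential derivative `∂ₜw` on a hyperplane with unit normal `n`, as the component of the
gradient orthogonal to `n`. -/
def dt (n : Pt d) (w : Pt d → ℝ) (x : Pt d) : Pt d := gradient w x - dn n w x • n

/-- The normal-tangential second derivative `∂ₙₜw`, as the component of `∇²w n` orthogonal
to `n`. -/
def dnt (n : Pt d) (w : Pt d → ℝ) (x : Pt d) : Pt d := hess w x n - dnn n w x • n

/-- The inner product `(∇v, ∇w)_{S,ε} = ε (∇²v, ∇²w)_S + (∇v, ∇w)_S`. -/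
def gradInner (ε : ℝ) (S : Set (Pt d)) (v w : Pt d → ℝ) : ℝ :=
  ε * (∫ x in S, hessInner v w x) + ∫ x in S, ⟪gradient v x, gradient w x⟫_ℝ

/-- The `L²`-inner product of scalar functions on (a part of) a boundary. -/
def surfInner (S : Set (Pt d)) (v w : Pt d → ℝ) : ℝ := ∫ x in S, v x * w x ∂surf d

/-- The `L²`-inner product of vector fields on (a part of) a boundary. -/
def surfInnerVec (S : Set (Pt d)) (v w : Pt d → Pt d) : ℝ := ∫ x in S, ⟪v x, w x⟫_ℝ ∂surf d

/-- `q` is the `L²`-orthogonal projection of `g` onto `ℙˡ(F)`, where `F` is planar with normal `n`. -/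
def IsFaceProj (l : ℕ) (F : Set (Pt d)) (n : Pt d) (g : Pt d → ℝ) (q : facePoly d l n) : Prop :=
  ∀ r : facePoly d l n, surfInner F q r = surfInner F g r

open Classical in
/-- The `L²`-orthogonal projection of `g` onto `ℙˡ(F)`. -/
def faceProj (l : ℕ) (F : Set (Pt d)) (n : Pt d) (g : Pt d → ℝ) : facePoly d l n :=
  if h : ∃ q, IsFaceProj l F n g q then h.choose else 0

/-! ### Local HHO space, reconstruction and stabilisation -/

namespace Mesh

variable {Ω : Set (Pt d)} (M : Mesh d Ω)

open Classical in
/-- The interior faces of the cell `K`. -/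
def facesOf (K : M.cells) : Finset M.intFaces :=
  Finset.univ.filter fun F => (F : Set (Pt d)) ⊆ frontier (K : Set (Pt d))

open Classical in
/-- The unit outward normal `n_K` of the cell `K` on its (planar) interior face `F`. -/
def faceNormal (K : M.cells) (F : M.intFaces) : Pt d :=
  if K = M.left F then M.normal F else -M.normal F

/-- The boundary part `∂K ∩ ∂Ω` of the boundary of the cell `K`. -/
def bdry (K : M.cells) : Set (Pt d) := frontier (K : Set (Pt d)) ∩ frontier Ω

/-- The diameter `h_K`. -/
def diam (K : M.cells) : ℝ := Metric.diam (K : Set (Pt d))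

/-- The weight `σ_K = max {1, ε h_K⁻²}`. -/
def sigma (ε : ℝ) (K : M.cells) : ℝ := max 1 (ε * (M.diam K ^ 2)⁻¹)

/-- The local HHO space: triples `(v_K, v_{∂K}, γ_{∂K})`. -/
abbrev LocalSpace (k : ℕ) (K : M.cells) : Type :=
  poly d (k + 2) × ((F : M.facesOf K) → facePoly d (k + 2) (M.normal F)) ×
    ((F : M.facesOf K) → facePoly d k (M.normal F))

/-- The right-hand side of the equation that defines the reconstruction. -/
def reconRHS (ε : ℝ) {k : ℕ} {K : M.cells} (v : M.LocalSpace k K) (w : Pt d → ℝ) : ℝ :=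
  (∫ x in (K : Set (Pt d)), (v.1 : Pt d → ℝ) x * (ε * lap (lap w) x))
  - (∫ x in (K : Set (Pt d)), (v.1 : Pt d → ℝ) x * lap w x)
  + ∑ F : M.facesOf K, surfInner F (v.2.1 F) (dn (M.faceNormal K F) w)
  - ε * ∑ F : M.facesOf K,
      (surfInner F (v.2.1 F) (dn (M.faceNormal K F) (lap w))
        - surfInner F (v.2.2 F) (dnn (M.faceNormal K F) w)
        - surfInnerVec F (dt (M.faceNormal K F) (v.2.1 F)) (dnt (M.faceNormal K F) w))

/-- `R` is the reconstruction of the local triple `v`. -/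
def IsRecon (ε : ℝ) {k : ℕ} {K : M.cells} (v : M.LocalSpace k K) (R : poly d (k + 2)) : Prop :=
  (∀ w : poly d (k + 2), (∫ x in (K : Set (Pt d)), (w : Pt d → ℝ) x) = 0 →
    gradInner ε (K : Set (Pt d)) R w = M.reconRHS ε v w) ∧
  (∫ x in (K : Set (Pt d)), (R : Pt d → ℝ) x) = ∫ x in (K : Set (Pt d)), (v.1 : Pt d → ℝ) x

open Classical in
/-- The local reconstruction operator `R_K`. -/
def recon (ε : ℝ) {k : ℕ} {K : M.cells} (v : M.LocalSpace k K) : poly d (k + 2) :=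
  if h : ∃ R, M.IsRecon ε v R then h.choose else 0

/-- The stabilisation on the interior part of `∂K`. -/
def stabInt (ε : ℝ) {k : ℕ} {K : M.cells} (v w : M.LocalSpace k K) : ℝ :=
  M.sigma ε K * (M.diam K)⁻¹ * (∑ F : M.facesOf K,
    surfInner F (fun x => (v.2.1 F : Pt d → ℝ) x - (v.1 : Pt d → ℝ) x)
      (fun x => (w.2.1 F : Pt d → ℝ) x - (w.1 : Pt d → ℝ) x))
  + M.sigma ε K * M.diam K * (∑ F : M.facesOf K,
    surfInner F
      (faceProj k F (M.normal F)
        (fun x => (v.2.2 F : Pt d → ℝ) x - dn (M.faceNormal K F) v.1 x))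
      (fun x => (w.2.2 F : Pt d → ℝ) x - dn (M.faceNormal K F) w.1 x))

/-- The stabilisation (Nitsche-type penalty) on the boundary part of `∂K`. -/
def stabBdry (ε : ℝ) (K : M.cells) (v w : Pt d → ℝ) : ℝ :=
  M.sigma ε K * (M.diam K)⁻¹ * surfInner (M.bdry K) v w
  + ε * (M.diam K)⁻¹ * surfInnerVec (M.bdry K) (gradient v) (gradient w)

/-- The local bilinear form `â_K`. -/
def localForm (ε : ℝ) {k : ℕ} {K : M.cells} (v w : M.LocalSpace k K) : ℝ :=
  gradInner ε (K : Set (Pt d)) (M.recon ε v) (M.recon ε w) + M.stabInt ε v w + M.stabBdry ε K v.1 w.1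

/-- The square of the local energy seminorm. -/
def localEnergy (ε : ℝ) {k : ℕ} {K : M.cells} (v : M.LocalSpace k K) : ℝ :=
  gradInner ε (K : Set (Pt d)) v.1 v.1
  + M.sigma ε K * (M.diam K)⁻¹ * (∑ F : M.facesOf K, ∫ x in (F : Set (Pt d)),
      ((v.2.1 F : Pt d → ℝ) x - (v.1 : Pt d → ℝ) x) ^ 2 ∂surf d)
  + M.sigma ε K * M.diam K * (∑ F : M.facesOf K, ∫ x in (F : Set (Pt d)),
      ((v.2.2 F : Pt d → ℝ) x - dn (M.faceNormal K F) v.1 x) ^ 2 ∂surf d)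
  + M.stabBdry ε K v.1 v.1

/-! ### The global discrete problem -/

/-- The global HHO space `ℙ^{k+2}(𝒯_h) × ℙ^{k+2}(ℱ_hⁱ) × ℙ^k(ℱ_hⁱ)`. -/
abbrev Space (k : ℕ) : Type :=
  (M.cells → poly d (k + 2)) × ((F : M.intFaces) → facePoly d (k + 2) (M.normal F)) ×
    ((F : M.intFaces) → facePoly d k (M.normal F))

/-- The local components `(v_K, (v_F)_F, ((n_F · n_K) γ_F)_F)` of `v` in the cell `K`. -/
def localize {k : ℕ} (v : M.Space k) (K : M.cells) : M.LocalSpace k K :=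
  (v.1 K, fun F => v.2.1 F, fun F => ⟪M.normal F, M.faceNormal K F⟫_ℝ • v.2.2 F)

/-- The global bilinear form `â_h`. -/
def form (ε : ℝ) {k : ℕ} (v w : M.Space k) : ℝ :=
  ∑ K : M.cells, M.localForm ε (M.localize v K) (M.localize w K)

/-- The norm on the global HHO space. -/
def energyNorm (ε : ℝ) {k : ℕ} (v : M.Space k) : ℝ :=
  √(∑ K : M.cells, M.localEnergy ε (M.localize v K))

end Mesh

/-! ### Boundary data and the discrete linear form -/

/-- `τ` is the tangential gradient at `x ∈ ∂Ω` of the function `g : ∂Ω → ℝ`: it is tangent to `∂Ω` at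
`x`, and `g(y) = g(x) + τ · (y - x) + o(|y - x|)` as `y → x` in `∂Ω`. -/
def IsTangentialGradientAt (Ω : Set (Pt d)) (g : Pt d → ℝ) (x τ : Pt d) : Prop :=
  ⟪outwardNormal Ω x, τ⟫_ℝ = 0 ∧ HasFDerivWithinAt g (innerSL ℝ τ) (frontier Ω) x

open Classical in
/-- The tangential gradient `(∂ₜg) t` on `∂Ω`. -/
def tangentialGradient (Ω : Set (Pt d)) (g : Pt d → ℝ) (x : Pt d) : Pt d :=
  if h : ∃ τ, IsTangentialGradientAt Ω g x τ then h.choose else 0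

/-- The regularity of the source term and of the boundary data that gives a meaning to the
right-hand side of the discrete problem. If `ε = 0`, nothing is required of the Neumann datum `gN` and
of the tangential derivative of the Dirichlet datum `gD`. -/
structure IsAdmissibleData (Ω : Set (Pt d)) (ε : ℝ) (f gD gN : Pt d → ℝ) : Prop where
  source : MemLp f 2 (volume.restrict Ω)
  dirichlet : MemLp gD 2 ((surf d).restrict (frontier Ω))
  neumann : ε ≠ 0 → MemLp gN 2 ((surf d).restrict (frontier Ω))
  dirichlet_diff : ε ≠ 0 →
    ∀ᵐ x ∂(surf d).restrict (frontier Ω), ∃ τ, IsTangentialGradientAt Ω gD x τ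
  dirichlet_grad : ε ≠ 0 →
    MemLp (tangentialGradient Ω gD) 2 ((surf d).restrict (frontier Ω))

/-- The discrete linear form `ℓ_h`. -/
def Mesh.linForm {Ω : Set (Pt d)} (M : Mesh d Ω) (ε : ℝ) (f gD gN : Pt d → ℝ) {k : ℕ}
    (w : M.Space k) : ℝ :=
  ∑ K : M.cells,
    let n : Pt d → Pt d := outwardNormal (K : Set (Pt d))
    let wK : Pt d → ℝ := w.1 K
    let R : Pt d → ℝ := M.recon ε (M.localize w K)
    ((∫ x in (K : Set (Pt d)), f x * wK x)
      + surfInner (M.bdry K) gD (fun x =>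
          M.sigma ε K * (M.diam K)⁻¹ * wK x + ε * dn (n x) (lap R) x - dn (n x) R x)
      + ε * surfInnerVec (M.bdry K) (fun x => gN x • n x + tangentialGradient Ω gD x)
          (fun x => (M.diam K)⁻¹ • gradient wK x - hess R x (n x)))

/-- `u` solves the discrete problem `â_h(u, w) = ℓ_h(w)` for all `w` in the HHO space. -/
def Mesh.IsDiscreteSolution {Ω : Set (Pt d)} (M : Mesh d Ω) (ε : ℝ) (f gD gN : Pt d → ℝ) {k : ℕ}
    (u : M.Space k) : Prop :=
  ∀ w : M.Space k, M.form ε u w = M.linForm ε f gD gN w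

end HHO

end

/-! The discrete problem is a square linear system, so everything rests on one fact: `form v v` is
nonnegative and vanishes only for `v = 0` (`Mesh.form_self_nonneg`, `Mesh.eq_zero_of_form_self`).
Definiteness makes the induced map into the dual space injective, hence bijective
(`IsBilin.existsUnique`). It also makes the symmetric part of the form an inner product on a
finite-dimensional space, which therefore dominates the squared energy norm
(`IsBilin.exists_bound`). Testing with the solution itself then gives the stability bound, with a
constant that may depend on the mesh, on k and on ε.

Definiteness. If `form v v = 0`, then on each cell the reconstruction has zero gradient, v_F = v_K
a.e. on the interior faces, γ - ∂ₙv_K is orthogonal to ℙ^k on each face, and v_K vanishes a.e. on ∂K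
∩ ∂Ω, together with its gradient if ε ≠ 0. Under these conditions the right-hand side of the
reconstruction can be integrated by parts back to (∇v_K, ∇w)_{K,ε}
(`Mesh.IsLocalKernel.reconRHS_eq`). Here v_F and its tangential derivative may be replaced by those
of v_K, because a polynomial that vanishes a.e. on a planar set of positive area vanishes on the
whole plane; and γ may be replaced by ∂ₙv_K, because ∂ₙₙw has degree at most k. Taking w = v_K shows
that v_K is a constant c_K.

These constants agree across interior faces. Instead of joining each cell to ∂Ω by a chain of cells,
one sums the divergence theorem for the fields c_K² x₀ e₀ over all cells: face contributions cancel
in pairs, boundary contributions vanish, and Σ c_K² |K| = 0 remains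
(`Mesh.eq_zero_of_face_continuous`). No connectedness of Ω or of the cells is needed.

The divergence theorem (`integral_pderiv`) is needed only for polynomials that vanish a.e. on the
boundary outside the planar faces, and it follows from Fubini along coordinate lines. Almost every
line avoids the exceptional boundary points, since projections are Lipschitz and send null sets to
null sets. On such a line the polynomial is nonzero at a boundary point only where the line crosses
a face transversally, and a one-dimensional fundamental theorem of calculus applies
(`integral_derivative_of_isOpen`). The area formula is thus used only on planes.

Linearity of the right-hand side requires integrability, hence measurability of the pointwise chosen
outward normal (`IsPiecewiseC2Domain.aestronglyMeasurable_outwardNormal`). -/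

noncomputable section

namespace HHO

/-! ### Slicing `ℝⁿ⁺¹` along a coordinate direction -/

section Slice

variable {n : ℕ}

/-- The projection of `ℝⁿ⁺¹` onto `ℝⁿ` that forgets the coordinate `i`. -/
def proj (i : Fin (n + 1)) (x : Pt (n + 1)) : Pt n := WithLp.toLp 2 fun j => x (i.succAbove j)

/-- The point of `ℝⁿ⁺¹` with `i`-th coordinate `t` and remaining coordinates `y`. -/
def slice (i : Fin (n + 1)) (t : ℝ) (y : Pt n) : Pt (n + 1) :=
  WithLp.toLp 2 (i.insertNth (α := fun _ => ℝ) t y)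

@[simp] lemma proj_apply (i : Fin (n + 1)) (x : Pt (n + 1)) (j : Fin n) :
    proj i x j = x (i.succAbove j) := rfl

@[simp] lemma slice_same (i : Fin (n + 1)) (t : ℝ) (y : Pt n) : slice i t y i = t := by
  simp [slice]

@[simp] lemma slice_succAbove (i : Fin (n + 1)) (t : ℝ) (y : Pt n) (j : Fin n) :
    slice i t y (i.succAbove j) = y j := by
  simp [slice]

@[simp] lemma proj_slice (i : Fin (n + 1)) (t : ℝ) (y : Pt n) : proj i (slice i t y) = y := by
  ext j; simp

@[simp] lemma slice_proj (i : Fin (n + 1)) (x : Pt (n + 1)) : slice i (x i) (proj i x) = x := by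
  ext j
  rcases Fin.eq_self_or_eq_succAbove i j with rfl | ⟨k, rfl⟩ <;> simp

lemma slice_add_smul (i : Fin (n + 1)) (t s : ℝ) (y : Pt n) :
    slice i (t + s) y = slice i t y + s • EuclideanSpace.single i 1 := by
  ext j
  rcases Fin.eq_self_or_eq_succAbove i j with rfl | ⟨k, rfl⟩ <;> simp

lemma sum_sq_proj (i : Fin (n + 1)) (x : Pt (n + 1)) :
    ‖x‖ ^ 2 = x i ^ 2 + ‖proj i x‖ ^ 2 := by
  simp [EuclideanSpace.norm_sq_eq, Fin.sum_univ_succAbove _ i]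

lemma inner_eq_slice (i : Fin (n + 1)) (x z : Pt (n + 1)) :
    ⟪x, z⟫_ℝ = x i * z i + ⟪proj i x, proj i z⟫_ℝ := by
  simp [PiLp.inner_apply, Fin.sum_univ_succAbove _ i, mul_comm]

lemma lipschitz_proj (i : Fin (n + 1)) : LipschitzWith 1 (proj i) := by
  refine LipschitzWith.of_dist_le_mul fun x z => ?_
  have h : proj i x - proj i z = proj i (x - z) := by ext j; simp
  rw [dist_eq_norm, dist_eq_norm, h, NNReal.coe_one, one_mul]
  have := sum_sq_proj i (x - z)
  exact le_of_sq_le_sq (by nlinarith [sq_nonneg ((x - z) i)]) (norm_nonneg _)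

lemma continuous_slice (i : Fin (n + 1)) : Continuous fun q : ℝ × Pt n => slice i q.1 q.2 := by
  refine (PiLp.continuous_toLp 2 _).comp (continuous_pi fun j => ?_)
  rcases Fin.eq_self_or_eq_succAbove i j with rfl | ⟨k, rfl⟩
  · simpa using continuous_fst
  · simp only [Fin.insertNth_apply_succAbove]
    exact (EuclideanSpace.proj k).continuous.comp continuous_snd

/-- Slicing as a homeomorphism. -/
def sliceHomeo (i : Fin (n + 1)) : ℝ × Pt n ≃ₜ Pt (n + 1) where
  toFun q := slice i q.1 q.2
  invFun x := (x i, proj i x)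
  left_inv q := by simp
  right_inv x := by simp
  continuous_toFun := continuous_slice i
  continuous_invFun := ((EuclideanSpace.proj i).continuous).prodMk (lipschitz_proj i).continuous

lemma measurePreserving_slice (i : Fin (n + 1)) :
    MeasurePreserving (sliceHomeo i) (volume.prod volume) volume := by
  have h1 := (volume_preserving_piFinSuccAbove (fun _ : Fin (n + 1) => ℝ) i).symm
  have h2 := EuclideanSpace.volume_preserving_symm_measurableEquiv_toLp (Fin n)
  have h3 := (EuclideanSpace.volume_preserving_symm_measurableEquiv_toLp (Fin (n + 1))).symm
  have h := h3.comp (h1.comp ((MeasurePreserving.id (volume : Measure ℝ)).prod h2))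
  exact h

/-- A 1-Lipschitz map does not increase Hausdorff measure, and the normalised measures differ from
it only by nonzero factors. This is what discards exceptional boundary sets in the Fubini argument.
-/
lemma volume_proj_image_eq_zero (i : Fin (n + 1)) {Z : Set (Pt (n + 1))}
    (hZ : surf (n + 1) Z = 0) : volume (proj i '' Z) = 0 := by
  rw [← EuclideanSpace.euclideanHausdorffMeasure_eq_volume]
  simp only [surf, Nat.add_sub_cancel, Measure.euclideanHausdorffMeasure_def, Measure.smul_apply,
    smul_eq_zero, Measure.addHaarScalarFactor_volume_hausdorffMeasure_ne_zero, false_or] at hZ ⊢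
  have := (lipschitz_proj i).hausdorffMeasure_image_le (d := n) (by positivity) Z
  simpa [hZ] using this

/-- The parametrisation of the hyperplane `{N · x = c}` by the coordinates other than `i`. -/
def planeParam (i : Fin (n + 1)) (N : Pt (n + 1)) (c : ℝ) (y : Pt n) : Pt (n + 1) :=
  slice i ((c - ⟪proj i N, y⟫_ℝ) / N i) y

lemma planeParam_proj {i : Fin (n + 1)} {N : Pt (n + 1)} (hi : N i ≠ 0) {c : ℝ} {x : Pt (n + 1)}
    (hx : ⟪N, x⟫_ℝ = c) : planeParam i N c (proj i x) = x := by
  have : (c - ⟪proj i N, proj i x⟫_ℝ) / N i = x i := by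
    rw [← hx, inner_eq_slice i]; field_simp; ring
  rw [planeParam, this, slice_proj]

@[simp] lemma proj_planeParam (i : Fin (n + 1)) (N : Pt (n + 1)) (c : ℝ) (y : Pt n) :
    proj i (planeParam i N c y) = y := by simp [planeParam]

lemma continuous_planeParam (i : Fin (n + 1)) (N : Pt (n + 1)) (c : ℝ) :
    Continuous (planeParam i N c) :=
  (continuous_slice i).comp (by fun_prop : Continuous fun y : Pt n =>
    ((c - ⟪proj i N, y⟫_ℝ) / N i, y))

/-- The linear part of `planeParam`. -/
def planeLin (i : Fin (n + 1)) (N : Pt (n + 1)) : Pt n →ₗ[ℝ] Pt (n + 1) where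
  toFun y := slice i (-⟪proj i N, y⟫_ℝ / N i) y
  map_add' y z := by
    ext j
    rcases Fin.eq_self_or_eq_succAbove i j with rfl | ⟨k, rfl⟩
    · simp [inner_add_right]; ring
    · simp
  map_smul' r y := by
    ext j
    rcases Fin.eq_self_or_eq_succAbove i j with rfl | ⟨k, rfl⟩
    · simp [inner_smul_right]; ring
    · simp

lemma planeParam_eq (i : Fin (n + 1)) (N : Pt (n + 1)) (c : ℝ) (y : Pt n) :
    planeParam i N c y = (c / N i) • EuclideanSpace.single i 1 + planeLin i N y := by
  ext j
  rcases Fin.eq_self_or_eq_succAbove i j with rfl | ⟨k, rfl⟩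
  · simp [planeParam, planeLin]; ring
  · simp [planeParam, planeLin]

/-- The Gram matrix of the columns is I + a aᵀ with a = (N_j / N_i)_{j ≠ i}, so its determinant is 1
+ |a|², which equals 1 / N_i² because N is a unit vector. -/
lemma normDet_planeLin {i : Fin (n + 1)} {N : Pt (n + 1)} (hi : N i ≠ 0) (hN : ‖N‖ = 1) :
    (planeLin i N).normDet = |N i|⁻¹ := by
  have h := (planeLin i N).normDet_sq_eq_det_gram (EuclideanSpace.basisFun (Fin n) ℝ)
  have hg : Matrix.gram ℝ (fun j => planeLin i N (EuclideanSpace.basisFun (Fin n) ℝ j)) =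
      1 + Matrix.replicateCol Unit (fun j => proj i N j / N i) *
        Matrix.replicateRow Unit (fun j => proj i N j / N i) := by
    ext j k
    rw [Matrix.gram_apply, inner_eq_slice i]
    simp [planeLin, Matrix.mul_apply, Matrix.one_apply, EuclideanSpace.inner_single_right, eq_comm]
    ring
  rw [hg, Matrix.det_one_add_replicateCol_mul_replicateRow] at h
  have h1 : 1 + (fun j => proj i N j / N i) ⬝ᵥ (fun j => proj i N j / N i) = (|N i|⁻¹) ^ 2 := by
    have h2 := sum_sq_proj i N
    rw [hN, EuclideanSpace.norm_sq_eq] at h2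
    have h3 : (fun j => proj i N j / N i) ⬝ᵥ (fun j => proj i N j / N i)
        = (∑ j, ‖proj i N j‖ ^ 2) / N i ^ 2 := by
      rw [dotProduct, Finset.sum_div]
      exact Finset.sum_congr rfl fun j _ => by rw [Real.norm_eq_abs, sq_abs]; ring
    rw [h3, inv_pow, sq_abs]
    field_simp
    linarith
  rw [h1] at h
  exact (sq_eq_sq₀ (LinearMap.normDet_nonneg _) (by positivity)).1 (by exact_mod_cast h)

lemma surf_planeParam_image {i : Fin (n + 1)} {N : Pt (n + 1)} (hi : N i ≠ 0) (hN : ‖N‖ = 1)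
    (c : ℝ) (A : Set (Pt n)) :
    ENNReal.ofReal |N i| * surf (n + 1) (planeParam i N c '' A) = volume A := by
  have h : planeParam i N c '' A
      = (fun x => (c / N i) • EuclideanSpace.single i (1 : ℝ) + x) '' (planeLin i N '' A) := by
    rw [Set.image_image]; exact Set.image_congr fun y _ => planeParam_eq i N c y
  have h2 := (planeLin i N).euclideanHausdorffMeasure_image_eq_normDet_mul_volume A
  rw [finrank_euclideanSpace_fin] at h2
  rw [h, surf, Nat.add_sub_cancel, (isometry_add_left _).euclideanHausdorffMeasure_image, h2,
    normDet_planeLin hi hN, ← mul_assoc, ← ENNReal.ofReal_mul (abs_nonneg _),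
    mul_inv_cancel₀ (by positivity), ENNReal.ofReal_one, one_mul]

lemma volume_proj_image {i : Fin (n + 1)} {N : Pt (n + 1)} (hi : N i ≠ 0) (hN : ‖N‖ = 1)
    {c : ℝ} {F : Set (Pt (n + 1))} (hF : ∀ x ∈ F, ⟪N, x⟫_ℝ = c) :
    volume (proj i '' F) = ENNReal.ofReal |N i| * surf (n + 1) F := by
  rw [← surf_planeParam_image hi hN c, Set.image_image]
  congr 2
  rw [Set.image_congr fun x hx => planeParam_proj hi (hF x hx), Set.image_id']

lemma proj_image_eq_preimage {i : Fin (n + 1)} {N : Pt (n + 1)} (hi : N i ≠ 0)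
    {c : ℝ} {F : Set (Pt (n + 1))} (hF : ∀ x ∈ F, ⟪N, x⟫_ℝ = c) :
    proj i '' F = planeParam i N c ⁻¹' F := by
  ext y
  constructor
  · rintro ⟨x, hx, rfl⟩
    rwa [Set.mem_preimage, planeParam_proj hi (hF x hx)]
  · intro hy
    exact ⟨_, hy, proj_planeParam ..⟩

/-- The area formula for a planar set that is parametrised by all but one of the coordinates. -/
lemma integral_proj_image {i : Fin (n + 1)} {N : Pt (n + 1)} (hi : N i ≠ 0) (hN : ‖N‖ = 1)
    {c : ℝ} {F : Set (Pt (n + 1))} (hF : ∀ x ∈ F, ⟪N, x⟫_ℝ = c)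
    (f : Pt (n + 1) → ℝ) :
    ∫ y in proj i '' F, f (planeParam i N c y) = |N i| * ∫ x in F, f x ∂surf (n + 1) := by
  have hinj : Function.Injective (planeParam i N c) :=
    Function.LeftInverse.injective (g := proj i) fun y => proj_planeParam ..
  have hemb : MeasurableEmbedding (planeParam i N c) :=
    (continuous_planeParam i N c).measurableEmbedding hinj
  have hmap : (volume.restrict (proj i '' F)).map (planeParam i N c)
      = ENNReal.ofReal |N i| • (surf (n + 1)).restrict F := by
    ext A hA
    have hA' := hemb.measurable hA
    rw [hemb.map_apply, Measure.restrict_apply hA', Measure.smul_apply,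
      Measure.restrict_apply hA, smul_eq_mul,
      ← volume_proj_image hi hN (F := A ∩ F) fun x hx => hF x hx.2,
      proj_image_eq_preimage hi hF, proj_image_eq_preimage hi (F := A ∩ F) fun x hx => hF x hx.2,
      Set.preimage_inter]
  rw [← hemb.integral_map, hmap, integral_smul_measure, ENNReal.toReal_ofReal (abs_nonneg _),
    smul_eq_mul]

/-- The plane is parallel to the direction i, so its shadow lies in a hyperplane of ℝⁿ, with normal
`proj i N` ≠ 0. -/
lemma volume_proj_image_of_normal_eq_zero {i : Fin (n + 1)} {N : Pt (n + 1)} (hi : N i = 0)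
    (hN : ‖N‖ = 1) {c : ℝ} {F : Set (Pt (n + 1))} (hF : ∀ x ∈ F, ⟪N, x⟫_ℝ = c) :
    volume (proj i '' F) = 0 := by
  have hp : ⟪proj i N, proj i N⟫_ℝ = 1 := by
    have := sum_sq_proj i N
    rw [hi, hN] at this
    rw [real_inner_self_eq_norm_sq]; linarith
  rcases F.eq_empty_or_nonempty with rfl | ⟨x₀, hx₀⟩
  · simp
  let s : AffineSubspace ℝ (Pt n) := AffineSubspace.mk' (proj i x₀) (LinearMap.ker (innerₛₗ ℝ (proj i N)))
  have hs : s ≠ ⊤ := by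
    intro h
    have : proj i x₀ + proj i N ∈ s := h ▸ AffineSubspace.mem_top ..
    simp [s, AffineSubspace.mem_mk'] at this
    have h0 : proj i N = 0 := by simpa using this
    simp [h0] at hp
  refine measure_mono_null ?_ (Measure.addHaar_affineSubspace volume s hs)
  rintro _ ⟨x, hx, rfl⟩
  have h1 := hF x hx
  have h2 := hF x₀ hx₀
  rw [inner_eq_slice i, hi] at h1 h2
  change proj i x ∈ s
  rw [AffineSubspace.mem_mk', LinearMap.mem_ker]
  simp [inner_sub_right]
  linarith

end Slice

/-! ### The fundamental theorem of calculus on a bounded open subset of the line -/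

/-- The step function at `t` that compensates the jump, of height `a`, that a function has at `t`
with the value of the vanishing side: the function vanishes to the right of `t` if `σ`, and to the
left of `t` otherwise. -/
def stepAt (σ : Prop) [Decidable σ] (t a : ℝ) (x : ℝ) : ℝ :=
  if σ then (if t ≤ x then a else 0) else (if t < x then -a else 0)

lemma stepAt_eventuallyEq (σ : Prop) [Decidable σ] {t a x : ℝ} (h : t ≠ x) :
    stepAt σ t a =ᶠ[𝓝 x] fun _ => stepAt σ t a x := by
  rcases h.lt_or_gt with h | h
  · filter_upwards [eventually_gt_nhds h] with y hy
    simp [stepAt, hy, h, hy.le, h.le]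
  · filter_upwards [eventually_lt_nhds h] with y hy
    simp [stepAt, hy.not_ge, h.not_ge, hy.le.not_gt, h.le.not_gt]

lemma indicator_eventuallyEq_of_mem {O : Set ℝ} (hO : IsOpen O) (f : ℝ → ℝ) {x : ℝ} (hx : x ∈ O) :
    O.indicator f =ᶠ[𝓝 x] f := by
  filter_upwards [hO.mem_nhds hx] with y hy using Set.indicator_of_mem hy f

lemma indicator_eventuallyEq_zero {O : Set ℝ} (f : ℝ → ℝ) {x : ℝ} (hx : x ∉ closure O) :
    O.indicator f =ᶠ[𝓝 x] fun _ => 0 := by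
  filter_upwards [isClosed_closure.isOpen_compl.mem_nhds hx] with y hy
    using Set.indicator_of_notMem (fun h => hy (subset_closure h)) f

/-- Since t is not in O, the indicator takes the value 0 at t. If O lies to the left, the step must
therefore already be active at t; if O lies to the right, it must start strictly after t. This is
the reason for `≤` in one branch of `stepAt` and `<` in the other. -/
lemma continuousAt_indicator_add_stepAt {O : Set ℝ} {f : ℝ → ℝ} (hf : Continuous f) {t : ℝ}
    (ht : t ∉ O) (σ : Prop) [Decidable σ]
    (h1 : σ → (∀ᶠ x in 𝓝[<] t, x ∈ O) ∧ ∀ᶠ x in 𝓝[>] t, x ∉ O)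
    (h2 : ¬σ → (∀ᶠ x in 𝓝[<] t, x ∉ O) ∧ ∀ᶠ x in 𝓝[>] t, x ∈ O) :
    ContinuousAt (fun x => O.indicator f x + stepAt σ t (f t) x) t := by
  rw [continuousAt_iff_continuous_left'_right']
  by_cases hσ : σ
  · obtain ⟨hl, hr⟩ := h1 hσ
    constructor
    · refine hf.continuousWithinAt.congr_of_eventuallyEq ?_ (by simp [stepAt, hσ, ht])
      filter_upwards [hl, self_mem_nhdsWithin] with x hx hxt
      simp [stepAt, hσ, hx, not_le.2 (show x < t from hxt)]
    · refine (continuousWithinAt_const (b := f t)).congr_of_eventuallyEq ?_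
        (by simp [stepAt, hσ, ht])
      filter_upwards [hr, self_mem_nhdsWithin] with x hx hxt
      simp [stepAt, hσ, hx, (show t < x from hxt).le]
  · obtain ⟨hl, hr⟩ := h2 hσ
    constructor
    · refine (continuousWithinAt_const (b := 0)).congr_of_eventuallyEq ?_
        (by simp [stepAt, hσ, ht])
      filter_upwards [hl, self_mem_nhdsWithin] with x hx hxt
      simp [stepAt, hσ, hx, (show x < t from hxt).le.not_gt]
    · refine ((hf.sub continuous_const : Continuous fun x => f x - f t).continuousWithinAt
        ).congr_of_eventuallyEq ?_ (by simp [stepAt, hσ, ht])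
      filter_upwards [hr, self_mem_nhdsWithin] with x hx hxt
      simp [stepAt, hσ, hx, show t < x from hxt, sub_eq_add_neg]

open Classical in
/-- The integral of the derivative of a polynomial `g` over a bounded open subset `O` of the line is
the sum of the values of `g`, with signs, at the boundary points of `O`, if `g` vanishes at all but
finitely many of them, and if each of these is a boundary point of just one interval in `O`. -/
lemma integral_derivative_of_isOpen {O : Set ℝ} (hO : IsOpen O) (hb : Bornology.IsBounded O)
    (g : Polynomial ℝ) {ι : Type*} (J : Finset ι) (t : ι → ℝ) (σ : ι → Prop)
    (hinj : Set.InjOn t J) (ht : ∀ j ∈ J, t j ∈ frontier O)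
    (h0 : ∀ x ∈ frontier O, g.eval x ≠ 0 → ∃ j ∈ J, t j = x)
    (h1 : ∀ j ∈ J, σ j → (∀ᶠ x in 𝓝[<] (t j), x ∈ O) ∧ ∀ᶠ x in 𝓝[>] (t j), x ∉ O)
    (h2 : ∀ j ∈ J, ¬σ j → (∀ᶠ x in 𝓝[<] (t j), x ∉ O) ∧ ∀ᶠ x in 𝓝[>] (t j), x ∈ O) :
    ∫ x in O, g.derivative.eval x = ∑ j ∈ J, (if σ j then 1 else -1) * g.eval (t j) := by
  by_cases hg : g = 0
  · simp [hg]
  -- Apart from the points `t j`, the frontier consists of roots of g. Finiteness allows the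
  -- fundamental theorem of calculus to ignore differentiability on the frontier.
  have hfin : (frontier O).Finite := by
    refine ((J.finite_toSet.image t).union (g.rootSet_finite ℝ)).subset fun x hx => ?_
    by_cases hx0 : g.eval x = 0
    · exact Or.inr (by simp [Polynomial.mem_rootSet, hg, hx0])
    · exact Or.inl (by simpa using h0 x hx hx0)
  obtain ⟨M, hM⟩ : ∃ M : ℝ, closure O ⊆ Set.Ioo (-M) M := by
    obtain ⟨M, hM⟩ := hb.closure.subset_ball 0
    exact ⟨M, fun x hx => by simpa [abs_lt] using hM hx⟩
  have hfO : ∀ x ∈ frontier O, x ∉ O := fun x hx hxO => by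
    rw [hO.frontier_eq] at hx; exact hx.2 hxO
  -- The steps remove all jumps of the indicator: this function is continuous, it vanishes to the
  -- left of O, and to the right of O it equals the signed sum of the values of g.
  let f : ℝ → ℝ := fun x => O.indicator g.eval x + ∑ j ∈ J, stepAt (σ j) (t j) (g.eval (t j)) x
  have hgc : Continuous fun x => g.eval x := g.continuous
  have hcont : ∀ x, ContinuousAt f x := by
    intro x
    have hstep : ∀ j, t j ≠ x → ContinuousAt (stepAt (σ j) (t j) (g.eval (t j))) x := fun j hj =>
      continuousAt_const.congr (stepAt_eventuallyEq (σ j) hj).symm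
    by_cases hx : x ∈ frontier O
    · by_cases hx0 : ∃ j ∈ J, t j = x
      · obtain ⟨j, hj, rfl⟩ := hx0
        have hf : f = fun x => (O.indicator g.eval x + stepAt (σ j) (t j) (g.eval (t j)) x) +
            ∑ l ∈ J.erase j, stepAt (σ l) (t l) (g.eval (t l)) x := by
          funext x
          rw [add_assoc, Finset.add_sum_erase _ (fun l => stepAt (σ l) (t l) (g.eval (t l)) x) hj]
        rw [hf]
        refine (continuousAt_indicator_add_stepAt hgc (hfO _ hx) (σ j) (h1 j hj) (h2 j hj)).add
          (tendsto_finsetSum _ fun l hl => ?_)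
        exact hstep l fun h => (Finset.mem_erase.1 hl).1 (hinj (Finset.mem_erase.1 hl).2 hj h)
      -- No jump here: the indicator is dominated by |g|, which tends to 0.
      · have hgx : g.eval x = 0 := by
          by_contra h; exact hx0 (h0 x hx h)
        refine ContinuousAt.add ?_ (tendsto_finsetSum _ fun l hl => hstep l fun h => hx0 ⟨l, hl, h⟩)
        rw [ContinuousAt, Set.indicator_of_notMem (hfO x hx)]
        have : Filter.Tendsto (fun x => g.eval x) (𝓝 x) (𝓝 0) := by
          have := hgc.tendsto x; rwa [hgx] at this
        refine squeeze_zero_norm (fun y => ?_) (tendsto_zero_iff_norm_tendsto_zero.1 this)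
        exact norm_indicator_le_norm_self _ _
    · refine ContinuousAt.add ?_ (tendsto_finsetSum _ fun l hl => hstep l fun h =>
        hx (h ▸ ht l hl))
      by_cases hxO : x ∈ O
      · exact hgc.continuousAt.congr (indicator_eventuallyEq_of_mem hO _ hxO).symm
      · have : x ∉ closure O := fun h => hx (by rw [hO.frontier_eq]; exact ⟨h, hxO⟩)
        exact continuousAt_const.congr (indicator_eventuallyEq_zero _ this).symm
  have hderiv : ∀ x, x ∉ frontier O →
      HasDerivAt f (O.indicator (fun x => g.derivative.eval x) x) x := by
    intro x hx
    have hs : HasDerivAt (fun x => ∑ j ∈ J, stepAt (σ j) (t j) (g.eval (t j)) x) 0 x := by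
      have := HasDerivAt.fun_sum (u := J) (A := fun j => stepAt (σ j) (t j) (g.eval (t j)))
        (A' := fun _ => 0) (x := x) fun j hj => (hasDerivAt_const x _).congr_of_eventuallyEq
          (stepAt_eventuallyEq (σ j) fun h => hx (h ▸ ht j hj))
      simpa using this
    have hi : HasDerivAt (O.indicator g.eval)
        (O.indicator (fun x => g.derivative.eval x) x) x := by
      by_cases hxO : x ∈ O
      · rw [Set.indicator_of_mem hxO]
        exact (g.hasDerivAt x).congr_of_eventuallyEq (indicator_eventuallyEq_of_mem hO _ hxO)
      · rw [Set.indicator_of_notMem hxO]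
        have : x ∉ closure O := fun h => hx (by rw [hO.frontier_eq]; exact ⟨h, hxO⟩)
        exact (hasDerivAt_const x 0).congr_of_eventuallyEq (indicator_eventuallyEq_zero _ this)
    have := hi.add hs
    rwa [add_zero] at this
  have hint : IntervalIntegrable (O.indicator fun x => g.derivative.eval x) volume (-M) M :=
    ⟨((g.derivative.continuous.integrableOn_Icc).mono_set Set.Ioc_subset_Icc_self).indicator
      hO.measurableSet, ((g.derivative.continuous.integrableOn_Icc).mono_set
        Set.Ioc_subset_Icc_self).indicator hO.measurableSet⟩
  have hftc := integral_eq_of_hasDerivAt_off_countable f _ hfin.countable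
    (fun x _ => (hcont x).continuousWithinAt) (fun x hx => hderiv x hx.2) hint
  have hO' : O ⊆ Set.Ioo (-M) M := subset_closure.trans hM
  have htM : ∀ j ∈ J, t j ∈ Set.Ioo (-M) M := fun j hj => hM (frontier_subset_closure (ht j hj))
  have hl : f (-M) = 0 := by
    have : -M ∉ O := fun h => lt_irrefl _ (hO' h).1
    simp only [f, Set.indicator_of_notMem this, zero_add]
    refine Finset.sum_eq_zero fun j hj => ?_
    simp [stepAt, (htM j hj).1.not_ge, (htM j hj).1.le.not_gt]
  have hr : f M = ∑ j ∈ J, (if σ j then 1 else -1) * g.eval (t j) := by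
    have : M ∉ O := fun h => lt_irrefl _ (hO' h).2
    simp only [f, Set.indicator_of_notMem this, zero_add]
    refine Finset.sum_congr rfl fun j hj => ?_
    by_cases hσ : σ j <;> simp [stepAt, hσ, (htM j hj).2, (htM j hj).2.le]
  rw [hl, hr, sub_zero] at hftc
  rw [← hftc]
  by_cases hM0 : -M ≤ M
  · rw [intervalIntegral.integral_of_le hM0, setIntegral_indicator hO.measurableSet,
      Set.inter_eq_right.2 (hO'.trans Set.Ioo_subset_Ioc_self)]
  · have : O = ∅ := Set.subset_empty_iff.1 (hO'.trans (by rw [Set.Ioo_eq_empty fun h => hM0 h.le]))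
    simp [this]

/-! ### Outward normals -/

section Normal

variable {d : ℕ}

/-- The derivative of ρ along v at x is c⟪N, v⟫ > 0, so ρ is negative just before x and positive
just after it. -/
lemma IsOutwardNormalAt.eventually {S : Set (Pt d)} {x N v : Pt d} (h : IsOutwardNormalAt S x N)
    (hv : 0 < ⟪N, v⟫_ℝ) :
    (∀ᶠ τ : ℝ in 𝓝[<] 0, x + τ • v ∈ S) ∧ ∀ᶠ τ : ℝ in 𝓝[>] 0, x + τ • v ∉ S := by
  obtain ⟨-, ρ, hρ, h0, ⟨c, hc, hg⟩, hS⟩ := h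
  have hline : HasDerivAt (fun τ : ℝ => x + τ • v) v 0 := by
    simpa using ((hasDerivAt_id (0 : ℝ)).smul_const v).const_add x
  have hd : HasDerivAt (fun τ : ℝ => ρ (x + τ • v)) (c * ⟪N, v⟫_ℝ) 0 := by
    have h1 : HasFDerivAt ρ (innerSL ℝ (gradient ρ x)) (x + (0 : ℝ) • v) := by
      rw [zero_smul, add_zero]
      exact (hρ.differentiableAt (by norm_num)).hasGradientAt.hasFDerivAt
    have := h1.comp_hasDerivAt (0 : ℝ) hline
    rwa [hg, innerSL_apply_apply, real_inner_smul_left] at this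
  have hpos : ∀ᶠ τ in 𝓝[≠] (0 : ℝ), 0 < slope (fun τ : ℝ => ρ (x + τ • v)) 0 τ :=
    (hasDerivAt_iff_tendsto_slope.1 hd).eventually (lt_mem_nhds (mul_pos hc hv))
  have hS' : ∀ᶠ τ : ℝ in 𝓝 0, (x + τ • v ∈ S ↔ ρ (x + τ • v) < 0) := by
    have := hline.continuousAt.tendsto
    simp only [zero_smul, add_zero] at this
    exact this.eventually hS
  constructor
  · filter_upwards [hpos.filter_mono (nhdsWithin_mono 0 fun τ (hτ : τ < 0) => hτ.ne),
      hS'.filter_mono nhdsWithin_le_nhds, self_mem_nhdsWithin] with τ h1 h2 h3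
    rw [h2]
    rw [slope_def_field] at h1
    have h3 : τ < 0 := h3
    simp [h0] at h1
    rcases div_pos_iff.1 h1 with h | h
    · exact absurd h3 h.2.not_gt
    · exact h.1
  · filter_upwards [hpos.filter_mono (nhdsWithin_mono 0 fun τ (hτ : 0 < τ) => hτ.ne'),
      hS'.filter_mono nhdsWithin_le_nhds, self_mem_nhdsWithin] with τ h1 h2 h3
    rw [h2]
    rw [slope_def_field] at h1
    have h3 : 0 < τ := h3
    simp [h0] at h1
    rcases div_pos_iff.1 h1 with h | h
    · exact h.1.not_gt
    · exact absurd h3 h.2.not_gt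

/-- If N ≠ N', the direction N - N' leaves S according to N and enters S according to N'. -/
lemma IsOutwardNormalAt.unique {S : Set (Pt d)} {x N N' : Pt d} (h : IsOutwardNormalAt S x N)
    (h' : IsOutwardNormalAt S x N') : N = N' := by
  by_contra hne
  have hlt : ⟪N, N'⟫_ℝ < 1 := by
    refine lt_of_le_of_ne ?_ fun h1 => hne ((inner_eq_one_iff_of_norm_eq_one h.1 h'.1).1 h1)
    simpa [h.1, h'.1] using real_inner_le_norm N N'
  have h1 := h.eventually (v := N - N') (by
    rw [inner_sub_right, real_inner_self_eq_norm_sq, h.1]; linarith)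
  have h2 := h'.eventually (v := N' - N) (by
    rw [inner_sub_right, real_inner_self_eq_norm_sq, h'.1, real_inner_comm]; linarith)
  have h3 : ∀ᶠ τ : ℝ in 𝓝[>] 0, x + (-τ) • (N' - N) ∈ S := by
    have : Filter.Tendsto (fun τ : ℝ => -τ) (𝓝[>] 0) (𝓝[<] 0) := by
      simpa using tendsto_neg_nhdsGT (a := (0 : ℝ))
    exact this.eventually h2.1
  obtain ⟨τ, ha, hb⟩ := (h1.2.and h3).exists
  exact ha (by rwa [neg_smul, ← smul_neg, neg_sub] at hb)

end Normal

/-! ### Polynomial functions on slices -/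

section Ev

variable {d : ℕ}

/-- The polynomial function on `ℝᵈ` defined by a multivariate polynomial. -/
def ev (p : MvPolynomial (Fin d) ℝ) (x : Pt d) : ℝ := MvPolynomial.eval (fun i => x i) p

lemma continuous_ev (p : MvPolynomial (Fin d) ℝ) : Continuous (ev p) :=
  (MvPolynomial.continuous_eval p).comp (by fun_prop)

@[simp] lemma ev_add (p q : MvPolynomial (Fin d) ℝ) (x : Pt d) : ev (p + q) x = ev p x + ev q x := by
  simp [ev]

@[simp] lemma ev_sub (p q : MvPolynomial (Fin d) ℝ) (x : Pt d) : ev (p - q) x = ev p x - ev q x := by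
  simp [ev]

@[simp] lemma ev_mul (p q : MvPolynomial (Fin d) ℝ) (x : Pt d) : ev (p * q) x = ev p x * ev q x := by
  simp [ev]

@[simp] lemma ev_zero (x : Pt d) : ev 0 x = 0 := by simp [ev]

@[simp] lemma ev_one (x : Pt d) : ev 1 x = 1 := by simp [ev]

@[simp] lemma ev_C (r : ℝ) (x : Pt d) : ev (MvPolynomial.C r) x = r := by simp [ev]

@[simp] lemma ev_X (i : Fin d) (x : Pt d) : ev (MvPolynomial.X i) x = x i := by simp [ev]

@[simp] lemma ev_smul (r : ℝ) (p : MvPolynomial (Fin d) ℝ) (x : Pt d) :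
    ev (r • p) x = r * ev p x := by
  simp [ev, MvPolynomial.smul_eval]

@[simp] lemma ev_sum {ι : Type*} (s : Finset ι) (p : ι → MvPolynomial (Fin d) ℝ) (x : Pt d) :
    ev (∑ j ∈ s, p j) x = ∑ j ∈ s, ev (p j) x := by
  simp [ev, map_sum]

variable {n : ℕ}

/-- The restriction of a polynomial to the line `t ↦ slice i t y`. -/
def linePoly (i : Fin (n + 1)) (y : Pt n) : MvPolynomial (Fin (n + 1)) ℝ →ₐ[ℝ] Polynomial ℝ :=
  MvPolynomial.aeval
    (i.insertNth (α := fun _ => Polynomial ℝ) Polynomial.X fun k => Polynomial.C (y k))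

lemma eval_linePoly (i : Fin (n + 1)) (y : Pt n) (p : MvPolynomial (Fin (n + 1)) ℝ) (t : ℝ) :
    (linePoly i y p).eval t = ev p (slice i t y) := by
  induction p using MvPolynomial.induction_on with
  | C a => simp [linePoly]
  | add p q hp hq => simp [hp, hq]
  | mul_X p j hp =>
    rw [map_mul, Polynomial.eval_mul, hp, ev_mul, ev_X]
    rcases Fin.eq_self_or_eq_succAbove i j with rfl | ⟨k, rfl⟩ <;> simp [linePoly]

lemma derivative_linePoly (i : Fin (n + 1)) (y : Pt n) (p : MvPolynomial (Fin (n + 1)) ℝ) :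
    Polynomial.derivative (linePoly i y p) = linePoly i y (MvPolynomial.pderiv i p) := by
  induction p using MvPolynomial.induction_on with
  | C a => simp [linePoly]
  | add p q hp hq => simp [hp, hq]
  | mul_X p j hp =>
    rw [map_mul, Polynomial.derivative_mul, hp, MvPolynomial.pderiv_mul]
    rcases Fin.eq_self_or_eq_succAbove i j with rfl | ⟨k, rfl⟩
    · simp [linePoly]
    · simp [linePoly, MvPolynomial.pderiv_X_of_ne (Fin.succAbove_ne i k)]

end Ev

/-! ### The divergence theorem for polynomials -/

section Divergence

variable {n : ℕ}

lemma eventually_slice {i : Fin (n + 1)} {y : Pt n} {t : ℝ} {v : ℝ} {K : Set (Pt (n + 1))}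
    {N : Pt (n + 1)} (h : IsOutwardNormalAt K (slice i t y) N) (hv : 0 < v * N i) :
    (∀ᶠ τ : ℝ in 𝓝[<] 0, slice i (t + τ * v) y ∈ K) ∧
      ∀ᶠ τ : ℝ in 𝓝[>] 0, slice i (t + τ * v) y ∉ K := by
  have := h.eventually (v := v • EuclideanSpace.single i 1) (by
    simpa [inner_smul_right, EuclideanSpace.inner_single_right] using hv)
  simpa only [slice_add_smul, mul_smul] using this

/-- The position of an open set on the two sides of a boundary point on a line that crosses the
boundary there. -/
lemma slice_mem_sides {i : Fin (n + 1)} {y : Pt n} {t : ℝ} {K : Set (Pt (n + 1))}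
    {N : Pt (n + 1)} (h : IsOutwardNormalAt K (slice i t y) N) (hi : N i ≠ 0) :
    (0 < N i → (∀ᶠ x in 𝓝[<] t, slice i x y ∈ K) ∧ ∀ᶠ x in 𝓝[>] t, slice i x y ∉ K) ∧
    (¬0 < N i → (∀ᶠ x in 𝓝[<] t, slice i x y ∉ K) ∧ ∀ᶠ x in 𝓝[>] t, slice i x y ∈ K) := by
  have hc : Continuous fun x : ℝ => x - t := by fun_prop
  have hc' : Continuous fun x : ℝ => t - x := by fun_prop
  have hl : Filter.Tendsto (fun x : ℝ => x - t) (𝓝[<] t) (𝓝[<] 0) :=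
    tendsto_nhdsWithin_of_tendsto_nhds_of_eventually_within _
      (by simpa using (hc.tendsto t).mono_left nhdsWithin_le_nhds)
      (by filter_upwards [self_mem_nhdsWithin] with x hx using sub_neg.2 (Set.mem_Iio.1 hx))
  have hr : Filter.Tendsto (fun x : ℝ => x - t) (𝓝[>] t) (𝓝[>] 0) :=
    tendsto_nhdsWithin_of_tendsto_nhds_of_eventually_within _
      (by simpa using (hc.tendsto t).mono_left nhdsWithin_le_nhds)
      (by filter_upwards [self_mem_nhdsWithin] with x hx using sub_pos.2 (Set.mem_Ioi.1 hx))
  have hl' : Filter.Tendsto (fun x : ℝ => t - x) (𝓝[<] t) (𝓝[>] 0) :=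
    tendsto_nhdsWithin_of_tendsto_nhds_of_eventually_within _
      (by simpa using (hc'.tendsto t).mono_left nhdsWithin_le_nhds)
      (by filter_upwards [self_mem_nhdsWithin] with x hx using sub_pos.2 (Set.mem_Iio.1 hx))
  have hr' : Filter.Tendsto (fun x : ℝ => t - x) (𝓝[>] t) (𝓝[<] 0) :=
    tendsto_nhdsWithin_of_tendsto_nhds_of_eventually_within _
      (by simpa using (hc'.tendsto t).mono_left nhdsWithin_le_nhds)
      (by filter_upwards [self_mem_nhdsWithin] with x hx using sub_neg.2 (Set.mem_Ioi.1 hx))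
  constructor
  · intro hpos
    have := eventually_slice h (v := 1) (by simpa using hpos)
    exact ⟨by simpa using hl.eventually this.1, by simpa using hr.eventually this.2⟩
  · intro hneg
    have hlt : N i < 0 := lt_of_le_of_ne (not_lt.1 hneg) hi
    have := eventually_slice h (v := -1) (by simpa using hlt)
    exact ⟨by simpa using hl'.eventually this.2, by simpa using hr'.eventually this.1⟩

open Classical in
/-- The divergence theorem for polynomials on a bounded open set, whose boundary has planar faces
outside of which the polynomial vanishes almost everywhere. -/
theorem integral_pderiv {K : Set (Pt (n + 1))} (hK : IsOpen K) (hb : Bornology.IsBounded K)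
    {ι : Type*} [Fintype ι] (F : ι → Set (Pt (n + 1))) (N : ι → Pt (n + 1)) (c : ι → ℝ)
    (hFc : ∀ j, IsClosed (F j)) (hFK : ∀ j, F j ⊆ frontier K) (hN : ∀ j, ‖N j‖ = 1)
    (hpl : ∀ j, ∀ x ∈ F j, ⟪N j, x⟫_ℝ = c j)
    (hov : ∀ j l, j ≠ l → surf (n + 1) (F j ∩ F l) = 0)
    (hnor : ∀ j, ∀ᵐ x ∂(surf (n + 1)).restrict (F j), IsOutwardNormalAt K x (N j))
    (p : MvPolynomial (Fin (n + 1)) ℝ)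
    (hp : surf (n + 1) {x ∈ frontier K | ev p x ≠ 0 ∧ ∀ j, x ∉ F j} = 0) (i : Fin (n + 1)) :
    ∫ x in K, ev (MvPolynomial.pderiv i p) x = ∑ j, N j i * ∫ x in F j, ev p x ∂surf (n + 1) := by
  have hFcpt : ∀ j, IsCompact (F j) := fun j => Metric.isCompact_of_isClosed_isBounded (hFc j)
    (hb.closure.subset ((hFK j).trans frontier_subset_closure))
  -- The exceptional points: boundary points off the faces where p is nonzero, overlaps of two
  -- faces, and face points without the prescribed normal.
  let Z : Set (Pt (n + 1)) := {x ∈ frontier K | ev p x ≠ 0 ∧ ∀ j, x ∉ F j} ∪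
    ((⋃ j, ⋃ l, ⋃ _ : j ≠ l, F j ∩ F l) ∪ ⋃ j, {x ∈ F j | ¬IsOutwardNormalAt K x (N j)})
  have hZ : surf (n + 1) Z = 0 := by
    refine measure_union_null hp (measure_union_null ?_ ?_)
    · simpa [measure_iUnion_null_iff] using hov
    · refine measure_iUnion_null fun j => ?_
      have := (ae_restrict_iff' (hFc j).measurableSet).1 (hnor j)
      rw [ae_iff] at this
      simpa only [Classical.not_imp] using this
  -- Almost every line in direction i misses Z and every face that is parallel to it.
  have hgen : ∀ᵐ y : Pt n, y ∉ proj i '' Z ∧ ∀ j, N j i = 0 → y ∉ proj i '' F j := by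
    refine (measure_eq_zero_iff_ae_notMem.1 (volume_proj_image_eq_zero i hZ)).and ?_
    rw [ae_all_iff]
    intro j
    by_cases hj : N j i = 0
    · simpa [hj] using
        measure_eq_zero_iff_ae_notMem.1 (volume_proj_image_of_normal_eq_zero hj (hN j) (hpl j))
    · simp [hj]
  -- the integral over a line
  have hline : ∀ᵐ y : Pt n, ∫ t, K.indicator (ev (MvPolynomial.pderiv i p)) (slice i t y) =
      ∑ j, if N j i = 0 then 0 else (if 0 < N j i then 1 else -1) *
        (proj i '' F j).indicator (fun y => ev p (planeParam i (N j) (c j) y)) y := by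
    filter_upwards [hgen] with y ⟨hyZ, hy0⟩
    have hcs : Continuous fun t : ℝ => slice i t y :=
      (continuous_slice i).comp (by fun_prop : Continuous fun t : ℝ => (t, y))
    let O : Set ℝ := {t | slice i t y ∈ K}
    have hO : IsOpen O := hK.preimage hcs
    have hOb : Bornology.IsBounded O := by
      refine ((EuclideanSpace.proj i : Pt (n + 1) →L[ℝ] ℝ).lipschitz.isBounded_image hb
        ).subset fun t ht => ⟨slice i t y, ht, by simp⟩
    have hfO : ∀ t ∈ frontier O, slice i t y ∈ frontier K := fun t ht =>
      hcs.frontier_preimage_subset K ht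
    -- The faces that the line crosses. They are transversal to it, so planarity allows a single
    -- crossing, at height `t j`.
    let J : Finset ι := Finset.univ.filter fun j => N j i ≠ 0 ∧ y ∈ proj i '' F j
    let t : ι → ℝ := fun j => planeParam i (N j) (c j) y i
    have hts : ∀ j, slice i (t j) y = planeParam i (N j) (c j) y := fun j => by
      conv_rhs => rw [← slice_proj i (planeParam i (N j) (c j) y), proj_planeParam]
    have hJF : ∀ j ∈ J, slice i (t j) y ∈ F j := fun j hj => by
      obtain ⟨h0, h1⟩ := (Finset.mem_filter.1 hj).2
      rw [hts]
      rwa [proj_image_eq_preimage h0 (hpl j)] at h1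
    have hnotZ : ∀ s, slice i s y ∉ Z := fun s hs => hyZ ⟨_, hs, proj_slice i s y⟩
    have hnorJ : ∀ j ∈ J, IsOutwardNormalAt K (slice i (t j) y) (N j) := fun j hj => by
      by_contra hnot
      exact hnotZ (t j) (Or.inr (Or.inr (Set.mem_iUnion.2 ⟨j, hJF j hj, hnot⟩)))
    have hsides := fun j (hj : j ∈ J) =>
      slice_mem_sides (hnorJ j hj) (Finset.mem_filter.1 hj).2.1
    have key := integral_derivative_of_isOpen hO hOb (linePoly i y p) J t (fun j => 0 < N j i)
      -- Two faces crossed at the same height would give an overlap point, which lies in Z.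
      (fun j hj l hl hjl => by
        by_contra hne
        refine hnotZ (t j) (Or.inr (Or.inl ?_))
        simp only [Set.mem_iUnion]
        refine ⟨j, l, hne, hJF j hj, ?_⟩
        rw [hjl]; exact hJF l hl)
      (fun j hj => by
        have hnO : t j ∉ O := fun h => by
          have := hFK j (hJF j hj)
          rw [hK.frontier_eq] at this
          exact this.2 h
        rw [hO.frontier_eq]
        refine ⟨?_, hnO⟩
        rw [mem_closure_iff_frequently]
        by_cases hpos : 0 < N j i
        · exact (((hsides j hj).1 hpos).1.frequently).filter_mono nhdsWithin_le_nhds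
        · exact (((hsides j hj).2 hpos).2.frequently).filter_mono nhdsWithin_le_nhds)
      -- A frontier point of the slice is a frontier point of K outside Z. If p is nonzero there,
      -- the point lies on a face, and this face is not parallel to the line.
      (fun s hs hne => by
        rw [eval_linePoly] at hne
        by_contra hno
        refine hnotZ s (Or.inl ⟨hfO s hs, hne, fun j hj => ?_⟩)
        have hyj : y ∈ proj i '' F j := ⟨_, hj, proj_slice i s y⟩
        have hji : N j i ≠ 0 := fun h => hy0 j h hyj
        refine hno ⟨j, Finset.mem_filter.2 ⟨Finset.mem_univ _, hji, hyj⟩, ?_⟩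
        have := planeParam_proj hji (hpl j _ hj)
        rw [proj_slice] at this
        simp only [t, this, slice_same])
      (fun j hj => (hsides j hj).1) (fun j hj => (hsides j hj).2)
    have hlhs : ∫ t, K.indicator (ev (MvPolynomial.pderiv i p)) (slice i t y) =
        ∫ x in O, (Polynomial.derivative (linePoly i y p)).eval x := by
      rw [← integral_indicator hO.measurableSet]
      refine integral_congr_ae (Filter.Eventually.of_forall fun t => ?_)
      rw [derivative_linePoly]
      by_cases ht : slice i t y ∈ K
      · have ht' : t ∈ O := ht
        simp [ht, ht', eval_linePoly]
      · have ht' : t ∉ O := ht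
        simp [ht, ht']
    rw [hlhs, key, Finset.sum_filter]
    refine Finset.sum_congr rfl fun j _ => ?_
    by_cases hj0 : N j i = 0
    · simp [hj0]
    · by_cases hyj : y ∈ proj i '' F j
      · rw [if_pos ⟨hj0, hyj⟩, if_neg hj0, Set.indicator_of_mem hyj, eval_linePoly, hts]
      · rw [if_neg fun h => hyj h.2, if_neg hj0, Set.indicator_of_notMem hyj, mul_zero]
  have hint : Integrable (K.indicator (ev (MvPolynomial.pderiv i p))) := by
    rw [integrable_indicator_iff hK.measurableSet]
    exact ((continuous_ev _).continuousOn.integrableOn_compact hb.isCompact_closure).mono_set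
      subset_closure
  have hmp := measurePreserving_slice i
  have hemb : MeasurableEmbedding (sliceHomeo i) := (sliceHomeo i).measurableEmbedding
  rw [← integral_indicator hK.measurableSet, ← hmp.integral_comp hemb]
  have hint' := (hmp.integrable_comp_emb hemb).2 hint
  refine (integral_prod_symm _ hint').trans ?_
  change ∫ y, ∫ t, K.indicator (ev (MvPolynomial.pderiv i p)) (slice i t y) = _
  rw [integral_congr_ae hline, integral_finsetSum]
  · refine Finset.sum_congr rfl fun j _ => ?_
    by_cases hj : N j i = 0
    · simp [hj]
    · have hm : MeasurableSet (proj i '' F j) :=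
        ((hFcpt j).image (lipschitz_proj i).continuous).isClosed.measurableSet
      simp only [hj, if_false]
      rw [integral_const_mul, integral_indicator hm, integral_proj_image hj (hN j) (hpl j),
        ← mul_assoc]
      congr 1
      -- The sign from the line integral times the Jacobian |N_i| from the area formula is N_i.
      by_cases hpos : 0 < N j i
      · simp [hpos, abs_of_pos hpos]
      · simp [hpos, abs_of_nonpos (not_lt.1 hpos)]
  · intro j _
    by_cases hj : N j i = 0
    · simp [hj]
    · have hcp := (hFcpt j).image (lipschitz_proj i).continuous
      simp only [hj, if_false]
      refine Integrable.const_mul ((integrable_indicator_iff hcp.isClosed.measurableSet).2 ?_) _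
      exact ((continuous_ev p).comp (continuous_planeParam i (N j) (c j))
        ).continuousOn.integrableOn_compact hcp

end Divergence

/-! ### Zero sets of polynomials -/

section ZeroSet

/-- Induction on the dimension with Fubini: as a polynomial in the first variable, p has a nonzero
coefficient, which by induction is nonzero at almost every y; the line over such a y contains only
finitely many zeros. -/
lemma volume_zeroSet_ev {n : ℕ} {p : MvPolynomial (Fin n) ℝ} (hp : p ≠ 0) :
    volume {x : Pt n | ev p x = 0} = 0 := by
  induction n with
  | zero =>
    have : {x : Pt 0 | ev p x = 0} = ∅ := by
      rw [Set.eq_empty_iff_forall_notMem]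
      intro x hx
      apply hp
      rw [MvPolynomial.eq_C_of_isEmpty p] at hx ⊢
      rw [Set.mem_ofPred_eq, ev_C] at hx
      rw [hx, map_zero]
    rw [this, measure_empty]
  | succ n ih =>
    obtain ⟨k, hk⟩ : ∃ k, (MvPolynomial.finSuccEquiv ℝ n p).coeff k ≠ 0 := by
      by_contra! h
      refine hp ((MvPolynomial.finSuccEquiv ℝ n).injective ?_)
      rw [map_zero]
      exact Polynomial.ext fun k => by simpa using h k
    have hm : MeasurableSet {x : Pt (n + 1) | ev p x = 0} :=
      (isClosed_eq (continuous_ev p) continuous_const).measurableSet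
    rw [← (measurePreserving_slice 0).measure_preimage hm.nullMeasurableSet,
      ← Measure.prod_swap, Measure.map_apply measurable_swap
        ((sliceHomeo 0).continuous.measurable hm),
      Measure.measure_prod_null (measurable_swap ((sliceHomeo 0).continuous.measurable hm))]
    have hae : ∀ᵐ y : Pt n, ev ((MvPolynomial.finSuccEquiv ℝ n p).coeff k) y ≠ 0 :=
      measure_eq_zero_iff_ae_notMem.1 (ih hk)
    filter_upwards [hae] with y hy
    let q : Polynomial ℝ :=
      (MvPolynomial.finSuccEquiv ℝ n p).map (MvPolynomial.eval fun j => y j)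
    have hq : q ≠ 0 := fun h => hy (by
      have := congrArg (fun r => Polynomial.coeff r k) h
      simpa [q, ev] using this)
    refine measure_mono_null (t := {t | q.eval t = 0}) (fun t ht => ?_)
      (Set.Finite.measure_zero ((q.rootSet_finite ℝ).subset fun t ht => ?_) _)
    · have ht : ev p (slice 0 t y) = 0 := ht
      rw [Set.mem_ofPred_eq, ← ht, ev, ← MvPolynomial.eval_eq_eval_mv_eval']
      congr 2
      funext j
      refine Fin.cases ?_ (fun k => ?_) j
      · simp
      · simpa using (slice_succAbove 0 t y k).symm
    · have ht : q.eval t = 0 := ht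
      simp [Polynomial.mem_rootSet, hq, ht]

lemma eq_zero_of_volume_ne_zero {n : ℕ} {p : MvPolynomial (Fin n) ℝ} {S : Set (Pt n)}
    (hS : volume S ≠ 0) (h : ∀ x ∈ S, ev p x = 0) : p = 0 := by
  by_contra hp
  exact hS (measure_mono_null (fun x hx => h x hx) (volume_zeroSet_ev hp))

/-- The polynomial `p ∘ planeParam i N c`. -/
def planePoly {n : ℕ} (i : Fin (n + 1)) (N : Pt (n + 1)) (c : ℝ)
    (p : MvPolynomial (Fin (n + 1)) ℝ) : MvPolynomial (Fin n) ℝ :=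
  MvPolynomial.aeval (i.insertNth (α := fun _ => MvPolynomial (Fin n) ℝ)
    (MvPolynomial.C (c / N i) - ∑ k, MvPolynomial.C (N (i.succAbove k) / N i) * MvPolynomial.X k)
    MvPolynomial.X) p

lemma ev_planePoly {n : ℕ} (i : Fin (n + 1)) (N : Pt (n + 1)) (c : ℝ)
    (p : MvPolynomial (Fin (n + 1)) ℝ) (y : Pt n) :
    ev (planePoly i N c p) y = ev p (planeParam i N c y) := by
  induction p using MvPolynomial.induction_on with
  | C a => simp [planePoly]
  | add p q hp hq =>
    have : planePoly i N c (p + q) = planePoly i N c p + planePoly i N c q := by simp [planePoly]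
    rw [this, ev_add, ev_add, hp, hq]
  | mul_X p j hp =>
    have : planePoly i N c (p * MvPolynomial.X j)
        = planePoly i N c p * planePoly i N c (MvPolynomial.X j) := by simp [planePoly]
    rw [this, ev_mul, ev_mul, hp, ev_X]
    congr 1
    rcases Fin.eq_self_or_eq_succAbove i j with rfl | ⟨k, rfl⟩
    · simp [planePoly, planeParam, PiLp.inner_apply, sub_div, Finset.sum_div]
      exact Finset.sum_congr rfl fun _ _ => by ring
    · simp [planePoly, planeParam]

/-- A polynomial that vanishes almost everywhere on a planar set of positive area vanishes on the
plane. -/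
lemma ev_eq_zero_of_ae {n : ℕ} {N : Pt (n + 1)} (hN : ‖N‖ = 1) {c : ℝ} {F : Set (Pt (n + 1))}
    (hF : ∀ x ∈ F, ⟪N, x⟫_ℝ = c) (hFm : MeasurableSet F) (hpos : surf (n + 1) F ≠ 0)
    {p : MvPolynomial (Fin (n + 1)) ℝ} (hp : ∀ᵐ x ∂(surf (n + 1)).restrict F, ev p x = 0)
    {x : Pt (n + 1)} (hx : ⟪N, x⟫_ℝ = c) : ev p x = 0 := by
  obtain ⟨i, hi⟩ : ∃ i, N i ≠ 0 := by
    by_contra! h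
    have : N = 0 := by ext j; exact h j
    simp [this] at hN
  have hF' : ∀ x ∈ F ∩ {x | ev p x = 0}, ⟪N, x⟫_ℝ = c := fun x hx => hF x hx.1
  have hA : surf (n + 1) (F ∩ {x | ev p x = 0}) ≠ 0 := by
    intro h
    apply hpos
    rw [ae_restrict_iff' hFm, ae_iff] at hp
    refine measure_mono_null (fun x hx => ?_) (measure_union_null h hp)
    by_cases h0 : ev p x = 0
    · exact Or.inl ⟨hx, h0⟩
    · exact Or.inr fun h => h0 (h hx)
  -- The zeros on F project to a set of positive volume, so the polynomial pulled back to the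
  -- parameter space is zero.
  have hq : planePoly i N c p = 0 := by
    refine eq_zero_of_volume_ne_zero (S := proj i '' (F ∩ {x | ev p x = 0})) ?_ ?_
    · rw [volume_proj_image hi hN hF']
      simp [hi, hA]
    · rintro _ ⟨x, hx, rfl⟩
      rw [ev_planePoly, planeParam_proj hi (hF' x hx)]
      exact hx.2
  rw [← planeParam_proj hi hx, ← ev_planePoly, hq, ev_zero]

end ZeroSet

/-! ### Calculus of polynomial functions -/

section Calculus

variable {d : ℕ}

lemma hasFDerivAt_ev (p : MvPolynomial (Fin d) ℝ) (x : Pt d) :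
    HasFDerivAt (ev p) (∑ j, ev (MvPolynomial.pderiv j p) x • (EuclideanSpace.proj j : Pt d →L[ℝ] ℝ))
      x := by
  induction p using MvPolynomial.induction_on with
  | C a => 
    have : ev (MvPolynomial.C a : MvPolynomial (Fin d) ℝ) = fun _ => a := funext fun x => ev_C a x
    simpa [this] using hasFDerivAt_const a x
  | add p q hp hq =>
    have : ev (p + q) = ev p + ev q := funext fun x => ev_add p q x
    rw [this]
    exact (hp.add hq).congr_fderiv (by simp [add_smul, Finset.sum_add_distrib])
  | mul_X p i hp =>
    have : ev (p * MvPolynomial.X i) = fun x => ev p x * (EuclideanSpace.proj i : Pt d →L[ℝ] ℝ) x :=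
      funext fun x => by simp
    rw [this]
    refine (hp.mul (EuclideanSpace.proj i : Pt d →L[ℝ] ℝ).hasFDerivAt).congr_fderiv ?_
    ext v
    have : ∀ j, ev (MvPolynomial.pderiv j (p * MvPolynomial.X i)) x * v j =
        (if i = j then ev p x * v j else 0) + x i * (ev (MvPolynomial.pderiv j p) x * v j) := by
      intro j
      rw [MvPolynomial.pderiv_mul, ev_add, ev_mul, ev_mul, ev_X]
      by_cases hij : i = j
      · subst hij; simp; ring
      · simp [MvPolynomial.pderiv_X_of_ne hij, hij]; ring
    simp only [_root_.sum_apply, _root_.smul_apply, smul_eq_mul, PiLp.proj_apply, this,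
      Finset.sum_add_distrib, _root_.add_apply, Finset.mul_sum]
    simp

lemma gradient_ev (p : MvPolynomial (Fin d) ℝ) (x : Pt d) :
    gradient (ev p) x = WithLp.toLp 2 fun j => ev (MvPolynomial.pderiv j p) x := by
  refine HasGradientAt.gradient ?_
  rw [hasGradientAt_iff_hasFDerivAt]
  refine (hasFDerivAt_ev p x).congr_fderiv ?_
  ext v
  simp [PiLp.inner_apply, mul_comm]

lemma hess_ev (p : MvPolynomial (Fin d) ℝ) (x v : Pt d) :
    hess (ev p) x v = WithLp.toLp 2 fun j =>
      ∑ k, v k * ev (MvPolynomial.pderiv k (MvPolynomial.pderiv j p)) x := by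
  have h : gradient (ev p) = fun x => WithLp.toLp 2 fun j => ev (MvPolynomial.pderiv j p) x :=
    funext (gradient_ev p)
  have h2 : HasFDerivAt (gradient (ev p)) ((PiLp.continuousLinearEquiv 2 ℝ (fun _ : Fin d => ℝ)).symm.toContinuousLinearMap.comp
      (ContinuousLinearMap.pi fun j => ∑ k, ev (MvPolynomial.pderiv k (MvPolynomial.pderiv j p)) x •
        (EuclideanSpace.proj k : Pt d →L[ℝ] ℝ))) x := by
    rw [h]
    exact (PiLp.continuousLinearEquiv 2 ℝ (fun _ : Fin d => ℝ)).symm.hasFDerivAt.comp x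
      (hasFDerivAt_pi.2 fun j => hasFDerivAt_ev (MvPolynomial.pderiv j p) x)
  rw [hess, h2.fderiv]
  ext j
  simp [mul_comm]

lemma lap_ev (p : MvPolynomial (Fin d) ℝ) :
    lap (ev p) = ev (∑ j, MvPolynomial.pderiv j (MvPolynomial.pderiv j p)) := by
  rw [lap, InnerProductSpace.laplacian_eq_iteratedFDeriv_orthonormalBasis _
    (EuclideanSpace.basisFun (Fin d) ℝ)]
  funext x
  rw [ev_sum]
  refine Finset.sum_congr rfl fun j _ => ?_
  have h : fderiv ℝ (ev p) = fun x => ∑ j, ev (MvPolynomial.pderiv j p) x •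
      (EuclideanSpace.proj j : Pt d →L[ℝ] ℝ) := funext fun x => (hasFDerivAt_ev p x).fderiv
  have h2 := HasFDerivAt.fun_sum (u := Finset.univ) fun j _ =>
    (hasFDerivAt_ev (MvPolynomial.pderiv j p) x).smul_const
      (EuclideanSpace.proj j : Pt d →L[ℝ] ℝ)
  rw [← h] at h2
  rw [iteratedFDeriv_two_apply, h2.fderiv]
  simp

end Calculus

/-! ### Total degree under differentiation and affine substitution. -/

section Degree

variable {σ τ : Type*}

lemma totalDegree_pderiv_le (i : σ) (p : MvPolynomial σ ℝ) :
    (MvPolynomial.pderiv i p).totalDegree ≤ p.totalDegree - 1 := by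
  classical
  refine Finset.sup_le fun m hm => ?_
  rw [MvPolynomial.mem_support_iff, MvPolynomial.coeff_pderiv] at hm
  have h : m + Finsupp.single i 1 ∈ p.support := by
    rw [MvPolynomial.mem_support_iff]
    intro h; simp [h] at hm
  have := MvPolynomial.le_totalDegree h
  rw [Finsupp.sum_add_index' (by simp) (by simp), Finsupp.sum_single_index rfl] at this
  exact Nat.le_sub_of_add_le this

lemma totalDegree_aeval_le (f : σ → MvPolynomial τ ℝ) (hf : ∀ i, (f i).totalDegree ≤ 1)
    (p : MvPolynomial σ ℝ) : (MvPolynomial.aeval f p).totalDegree ≤ p.totalDegree := by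
  rw [MvPolynomial.aeval_def, MvPolynomial.eval₂_eq]
  refine MvPolynomial.totalDegree_finsetSum_le fun m hm => ?_
  refine (MvPolynomial.totalDegree_mul _ _).trans ?_
  rw [MvPolynomial.algebraMap_eq, MvPolynomial.totalDegree_C, zero_add]
  refine (MvPolynomial.totalDegree_finsetProd _ _).trans
    (le_trans (Finset.sum_le_sum fun i _ => ?_) (MvPolynomial.le_totalDegree hm))
  exact (MvPolynomial.totalDegree_pow _ _).trans (by simpa using Nat.mul_le_mul_left (m i) (hf i))

end Degree

/-! ### Finite dimension of the polynomial spaces -/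

section FiniteDimensional

variable {d : ℕ}

lemma mem_poly_iff {l : ℕ} {v : Pt d → ℝ} :
    v ∈ poly d l ↔ ∃ p : MvPolynomial (Fin d) ℝ, p.totalDegree ≤ l ∧ v = ev p :=
  ⟨fun ⟨p, hp, h⟩ => ⟨p, hp, funext h⟩, fun ⟨p, hp, h⟩ => ⟨p, hp, fun x => congrFun h x⟩⟩

lemma ev_mem_poly {l : ℕ} {p : MvPolynomial (Fin d) ℝ} (hp : p.totalDegree ≤ l) : ev p ∈ poly d l :=
  mem_poly_iff.2 ⟨p, hp, rfl⟩

/-- Evaluation, as a linear map from polynomials to functions. -/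
def evLin (d : ℕ) : MvPolynomial (Fin d) ℝ →ₗ[ℝ] Pt d → ℝ where
  toFun := ev
  map_add' p q := funext fun x => ev_add p q x
  map_smul' r p := funext fun x => ev_smul r p x

instance (l : ℕ) : FiniteDimensional ℝ (poly d l) := by
  have : poly d l = (MvPolynomial.restrictTotalDegree (Fin d) ℝ l).map (evLin d) := by
    ext v
    rw [mem_poly_iff]
    simp only [Submodule.mem_map, MvPolynomial.mem_restrictTotalDegree]
    exact ⟨fun ⟨p, hp, h⟩ => ⟨p, hp, h.symm⟩, fun ⟨p, hp, h⟩ => ⟨p, hp, h.symm⟩⟩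
  rw [this]
  infer_instance

lemma facePoly_le (l : ℕ) (N : Pt d) : facePoly d l N ≤ poly d l := fun _ h => h.1

instance (l : ℕ) (N : Pt d) : FiniteDimensional ℝ (facePoly d l N) :=
  Submodule.finiteDimensional_of_le (facePoly_le l N)

/-- A polynomial function, restricted to a plane and extended constantly along its normal. -/
lemma exists_facePoly {l : ℕ} {N : Pt d} (hN : ‖N‖ = 1) (c : ℝ) {p : MvPolynomial (Fin d) ℝ}
    (hp : p.totalDegree ≤ l) :
    ∃ r : facePoly d l N, ∀ x, ⟪N, x⟫_ℝ = c → (r : Pt d → ℝ) x = ev p x := by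
  -- The coordinates of the orthogonal projection x + (c - N · x) N onto the plane; they have degree
  -- at most 1, so composition preserves the degree bound.
  let f : Fin d → MvPolynomial (Fin d) ℝ := fun j =>
    MvPolynomial.X j + MvPolynomial.C (c * N j) -
      ∑ k, MvPolynomial.C (N j * N k) * MvPolynomial.X k
  have hf : ∀ j, (f j).totalDegree ≤ 1 := by
    intro j
    refine (MvPolynomial.totalDegree_sub _ _).trans (max_le ((MvPolynomial.totalDegree_add _ _).trans
      (max_le (by simp) (by rw [MvPolynomial.totalDegree_C]; simp))) (MvPolynomial.totalDegree_finsetSum_le fun k _ => ?_))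
    exact (MvPolynomial.totalDegree_mul _ _).trans
      (by rw [MvPolynomial.totalDegree_C, MvPolynomial.totalDegree_X])
  have hev : ∀ x, ev (MvPolynomial.aeval f p) x = ev p (x + (c - ⟪N, x⟫_ℝ) • N) := by
    intro x
    have : (MvPolynomial.eval fun i => x i) (MvPolynomial.aeval f p) =
        MvPolynomial.eval (fun j => MvPolynomial.eval (fun i => x i) (f j)) p := by
      clear hp
      induction p using MvPolynomial.induction_on with
      | C a => simp
      | add p q hp hq => simp_all
      | mul_X p i hp => simp_all
    rw [ev, this, ev]
    congr 2
    funext j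
    have : ∀ k, N j * N k * x k = x k * N k * N j := fun k => by ring
    simp [f, PiLp.inner_apply, sub_mul, Finset.sum_mul, this, add_sub_assoc]
  refine ⟨⟨ev (MvPolynomial.aeval f p), ev_mem_poly ((totalDegree_aeval_le f hf p).trans hp), ?_⟩, ?_⟩
  · intro x t
    rw [hev, hev]
    congr 1
    rw [inner_add_right, inner_smul_right, real_inner_self_eq_norm_sq, hN]
    module
  · intro x hx
    change ev (MvPolynomial.aeval f p) x = _
    rw [hev, hx]; simp

end FiniteDimensional

/-! ### Bilinear forms on finite-dimensional spaces -/

section Bilinear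

variable {V W : Type*} [AddCommGroup V] [Module ℝ V] [AddCommGroup W] [Module ℝ W]

/-- Bilinearity of a function of two arguments. -/
def IsBilin (B : V → W → ℝ) : Prop :=
  (∀ w, IsLinearMap ℝ fun v => B v w) ∧ ∀ v, IsLinearMap ℝ (B v)

lemma IsBilin.map_add_left {B : V → W → ℝ} (h : IsBilin B) (a b : V) (w : W) :
    B (a + b) w = B a w + B b w := (h.1 w).map_add a b

lemma IsBilin.map_smul_left {B : V → W → ℝ} (h : IsBilin B) (r : ℝ) (a : V) (w : W) :
    B (r • a) w = r * B a w := (h.1 w).map_smul r a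

lemma IsBilin.map_sub_right {B : V → W → ℝ} (h : IsBilin B) (v : V) (a b : W) :
    B v (a - b) = B v a - B v b := (h.2 v).map_sub a b

lemma IsBilin.map_smul_right {B : V → W → ℝ} (h : IsBilin B) (v : V) (r : ℝ) (a : W) :
    B v (r • a) = r * B v a := (h.2 v).map_smul r a

lemma IsBilin.add {B B' : V → W → ℝ} (h : IsBilin B) (h' : IsBilin B') :
    IsBilin fun v w => B v w + B' v w :=
  ⟨fun w => ⟨fun a b => by dsimp only; rw [(h.1 w).map_add, (h'.1 w).map_add]; ring,
      fun r a => by dsimp only; rw [(h.1 w).map_smul, (h'.1 w).map_smul, smul_add]⟩,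
    fun v => ⟨fun a b => by dsimp only; rw [(h.2 v).map_add, (h'.2 v).map_add]; ring,
      fun r a => by dsimp only; rw [(h.2 v).map_smul, (h'.2 v).map_smul, smul_add]⟩⟩

lemma IsBilin.const_mul {B : V → W → ℝ} (h : IsBilin B) (c : ℝ) : IsBilin fun v w => c * B v w :=
  ⟨fun w => ⟨fun a b => by dsimp only; rw [(h.1 w).map_add]; ring,
      fun r a => by dsimp only; rw [(h.1 w).map_smul]; simp only [smul_eq_mul]; ring⟩,
    fun v => ⟨fun a b => by dsimp only; rw [(h.2 v).map_add]; ring,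
      fun r a => by dsimp only; rw [(h.2 v).map_smul]; simp only [smul_eq_mul]; ring⟩⟩

lemma IsBilin.sub {B B' : V → W → ℝ} (h : IsBilin B) (h' : IsBilin B') :
    IsBilin fun v w => B v w - B' v w := by
  simpa [sub_eq_add_neg] using h.add (h'.const_mul (-1))

lemma IsBilin.sum {ι : Type*} (s : Finset ι) {B : ι → V → W → ℝ} (h : ∀ j, IsBilin (B j)) :
    IsBilin fun v w => ∑ j ∈ s, B j v w :=
  ⟨fun w => ⟨fun a b => by simp only [((h _).1 w).map_add, Finset.sum_add_distrib],
      fun r a => by simp only [((h _).1 w).map_smul, Finset.smul_sum]⟩,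
    fun v => ⟨fun a b => by simp only [((h _).2 v).map_add, Finset.sum_add_distrib],
      fun r a => by simp only [((h _).2 v).map_smul, Finset.smul_sum]⟩⟩

lemma IsBilin.comp {V' W' : Type*} [AddCommGroup V'] [Module ℝ V'] [AddCommGroup W'] [Module ℝ W']
    {B : V → W → ℝ} (h : IsBilin B) {f : V' → V} {g : W' → W} (hf : IsLinearMap ℝ f)
    (hg : IsLinearMap ℝ g) : IsBilin fun v w => B (f v) (g w) :=
  ⟨fun w => ⟨fun a b => by dsimp only; rw [hf.map_add, (h.1 _).map_add],
      fun r a => by dsimp only; rw [hf.map_smul, (h.1 _).map_smul]⟩,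
    fun v => ⟨fun a b => by dsimp only; rw [hg.map_add, (h.2 _).map_add],
      fun r a => by dsimp only; rw [hg.map_smul, (h.2 _).map_smul]⟩⟩

lemma isBilin_mul {f : V → ℝ} {g : W → ℝ} (hf : IsLinearMap ℝ f) (hg : IsLinearMap ℝ g) :
    IsBilin fun v w => f v * g w :=
  ⟨fun w => ⟨fun a b => by dsimp only; rw [hf.map_add, add_mul],
      fun r a => by dsimp only; rw [hf.map_smul, smul_eq_mul, smul_eq_mul, mul_assoc]⟩,
    fun v => ⟨fun a b => by dsimp only; rw [hg.map_add, mul_add],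
      fun r a => by dsimp only; rw [hg.map_smul, smul_eq_mul, smul_eq_mul, mul_left_comm]⟩⟩

lemma isBilin_inner {E : Type*} [NormedAddCommGroup E] [InnerProductSpace ℝ E] {f : V → E}
    {g : W → E} (hf : IsLinearMap ℝ f) (hg : IsLinearMap ℝ g) :
    IsBilin fun v w => ⟪f v, g w⟫_ℝ :=
  ⟨fun w => ⟨fun a b => by dsimp only; rw [hf.map_add, inner_add_left],
      fun r a => by dsimp only; rw [hf.map_smul, real_inner_smul_left, smul_eq_mul]⟩,
    fun v => ⟨fun a b => by dsimp only; rw [hg.map_add, inner_add_right],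
      fun r a => by dsimp only; rw [hg.map_smul, real_inner_smul_right, smul_eq_mul]⟩⟩

lemma isLinearMap_integral {X E : Type*} [MeasurableSpace X] [NormedAddCommGroup E]
    [NormedSpace ℝ E] {μ : Measure X}
    {Φ : V → X → E} (hi : ∀ v, Integrable (Φ v) μ) (h : ∀ x, IsLinearMap ℝ fun v => Φ v x) :
    IsLinearMap ℝ fun v => ∫ x, Φ v x ∂μ :=
  ⟨fun a b => by simp only [(h _).map_add]; exact integral_add (hi a) (hi b),
    fun r a => by simp only [(h _).map_smul]; exact integral_smul r _⟩

lemma isBilin_integral {X : Type*} [MeasurableSpace X] {μ : Measure X} {Φ : V → W → X → ℝ}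
    (hi : ∀ v w, Integrable (Φ v w) μ) (h : ∀ x, IsBilin fun v w => Φ v w x) :
    IsBilin fun v w => ∫ x, Φ v w x ∂μ :=
  ⟨fun w => isLinearMap_integral (fun v => hi v w) fun x => (h x).1 w,
    fun v => isLinearMap_integral (fun w => hi v w) fun x => (h x).2 v⟩

/-- A bilinear function as a bilinear map. -/
def IsBilin.toLin {B : V → W → ℝ} (h : IsBilin B) : V →ₗ[ℝ] W →ₗ[ℝ] ℝ :=
  LinearMap.mk₂ ℝ B (fun a b w => (h.1 w).map_add a b) (fun r a w => (h.1 w).map_smul r a)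
    (fun v a b => (h.2 v).map_add a b) fun r v a => (h.2 v).map_smul r a

@[simp] lemma IsBilin.toLin_apply {B : V → W → ℝ} (h : IsBilin B) (v : V) (w : W) :
    h.toLin v w = B v w := rfl

/-- Definiteness makes V → V* injective, and the two spaces have the same finite dimension. Symmetry
is not needed. -/
lemma IsBilin.existsUnique [FiniteDimensional ℝ V] {B : V → V → ℝ} (hB : IsBilin B)
    (hpos : ∀ v, B v v = 0 → v = 0) {ℓ : V → ℝ} (hℓ : IsLinearMap ℝ ℓ) :
    ∃! u, ∀ w, B u w = ℓ w := by
  have hinj : Function.Injective hB.toLin := by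
    rw [injective_iff_map_eq_zero]
    intro v hv
    refine hpos v ?_
    rw [← hB.toLin_apply, hv, LinearMap.zero_apply]
  have hsurj : Function.Surjective hB.toLin :=
    (LinearMap.injective_iff_surjective_of_finrank_eq_finrank
      (Subspace.dual_finrank_eq (K := ℝ) (V := V)).symm).1 hinj
  obtain ⟨u, hu⟩ := hsurj hℓ.mk'
  refine ⟨u, fun w => ?_, fun u' hu' => hinj ?_⟩
  · rw [← hB.toLin_apply, hu, IsLinearMap.mk'_apply]
  · rw [hu]; ext w; exact hu' w

lemma exists_bound_norm_sq {E : Type*} [NormedAddCommGroup E] [InnerProductSpace ℝ E]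
    [FiniteDimensional ℝ E] (Q : E →ₗ[ℝ] E →ₗ[ℝ] ℝ) :
    ∃ C : ℝ, 0 < C ∧ ∀ v, Q v v ≤ C * ‖v‖ ^ 2 := by
  refine ⟨‖Q.toContinuousBilinearMap‖ + 1, by positivity, fun v => ?_⟩
  have h2 := (le_abs_self _).trans (Q.toContinuousBilinearMap.le_opNorm₂ v v)
  rw [LinearMap.toContinuousBilinearMap_apply] at h2
  nlinarith [sq_nonneg ‖v‖]

/-- The symmetric part of A is an inner product with ‖v‖² = A v v, and every bilinear form on a
finite-dimensional space is bounded for the resulting norm. -/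
lemma IsBilin.exists_bound [FiniteDimensional ℝ V] {A Q : V → V → ℝ} (hA : IsBilin A)
    (hQ : IsBilin Q) (hnn : ∀ v, 0 ≤ A v v) (hpos : ∀ v, A v v = 0 → v = 0) :
    ∃ C : ℝ, 0 < C ∧ ∀ v, Q v v ≤ C * A v v := by
  let core : InnerProductSpace.Core ℝ V :=
    { inner := fun v w => (A v w + A w v) / 2
      conj_inner_symm := fun v w => by simp [add_comm]
      re_inner_nonneg := fun v => by simpa using hnn v
      definite := fun v hv => hpos v (by simpa using hv)
      add_left := fun a b w => by
        rw [(hA.1 w).map_add, (hA.2 w).map_add]; ring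
      smul_left := fun a w r => by
        rw [(hA.1 w).map_smul, (hA.2 w).map_smul]; simp; ring }
  let i₁ : NormedAddCommGroup V := core.toNormedAddCommGroup
  let i₂ : InnerProductSpace ℝ V := InnerProductSpace.ofCore core.toCore
  have hnorm : ∀ v : V, ‖v‖ ^ 2 = A v v := fun v => by
    rw [← real_inner_self_eq_norm_sq]
    change (A v v + A v v) / 2 = A v v
    ring
  obtain ⟨C, hC, h⟩ := @exists_bound_norm_sq V i₁ i₂ ‹_› hQ.toLin
  exact ⟨C, hC, fun v => by rw [← hnorm]; exact h v⟩

end Bilinear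

/-! ### Linearity and continuity of the differential operators -/

section Operators

variable {d : ℕ}

/-- Differential operators are not linear on arbitrary functions, because derivatives have default
values. Linearity is therefore checked on polynomial evaluations and transferred to polynomial
subspaces. -/
lemma isLinearMap_restrict {E : Type*} [AddCommGroup E] [Module ℝ E] {T : (Pt d → ℝ) → E}
    (hT : IsLinearMap ℝ fun p => T (ev p)) {l : ℕ} {S : Submodule ℝ (Pt d → ℝ)} (hS : S ≤ poly d l) :
    IsLinearMap ℝ fun v : S => T v := by
  constructor
  · intro v w
    obtain ⟨p, -, hp⟩ := mem_poly_iff.1 (hS v.2)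
    obtain ⟨q, -, hq⟩ := mem_poly_iff.1 (hS w.2)
    have : ((v + w : S) : Pt d → ℝ) = ev (p + q) := by
      funext x; rw [ev_add, ← hp, ← hq]; rfl
    rw [this, hT.map_add, hp, hq]
  · intro r v
    obtain ⟨p, -, hp⟩ := mem_poly_iff.1 (hS v.2)
    have : ((r • v : S) : Pt d → ℝ) = ev (r • p) := by
      funext x; rw [ev_smul, ← hp]; rfl
    rw [this, hT.map_smul, hp]

lemma isLinearMap_poly {E : Type*} [AddCommGroup E] [Module ℝ E] {T : (Pt d → ℝ) → E}
    (hT : IsLinearMap ℝ fun p => T (ev p)) {l : ℕ} : IsLinearMap ℝ fun v : poly d l => T v :=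
  isLinearMap_restrict hT le_rfl

lemma isLinearMap_facePoly {E : Type*} [AddCommGroup E] [Module ℝ E] {T : (Pt d → ℝ) → E}
    (hT : IsLinearMap ℝ fun p => T (ev p)) {l : ℕ} {N : Pt d} :
    IsLinearMap ℝ fun v : facePoly d l N => T v :=
  isLinearMap_restrict hT (facePoly_le l N)

lemma _root_.IsLinearMap.inner_right {V E : Type*} [AddCommGroup V] [Module ℝ V]
    [NormedAddCommGroup E] [InnerProductSpace ℝ E] {f : V → E} (hf : IsLinearMap ℝ f) (a : E) :
    IsLinearMap ℝ fun v => ⟪a, f v⟫_ℝ :=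
  ⟨fun v w => by rw [hf.map_add, inner_add_right],
    fun r v => by rw [hf.map_smul, real_inner_smul_right, smul_eq_mul]⟩

lemma _root_.IsLinearMap.comp' {V W E : Type*} [AddCommGroup V] [Module ℝ V] [AddCommGroup W]
    [Module ℝ W] [AddCommGroup E] [Module ℝ E] {f : W → E} {g : V → W} (hf : IsLinearMap ℝ f)
    (hg : IsLinearMap ℝ g) : IsLinearMap ℝ fun v => f (g v) :=
  ⟨fun v w => by rw [hg.map_add, hf.map_add], fun r v => by rw [hg.map_smul, hf.map_smul]⟩

lemma _root_.IsLinearMap.add' {V E : Type*} [AddCommGroup V] [Module ℝ V] [AddCommGroup E]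
    [Module ℝ E] {f g : V → E} (hf : IsLinearMap ℝ f) (hg : IsLinearMap ℝ g) :
    IsLinearMap ℝ fun v => f v + g v :=
  ⟨fun v w => by rw [hf.map_add, hg.map_add]; abel,
    fun r v => by rw [hf.map_smul, hg.map_smul, smul_add]⟩

lemma _root_.IsLinearMap.sub' {V E : Type*} [AddCommGroup V] [Module ℝ V] [AddCommGroup E]
    [Module ℝ E] {f g : V → E} (hf : IsLinearMap ℝ f) (hg : IsLinearMap ℝ g) :
    IsLinearMap ℝ fun v => f v - g v :=
  ⟨fun v w => by rw [hf.map_add, hg.map_add]; abel,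
    fun r v => by rw [hf.map_smul, hg.map_smul, smul_sub]⟩

lemma _root_.IsLinearMap.smul_vec {V E : Type*} [AddCommGroup V] [Module ℝ V] [AddCommGroup E]
    [Module ℝ E] {f : V → ℝ} (hf : IsLinearMap ℝ f) (e : E) : IsLinearMap ℝ fun v => f v • e :=
  ⟨fun v w => by rw [hf.map_add, add_smul],
    fun r v => by rw [hf.map_smul, smul_eq_mul, mul_smul]⟩

lemma _root_.IsLinearMap.const_mul {V : Type*} [AddCommGroup V] [Module ℝ V] {f : V → ℝ}
    (hf : IsLinearMap ℝ f) (c : ℝ) : IsLinearMap ℝ fun v => c * f v :=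
  ⟨fun v w => by rw [hf.map_add, mul_add],
    fun r v => by rw [hf.map_smul, smul_eq_mul, smul_eq_mul, mul_left_comm]⟩

lemma _root_.IsLinearMap.const_smul {V E : Type*} [AddCommGroup V] [Module ℝ V] [AddCommGroup E]
    [Module ℝ E] {f : V → E} (hf : IsLinearMap ℝ f) (c : ℝ) : IsLinearMap ℝ fun v => c • f v :=
  ⟨fun v w => by rw [hf.map_add, smul_add],
    fun r v => by rw [hf.map_smul, smul_comm]⟩

lemma _root_.IsLinearMap.finsetSum {V E ι : Type*} [AddCommGroup V] [Module ℝ V] [AddCommGroup E]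
    [Module ℝ E] (s : Finset ι) {f : ι → V → E} (hf : ∀ j, IsLinearMap ℝ (f j)) :
    IsLinearMap ℝ fun v => ∑ j ∈ s, f j v :=
  ⟨fun v w => by simp only [(hf _).map_add, Finset.sum_add_distrib],
    fun r v => by simp only [(hf _).map_smul, Finset.smul_sum]⟩

lemma lin_eval (x : Pt d) : IsLinearMap ℝ fun p : MvPolynomial (Fin d) ℝ => ev p x :=
  ⟨fun p q => ev_add p q x, fun r p => ev_smul r p x⟩

lemma lin_gradient (x : Pt d) : IsLinearMap ℝ fun p => gradient (ev p) x :=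
  ⟨fun p q => by ext j; simp [gradient_ev], fun r p => by ext j; simp [gradient_ev]⟩

lemma lin_hess (x v : Pt d) : IsLinearMap ℝ fun p => hess (ev p) x v :=
  ⟨fun p q => by ext j; simp [hess_ev, mul_add, Finset.sum_add_distrib],
    fun r p => by ext j; simp [hess_ev, Finset.mul_sum, mul_left_comm]⟩

/-- The Laplacian of a polynomial. -/
def lapPoly : MvPolynomial (Fin d) ℝ →ₗ[ℝ] MvPolynomial (Fin d) ℝ where
  toFun p := ∑ j, MvPolynomial.pderiv j (MvPolynomial.pderiv j p)
  map_add' p q := by simp [Finset.sum_add_distrib]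
  map_smul' r p := by simp [Finset.smul_sum]

lemma lap_ev' (p : MvPolynomial (Fin d) ℝ) : lap (ev p) = ev (lapPoly p) := lap_ev p

lemma isLinearMap_lapPoly : IsLinearMap ℝ (lapPoly : MvPolynomial (Fin d) ℝ → _) :=
  lapPoly.isLinear

lemma lin_lap (x : Pt d) : IsLinearMap ℝ fun p => lap (ev p) x := by
  simp only [lap_ev']
  exact (lin_eval x).comp' isLinearMap_lapPoly

lemma lin_lap_lap (x : Pt d) : IsLinearMap ℝ fun p => lap (lap (ev p)) x := by
  simp only [lap_ev']
  exact (lin_eval x).comp' (isLinearMap_lapPoly.comp' isLinearMap_lapPoly)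

lemma lin_dn (N x : Pt d) : IsLinearMap ℝ fun p => dn N (ev p) x := (lin_gradient x).inner_right N

lemma lin_dn_lap (N x : Pt d) : IsLinearMap ℝ fun p => dn N (lap (ev p)) x := by
  simp only [lap_ev']
  exact (lin_dn N x).comp' isLinearMap_lapPoly

lemma lin_dnn (N x : Pt d) : IsLinearMap ℝ fun p => dnn N (ev p) x := (lin_hess x N).inner_right N

lemma lin_dt (N x : Pt d) : IsLinearMap ℝ fun p => dt N (ev p) x :=
  (lin_gradient x).sub' ((lin_dn N x).smul_vec N)

lemma lin_dnt (N x : Pt d) : IsLinearMap ℝ fun p => dnt N (ev p) x :=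
  (lin_hess x N).sub' ((lin_dnn N x).smul_vec N)

lemma continuous_gradient_ev (p : MvPolynomial (Fin d) ℝ) : Continuous (gradient (ev p)) := by
  rw [show gradient (ev p) = _ from funext (gradient_ev p)]
  exact (PiLp.continuous_toLp 2 _).comp (continuous_pi fun j => continuous_ev _)

lemma continuous_hess_ev (p : MvPolynomial (Fin d) ℝ) {f : Pt d → Pt d} (hf : Continuous f) :
    Continuous fun x => hess (ev p) x (f x) := by
  simp only [hess_ev]
  refine (PiLp.continuous_toLp 2 _).comp (continuous_pi fun j => continuous_finsetSum _ fun k _ => ?_)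
  exact ((EuclideanSpace.proj k : Pt d →L[ℝ] ℝ).continuous.comp hf).mul (continuous_ev _)

lemma continuous_dn_ev (N : Pt d) (p : MvPolynomial (Fin d) ℝ) : Continuous (dn N (ev p)) :=
  continuous_const.inner (continuous_gradient_ev p)

lemma continuous_dnn_ev (N : Pt d) (p : MvPolynomial (Fin d) ℝ) : Continuous (dnn N (ev p)) :=
  continuous_const.inner (continuous_hess_ev p continuous_const)

lemma continuous_dt_ev (N : Pt d) (p : MvPolynomial (Fin d) ℝ) : Continuous (dt N (ev p)) :=
  (continuous_gradient_ev p).sub ((continuous_dn_ev N p).smul continuous_const)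

lemma continuous_dnt_ev (N : Pt d) (p : MvPolynomial (Fin d) ℝ) : Continuous (dnt N (ev p)) :=
  (continuous_hess_ev p continuous_const).sub ((continuous_dnn_ev N p).smul continuous_const)

lemma exists_ev {l : ℕ} {v : Pt d → ℝ} (hv : v ∈ poly d l) : ∃ p, v = ev p :=
  let ⟨p, _, h⟩ := mem_poly_iff.1 hv; ⟨p, h⟩

/-- A statement about polynomial functions holds if it holds for evaluations. -/
lemma poly_prop {l : ℕ} {P : (Pt d → ℝ) → Prop} (h : ∀ p, P (ev p)) (v : poly d l) : P v := by
  obtain ⟨p, hp⟩ := exists_ev v.2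
  rw [hp]; exact h p

lemma facePoly_prop {l : ℕ} {N : Pt d} {P : (Pt d → ℝ) → Prop} (h : ∀ p, P (ev p))
    (v : facePoly d l N) : P v :=
  poly_prop h ⟨v, v.2.1⟩

lemma continuous_poly {l : ℕ} (v : poly d l) : Continuous (v : Pt d → ℝ) :=
  poly_prop continuous_ev v

lemma continuous_facePoly {l : ℕ} {N : Pt d} (v : facePoly d l N) : Continuous (v : Pt d → ℝ) :=
  facePoly_prop continuous_ev v

end Operators

/-! ### Integrability of continuous functions on bounded sets -/

section Integrability

variable {d : ℕ} {E : Type*} [NormedAddCommGroup E]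

lemma integrableOn_of_bounded {S : Set (Pt d)} (hb : Bornology.IsBounded S)
    {f : Pt d → E} (hf : Continuous f) : IntegrableOn f S :=
  (hf.continuousOn.integrableOn_compact hb.isCompact_closure).mono_set subset_closure

/-- Hausdorff surface measure is in general infinite on compact sets, so compactness alone does not
suffice: the finite area of S is combined with a bound on f. -/
lemma integrableOn_surf {S : Set (Pt d)} (hb : Bornology.IsBounded S) (hm : MeasurableSet S)
    (hS : surf d S < ⊤) {f : Pt d → E} (hf : Continuous f) : IntegrableOn f S (surf d) := by
  obtain ⟨C, hC⟩ := hb.isCompact_closure.exists_bound_of_continuousOn hf.continuousOn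
  exact IntegrableOn.of_bound hS (hf.aestronglyMeasurable) C
    (ae_restrict_of_forall_mem hm fun x hx => hC x (subset_closure hx))

end Integrability

/-! ### The energy inner product on a cell -/

section GradInner

variable {d : ℕ}

lemma isBilin_gradInner (ε : ℝ) {S : Set (Pt d)} (hb : Bornology.IsBounded S) (l : ℕ) :
    IsBilin fun v w : poly d l => gradInner ε S v w := by
  refine ((isBilin_integral (fun v w => ?_) fun x => IsBilin.sum _ fun i =>
    isBilin_inner (isLinearMap_poly (T := fun f => hess f x _) (lin_hess x _))
      (isLinearMap_poly (T := fun f => hess f x _) (lin_hess x _))).const_mul ε).add (isBilin_integral (fun v w => ?_) fun x =>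
    isBilin_inner (isLinearMap_poly (T := fun f => gradient f x) (lin_gradient x))
      (isLinearMap_poly (T := fun f => gradient f x) (lin_gradient x)))
  · obtain ⟨p, hp⟩ := exists_ev v.2
    obtain ⟨q, hq⟩ := exists_ev w.2
    rw [hp, hq]
    exact integrableOn_of_bounded hb (continuous_finsetSum _ fun i _ =>
      (continuous_hess_ev p continuous_const).inner (continuous_hess_ev q continuous_const))
  · obtain ⟨p, hp⟩ := exists_ev v.2
    obtain ⟨q, hq⟩ := exists_ev w.2
    rw [hp, hq]
    exact integrableOn_of_bounded hb ((continuous_gradient_ev p).inner (continuous_gradient_ev q))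

lemma gradInner_self_nonneg {ε : ℝ} (hε : 0 ≤ ε) (S : Set (Pt d)) (v : Pt d → ℝ) :
    0 ≤ gradInner ε S v v :=
  add_nonneg (mul_nonneg hε (integral_nonneg fun _ =>
    Finset.sum_nonneg fun _ _ => real_inner_self_nonneg))
      (integral_nonneg fun _ => real_inner_self_nonneg)

lemma exists_const_of_pderiv_eq_zero {p : MvPolynomial (Fin d) ℝ}
    (h : ∀ j, MvPolynomial.pderiv j p = 0) : ∃ a, ev p = fun _ => a := by
  refine ⟨ev p 0, funext fun x => is_const_of_fderiv_eq_zero (𝕜 := ℝ)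
    (fun x => (hasFDerivAt_ev p x).differentiableAt) (fun x => ?_) x 0⟩
  rw [(hasFDerivAt_ev p x).fderiv]
  simp [h]

/-- The unweighted gradient term already vanishes, which covers ε = 0. The partial derivatives are
then polynomials that vanish on a set of positive volume, hence identically; so S need not be
connected. -/
lemma exists_const_of_gradInner_self {ε : ℝ} (hε : 0 ≤ ε) {S : Set (Pt d)} (hS : IsOpen S)
    (hb : Bornology.IsBounded S) (hne : S.Nonempty) {l : ℕ} (v : poly d l)
    (h : gradInner ε S v v = 0) : ∃ a, (v : Pt d → ℝ) = fun _ => a := by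
  obtain ⟨p, hp⟩ := exists_ev v.2
  rw [hp] at h ⊢
  refine exists_const_of_pderiv_eq_zero fun j => ?_
  have h1 : 0 ≤ ∫ x in S, hessInner (ev p) (ev p) x := integral_nonneg fun x =>
    Finset.sum_nonneg fun i _ => real_inner_self_nonneg
  have h2 : 0 ≤ ∫ x in S, ⟪gradient (ev p) x, gradient (ev p) x⟫_ℝ :=
    integral_nonneg fun x => real_inner_self_nonneg
  have h3 : ∫ x in S, ⟪gradient (ev p) x, gradient (ev p) x⟫_ℝ = 0 := by
    unfold gradInner at h
    nlinarith [mul_nonneg hε h1]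
  rw [setIntegral_eq_zero_iff_of_nonneg_ae (Filter.Eventually.of_forall fun x =>
    real_inner_self_nonneg) (integrableOn_of_bounded hb
      ((continuous_gradient_ev p).inner (continuous_gradient_ev p)))] at h3
  have h4 : volume (S ∩ {x | gradient (ev p) x = 0}) ≠ 0 := by
    intro h0
    refine (hS.measure_pos volume hne).ne' ?_
    rw [Filter.EventuallyEq, ae_restrict_iff' hS.measurableSet, ae_iff] at h3
    refine measure_mono_null (fun x hx => ?_) (measure_union_null h0 h3)
    by_cases hg : gradient (ev p) x = 0
    · exact Or.inl ⟨hx, hg⟩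
    · exact Or.inr fun h => hg (by simpa using h hx)
  refine eq_zero_of_volume_ne_zero h4 fun x hx => ?_
  have := congrArg (fun y : Pt d => y j) (gradient_ev p x)
  rw [show gradient (ev p) x = 0 from hx.2] at this
  simpa using this.symm

lemma gradInner_const_right (ε : ℝ) (S : Set (Pt d)) (v : Pt d → ℝ) (a : ℝ) :
    gradInner ε S v (fun _ => a) = 0 := by
  have h : gradient (fun _ : Pt d => a) = 0 := funext fun x => by simp [gradient]
  simp [gradInner, hessInner, hess, h]

end GradInner

/-! ### Continuous functions that depend linearly on a parameter -/

section Family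

variable {d : ℕ} {V W E : Type*} [AddCommGroup V] [Module ℝ V] [AddCommGroup W] [Module ℝ W]
  [NormedAddCommGroup E] [InnerProductSpace ℝ E]

/-- A linear family of continuous functions. -/
structure IsFamily (A : V → Pt d → E) : Prop where
  lin : ∀ x, IsLinearMap ℝ fun v => A v x
  cont : ∀ v, Continuous (A v)

lemma IsFamily.comp {A : W → Pt d → E} (h : IsFamily A) {f : V → W} (hf : IsLinearMap ℝ f) :
    IsFamily fun v => A (f v) :=
  ⟨fun x => (h.lin x).comp' hf, fun v => h.cont (f v)⟩

lemma IsFamily.sub {A B : V → Pt d → E} (h : IsFamily A) (h' : IsFamily B) :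
    IsFamily fun v x => A v x - B v x :=
  ⟨fun x => (h.lin x).sub' (h'.lin x), fun v => (h.cont v).sub (h'.cont v)⟩

lemma IsFamily.const_mul {A : V → Pt d → ℝ} (h : IsFamily A) (c : ℝ) :
    IsFamily fun v x => c * A v x :=
  ⟨fun x => (h.lin x).const_mul c, fun v => continuous_const.mul (h.cont v)⟩

lemma isFamily_poly {T : (Pt d → ℝ) → Pt d → E} (h : ∀ x, IsLinearMap ℝ fun p => T (ev p) x)
    (hc : ∀ p, Continuous (T (ev p))) (l : ℕ) : IsFamily fun v : poly d l => T v :=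
  ⟨fun x => isLinearMap_poly (T := fun f => T f x) (h x),
    fun v => poly_prop (P := fun f => Continuous (T f)) hc v⟩

lemma isFamily_facePoly {T : (Pt d → ℝ) → Pt d → E} (h : ∀ x, IsLinearMap ℝ fun p => T (ev p) x)
    (hc : ∀ p, Continuous (T (ev p))) (l : ℕ) (N : Pt d) :
    IsFamily fun v : facePoly d l N => T v :=
  ⟨fun x => isLinearMap_facePoly (T := fun f => T f x) (h x),
    fun v => facePoly_prop (P := fun f => Continuous (T f)) hc v⟩

lemma isBilin_vol {S : Set (Pt d)} (hb : Bornology.IsBounded S) {A : V → Pt d → ℝ}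
    {B : W → Pt d → ℝ} (hA : IsFamily A) (hB : IsFamily B) :
    IsBilin fun v w => ∫ x in S, A v x * B w x :=
  isBilin_integral (fun v w => integrableOn_of_bounded hb ((hA.cont v).mul (hB.cont w)))
    fun x => isBilin_mul (hA.lin x) (hB.lin x)

lemma isBilin_surfInner {S : Set (Pt d)} (hb : Bornology.IsBounded S) (hm : MeasurableSet S)
    (hS : surf d S < ⊤) {A : V → Pt d → ℝ} {B : W → Pt d → ℝ} (hA : IsFamily A) (hB : IsFamily B) :
    IsBilin fun v w => surfInner S (A v) (B w) :=
  isBilin_integral (fun v w => integrableOn_surf hb hm hS ((hA.cont v).mul (hB.cont w)))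
    fun x => isBilin_mul (hA.lin x) (hB.lin x)

lemma isBilin_surfInnerVec {S : Set (Pt d)} (hb : Bornology.IsBounded S) (hm : MeasurableSet S)
    (hS : surf d S < ⊤) {A : V → Pt d → Pt d} {B : W → Pt d → Pt d} (hA : IsFamily A)
    (hB : IsFamily B) : IsBilin fun v w => surfInnerVec S (A v) (B w) :=
  isBilin_integral (fun v w => integrableOn_surf hb hm hS ((hA.cont v).inner (hB.cont w)))
    fun x => isBilin_inner (hA.lin x) (hB.lin x)

lemma isFamily_poly_id (l : ℕ) : IsFamily fun v : poly d l => (v : Pt d → ℝ) :=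
  isFamily_poly (T := fun f => f) lin_eval continuous_ev l

lemma isFamily_facePoly_id (l : ℕ) (N : Pt d) :
    IsFamily fun v : facePoly d l N => (v : Pt d → ℝ) :=
  isFamily_facePoly (T := fun f => f) lin_eval continuous_ev l N

lemma isLinearMap_fst : IsLinearMap ℝ fun v : V × W => v.1 := ⟨fun _ _ => rfl, fun _ _ => rfl⟩

lemma isLinearMap_snd_fst_apply {ι : Type*} {X Y : ι → Type*} [∀ j, AddCommGroup (X j)]
    [∀ j, Module ℝ (X j)] [∀ j, AddCommGroup (Y j)] [∀ j, Module ℝ (Y j)] (j : ι) :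
    IsLinearMap ℝ fun v : V × ((j : ι) → X j) × ((j : ι) → Y j) => v.2.1 j :=
  ⟨fun _ _ => rfl, fun _ _ => rfl⟩

lemma isLinearMap_snd_snd_apply {ι : Type*} {X Y : ι → Type*} [∀ j, AddCommGroup (X j)]
    [∀ j, Module ℝ (X j)] [∀ j, AddCommGroup (Y j)] [∀ j, Module ℝ (Y j)] (j : ι) :
    IsLinearMap ℝ fun v : V × ((j : ι) → X j) × ((j : ι) → Y j) => v.2.2 j :=
  ⟨fun _ _ => rfl, fun _ _ => rfl⟩

end Family

/-! ### Projections onto face polynomials -/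

section FaceProj

variable {n : ℕ} {N : Pt (n + 1)} {c : ℝ} {F : Set (Pt (n + 1))}

/-- A face polynomial is constant along N, so any point may be moved onto the plane of F, where
`ev_eq_zero_of_ae` applies. -/
lemma facePoly_eq_zero {l : ℕ} (hN : ‖N‖ = 1) (hF : ∀ x ∈ F, ⟪N, x⟫_ℝ = c)
    (hm : MeasurableSet F) (hpos : surf (n + 1) F ≠ 0) (v : facePoly (n + 1) l N)
    (h : ∀ᵐ x ∂(surf (n + 1)).restrict F, (v : Pt (n + 1) → ℝ) x = 0) : v = 0 := by
  obtain ⟨p, hp⟩ := exists_ev v.2.1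
  ext x
  rw [← v.2.2 x (c - ⟪N, x⟫_ℝ), hp]
  rw [hp] at h
  exact ev_eq_zero_of_ae hN hF hm hpos h (by
    rw [inner_add_right, inner_smul_right, real_inner_self_eq_norm_sq, hN]; ring)

/-- A continuous function with vanishing square integral vanishes almost everywhere. -/
lemma ae_eq_zero_of_surfInner_self {d : ℕ} {S : Set (Pt d)} (hb : Bornology.IsBounded S)
    (hm : MeasurableSet S) (hS : surf d S < ⊤) {f : Pt d → ℝ} (hf : Continuous f)
    (h : surfInner S f f = 0) : ∀ᵐ x ∂(surf d).restrict S, f x = 0 := by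
  rw [surfInner, setIntegral_eq_zero_iff_of_nonneg_ae (Filter.Eventually.of_forall fun x =>
    mul_self_nonneg (f x)) (integrableOn_surf hb hm hS (hf.mul hf))] at h
  filter_upwards [h] with x hx using mul_self_eq_zero.1 hx

lemma facePoly_eq_zero_of_surfInner {l : ℕ} (hN : ‖N‖ = 1) (hF : ∀ x ∈ F, ⟪N, x⟫_ℝ = c)
    (hb : Bornology.IsBounded F) (hm : MeasurableSet F) (hpos : surf (n + 1) F ≠ 0)
    (hfin : surf (n + 1) F < ⊤) (v : facePoly (n + 1) l N) (h : surfInner F v v = 0) : v = 0 :=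
  facePoly_eq_zero hN hF hm hpos v
    (ae_eq_zero_of_surfInner_self hb hm hfin (continuous_facePoly v) h)

variable {V : Type*} [AddCommGroup V] [Module ℝ V]

lemma existsUnique_isFaceProj (l : ℕ) (hN : ‖N‖ = 1) (hF : ∀ x ∈ F, ⟪N, x⟫_ℝ = c)
    (hb : Bornology.IsBounded F) (hm : MeasurableSet F) (hpos : surf (n + 1) F ≠ 0)
    (hfin : surf (n + 1) F < ⊤) {G : V → Pt (n + 1) → ℝ} (hG : IsFamily G) (v : V) :
    ∃! q, IsFaceProj l F N (G v) q :=
  (isBilin_surfInner hb hm hfin (isFamily_facePoly_id l N) (isFamily_facePoly_id l N)).existsUnique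
    (fun q hq => facePoly_eq_zero_of_surfInner hN hF hb hm hpos hfin q hq)
    ((isBilin_surfInner hb hm hfin hG (isFamily_facePoly_id l N)).2 v)

lemma isFaceProj_faceProj {l : ℕ} {g : Pt (n + 1) → ℝ} (h : ∃! q, IsFaceProj l F N g q) :
    IsFaceProj l F N g (faceProj l F N g) := by
  rw [faceProj, dif_pos h.exists]
  exact h.exists.choose_spec

lemma isLinearMap_faceProj (l : ℕ) (hN : ‖N‖ = 1) (hF : ∀ x ∈ F, ⟪N, x⟫_ℝ = c)
    (hb : Bornology.IsBounded F) (hm : MeasurableSet F) (hpos : surf (n + 1) F ≠ 0)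
    (hfin : surf (n + 1) F < ⊤) {G : V → Pt (n + 1) → ℝ} (hG : IsFamily G) :
    IsLinearMap ℝ fun v => faceProj l F N (G v) := by
  have hex := existsUnique_isFaceProj l hN hF hb hm hpos hfin hG
  have hq := isBilin_surfInner hb hm hfin (isFamily_facePoly_id l N) (isFamily_facePoly_id l N)
  have hg := isBilin_surfInner hb hm hfin hG (isFamily_facePoly_id l N)
  constructor
  · intro v w
    refine (hex (v + w)).unique (isFaceProj_faceProj (hex _)) fun r => ?_
    rw [hq.map_add_left, hg.map_add_left, isFaceProj_faceProj (hex v) r,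
      isFaceProj_faceProj (hex w) r]
  · intro a v
    refine (hex (a • v)).unique (isFaceProj_faceProj (hex _)) fun r => ?_
    rw [hq.map_smul_left, hg.map_smul_left, isFaceProj_faceProj (hex v) r]

end FaceProj

namespace Mesh

variable {n : ℕ} {Ω : Set (Pt (n + 1))} (M : Mesh (n + 1) Ω)

/-! ### Elementary properties of meshes -/

lemma isOpen_cell (K : M.cells) : IsOpen (K : Set (Pt (n + 1))) := (M.cell_domain K K.2).isOpen

lemma isBounded_cell (K : M.cells) : Bornology.IsBounded (K : Set (Pt (n + 1))) :=
  (M.cell_domain K K.2).bounded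

lemma isBounded_frontier (K : M.cells) : Bornology.IsBounded (frontier (K : Set (Pt (n + 1)))) :=
  (M.isBounded_cell K).closure.subset frontier_subset_closure

lemma face_subset_left (F : M.intFaces) :
    (F : Set (Pt (n + 1))) ⊆ frontier (M.left F : Set (Pt (n + 1))) :=
  (M.subset_frontier_iff F _).2 (Or.inl rfl)

lemma isBounded_face (F : M.intFaces) : Bornology.IsBounded (F : Set (Pt (n + 1))) :=
  (M.isBounded_frontier _).subset (M.face_subset_left F)

lemma measurableSet_face (F : M.intFaces) : MeasurableSet (F : Set (Pt (n + 1))) :=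
  (M.face_closed F F.2).measurableSet

lemma surf_face_lt_top (F : M.intFaces) : surf (n + 1) (F : Set (Pt (n + 1))) < ⊤ :=
  (measure_mono (M.face_subset_left F)).trans_lt (M.cell_domain _ (M.left F).2).area_lt_top

lemma surf_face_ne_zero (F : M.intFaces) : surf (n + 1) (F : Set (Pt (n + 1))) ≠ 0 :=
  (M.face_pos F F.2).ne'

lemma isBounded_bdry (K : M.cells) : Bornology.IsBounded (M.bdry K) :=
  (M.isBounded_frontier K).subset Set.inter_subset_left

lemma measurableSet_bdry (K : M.cells) : MeasurableSet (M.bdry K) :=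
  (isClosed_frontier.inter isClosed_frontier).measurableSet

lemma surf_bdry_lt_top (K : M.cells) : surf (n + 1) (M.bdry K) < ⊤ :=
  (measure_mono Set.inter_subset_left).trans_lt (M.cell_domain _ K.2).area_lt_top

lemma volume_cell_pos (K : M.cells) : 0 < volume (K : Set (Pt (n + 1))) :=
  (M.isOpen_cell K).measure_pos volume (M.cell_nonempty K K.2)

lemma volume_real_cell_pos (K : M.cells) : 0 < volume.real (K : Set (Pt (n + 1))) :=
  ENNReal.toReal_pos (M.volume_cell_pos K).ne' (M.isBounded_cell K).measure_lt_top.ne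

lemma diam_pos (K : M.cells) : 0 < M.diam K := by
  refine Metric.diam_pos (Set.not_subsingleton_iff.1 fun h => ?_) (M.isBounded_cell K)
  exact (M.volume_cell_pos K).ne' (h.measure_zero volume)

lemma sigma_pos (ε : ℝ) (K : M.cells) : 0 < M.sigma ε K :=
  lt_of_lt_of_le one_pos (le_max_left _ _)

lemma norm_faceNormal (K : M.cells) (F : M.intFaces) : ‖M.faceNormal K F‖ = 1 := by
  unfold faceNormal
  split_ifs
  · exact M.norm_normal F
  · rw [norm_neg, M.norm_normal F]

/-! ### The local reconstruction -/

variable {k : ℕ}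

lemma isBilin_reconRHS (ε : ℝ) (K : M.cells) :
    IsBilin fun (v : M.LocalSpace k K) (w : poly (n + 1) (k + 2)) => M.reconRHS ε v w := by
  have hK := M.isBounded_cell K
  have h1 : IsFamily fun v : M.LocalSpace k K => (v.1 : Pt (n + 1) → ℝ) :=
    (isFamily_poly_id (k + 2)).comp isLinearMap_fst
  have hcl : ∀ p : MvPolynomial (Fin (n + 1)) ℝ, Continuous (lap (ev p)) := fun p => by
    rw [lap_ev]; exact continuous_ev _
  have hcll : ∀ p : MvPolynomial (Fin (n + 1)) ℝ, Continuous (lap (lap (ev p))) := fun p => by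
    rw [lap_ev']; exact hcl _
  refine (((isBilin_vol hK h1 ((isFamily_poly (T := fun f => lap (lap f)) lin_lap_lap hcll
    (k + 2)).const_mul ε)).sub (isBilin_vol hK h1 (isFamily_poly (T := fun f => lap f) lin_lap hcl
    (k + 2)))).add (IsBilin.sum _ fun F => ?_)).sub ((IsBilin.sum _ fun F => ?_).const_mul ε)
  · exact isBilin_surfInner (M.isBounded_face F) (M.measurableSet_face F) (M.surf_face_lt_top F)
      ((isFamily_facePoly_id (k + 2) (M.normal F)).comp (isLinearMap_snd_fst_apply F))
      (isFamily_poly (T := fun f => dn (M.faceNormal K F) f) (lin_dn _) (continuous_dn_ev _) _)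
  · refine ((isBilin_surfInner (M.isBounded_face F) (M.measurableSet_face F) (M.surf_face_lt_top F)
      ((isFamily_facePoly_id (k + 2) (M.normal F)).comp (isLinearMap_snd_fst_apply F))
      (isFamily_poly (T := fun f => dn (M.faceNormal K F) (lap f)) (lin_dn_lap _) ?_ _)).sub
      (isBilin_surfInner (M.isBounded_face F) (M.measurableSet_face F) (M.surf_face_lt_top F)
      ((isFamily_facePoly_id k (M.normal F)).comp (isLinearMap_snd_snd_apply F))
      (isFamily_poly (T := fun f => dnn (M.faceNormal K F) f) (lin_dnn _) (continuous_dnn_ev _)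
        _))).sub (isBilin_surfInnerVec (M.isBounded_face F) (M.measurableSet_face F)
        (M.surf_face_lt_top F) ((isFamily_facePoly (T := fun f => dt (M.faceNormal K F) f)
          (lin_dt _) (continuous_dt_ev _) (k + 2) (M.normal F)).comp (isLinearMap_snd_fst_apply F))
      (isFamily_poly (T := fun f => dnt (M.faceNormal K F) f) (lin_dnt _) (continuous_dnt_ev _) _))
    intro p
    rw [lap_ev]
    exact continuous_dn_ev _ _

/-- The constant function `1`, as a polynomial. -/
def onePoly (d l : ℕ) : poly d l := ⟨fun _ => 1, 1, by simp, fun x => by simp⟩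

/-- Only derivatives of w enter. This compatibility allows the reconstruction equation to be tested
with all w instead of only those of zero mean. -/
lemma reconRHS_one (ε : ℝ) {K : M.cells} (v : M.LocalSpace k K) :
    M.reconRHS ε v (fun _ => 1) = 0 := by
  have hg : gradient (fun _ : Pt (n + 1) => (1 : ℝ)) = 0 := funext fun x => by simp [gradient]
  have hg0 : gradient (0 : Pt (n + 1) → ℝ) = 0 := funext fun x => by simp [gradient]
  have hh : ∀ x, hess (fun _ : Pt (n + 1) => (1 : ℝ)) x = 0 := fun x => by simp [hess, hg]
  have hl : lap (fun _ : Pt (n + 1) => (1 : ℝ)) = 0 := by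
    have h1 : (fun _ : Pt (n + 1) => (1 : ℝ)) = ev 1 := funext fun x => (ev_one x).symm
    rw [h1, lap_ev]; funext x; simp
  have hl0 : lap (0 : Pt (n + 1) → ℝ) = 0 := by
    have h1 : (0 : Pt (n + 1) → ℝ) = ev 0 := funext fun x => (ev_zero x).symm
    rw [h1, lap_ev]; funext x; simp
  simp [reconRHS, hl, hl0, surfInner, surfInnerVec, dn, dnn, dnt, hg, hg0, hh]

/-- The equation for mean-free w and the mean value condition merge into a single variational
equation on the whole polynomial space; testing it with 1 recovers the mean value condition. -/
lemma isRecon_iff (ε : ℝ) {K : M.cells} (v : M.LocalSpace k K) (R : poly (n + 1) (k + 2)) :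
    M.IsRecon ε v R ↔ ∀ w : poly (n + 1) (k + 2),
      gradInner ε (K : Set (Pt (n + 1))) R w + (∫ x in (K : Set (Pt (n + 1))), (R : Pt (n + 1) → ℝ) x) *
        (∫ x in (K : Set (Pt (n + 1))), (w : Pt (n + 1) → ℝ) x) =
      M.reconRHS ε v w + (∫ x in (K : Set (Pt (n + 1))), (v.1 : Pt (n + 1) → ℝ) x) *
        (∫ x in (K : Set (Pt (n + 1))), (w : Pt (n + 1) → ℝ) x) := by
  have hvol := M.volume_real_cell_pos K
  have h1 : ∫ x in (K : Set (Pt (n + 1))), (onePoly (n + 1) (k + 2) : Pt (n + 1) → ℝ) x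
      = volume.real (K : Set (Pt (n + 1))) := by simp [onePoly]
  have hint : IsLinearMap ℝ fun w : poly (n + 1) (k + 2) =>
      ∫ x in (K : Set (Pt (n + 1))), (w : Pt (n + 1) → ℝ) x :=
    isLinearMap_integral (fun v => integrableOn_of_bounded (M.isBounded_cell K) (continuous_poly v))
      (isFamily_poly_id (k + 2)).lin
  constructor
  · rintro ⟨h, hm⟩ w
    rw [hm]
    congr 1
    set m : ℝ := (∫ x in (K : Set (Pt (n + 1))), (w : Pt (n + 1) → ℝ) x) /
      volume.real (K : Set (Pt (n + 1))) with hmdef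
    -- Subtracting the mean value of w changes neither side of the original equation.
    have hw := h (w - m • onePoly (n + 1) (k + 2)) (by
      rw [hint.map_sub, hint.map_smul, h1, hmdef, smul_eq_mul, div_mul_cancel₀ _ hvol.ne', sub_self])
    rw [(isBilin_gradInner ε (M.isBounded_cell K) (k + 2)).map_sub_right,
      (isBilin_gradInner ε (M.isBounded_cell K) (k + 2)).map_smul_right,
      (M.isBilin_reconRHS ε K).map_sub_right, (M.isBilin_reconRHS ε K).map_smul_right] at hw
    rwa [show ((onePoly (n + 1) (k + 2) : poly (n + 1) (k + 2)) : Pt (n + 1) → ℝ) = fun _ => 1 from rfl,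
      reconRHS_one, gradInner_const_right, mul_zero, sub_zero, sub_zero] at hw
  · intro h
    have hm : (∫ x in (K : Set (Pt (n + 1))), (R : Pt (n + 1) → ℝ) x) =
        ∫ x in (K : Set (Pt (n + 1))), (v.1 : Pt (n + 1) → ℝ) x := by
      have := h (onePoly (n + 1) (k + 2))
      rw [h1, show ((onePoly (n + 1) (k + 2) : poly (n + 1) (k + 2)) : Pt (n + 1) → ℝ) = fun _ => 1 from rfl,
        reconRHS_one, gradInner_const_right, zero_add, zero_add] at this
      exact mul_right_cancel₀ hvol.ne' this
    refine ⟨fun w hw => ?_, hm⟩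
    simpa [hw] using h w

/-- The form of `isRecon_iff` is definite: zero energy forces R to be constant, and zero mean forces
the constant to be 0. -/
theorem existsUnique_isRecon {ε : ℝ} (hε : 0 ≤ ε) {K : M.cells} (v : M.LocalSpace k K) :
    ∃! R, M.IsRecon ε v R := by
  have hint : IsLinearMap ℝ fun w : poly (n + 1) (k + 2) =>
      ∫ x in (K : Set (Pt (n + 1))), (w : Pt (n + 1) → ℝ) x :=
    isLinearMap_integral (fun v => integrableOn_of_bounded (M.isBounded_cell K) (continuous_poly v))
      (isFamily_poly_id (k + 2)).lin
  simp only [isRecon_iff]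
  refine ((isBilin_gradInner ε (M.isBounded_cell K) (k + 2)).add
    (isBilin_mul hint hint)).existsUnique (fun R hR => ?_)
    (((M.isBilin_reconRHS ε K).2 v).add' (hint.const_mul _))
  have h1 := gradInner_self_nonneg hε (K : Set (Pt (n + 1))) R
  have h2 := mul_self_nonneg (∫ x in (K : Set (Pt (n + 1))), (R : Pt (n + 1) → ℝ) x)
  have h3 : gradInner ε (K : Set (Pt (n + 1))) R R = 0 := by linarith
  have h4 : (∫ x in (K : Set (Pt (n + 1))), (R : Pt (n + 1) → ℝ) x) = 0 :=
    mul_self_eq_zero.1 (by linarith)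
  obtain ⟨a, ha⟩ := exists_const_of_gradInner_self hε (M.isOpen_cell K) (M.isBounded_cell K)
    (M.cell_nonempty K K.2) R h3
  rw [ha, setIntegral_const, smul_eq_mul] at h4
  have ha0 : a = 0 := (mul_eq_zero.1 h4).resolve_left (M.volume_real_cell_pos K).ne'
  ext x
  rw [ha, ha0]; rfl

lemma isRecon_recon {ε : ℝ} (hε : 0 ≤ ε) {K : M.cells} (v : M.LocalSpace k K) :
    M.IsRecon ε v (M.recon ε v) := by
  rw [recon, dif_pos (M.existsUnique_isRecon hε v).exists]
  exact (M.existsUnique_isRecon hε v).exists.choose_spec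

/-- Here w need not have zero mean, so that the cell component itself may later serve as a test
function. -/
lemma gradInner_recon {ε : ℝ} (hε : 0 ≤ ε) {K : M.cells} (v : M.LocalSpace k K)
    (w : poly (n + 1) (k + 2)) :
    gradInner ε (K : Set (Pt (n + 1))) (M.recon ε v) w = M.reconRHS ε v w := by
  have h := M.isRecon_recon hε v
  have := (M.isRecon_iff ε v _).1 h w
  rw [h.2] at this
  linarith

lemma isLinearMap_recon {ε : ℝ} (hε : 0 ≤ ε) (K : M.cells) :
    IsLinearMap ℝ fun v : M.LocalSpace k K => M.recon ε v := by
  have hint : IsLinearMap ℝ fun w : poly (n + 1) (k + 2) =>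
      ∫ x in (K : Set (Pt (n + 1))), (w : Pt (n + 1) → ℝ) x :=
    isLinearMap_integral (fun v => integrableOn_of_bounded (M.isBounded_cell K) (continuous_poly v))
      (isFamily_poly_id (k + 2)).lin
  have hg := isBilin_gradInner ε (M.isBounded_cell K) (k + 2)
  have hr := M.isBilin_reconRHS (k := k) ε K
  constructor
  · intro v w
    refine (M.existsUnique_isRecon hε (v + w)).unique (M.isRecon_recon hε _) ⟨fun z _ => ?_, ?_⟩
    · rw [hg.map_add_left, hr.map_add_left, M.gradInner_recon hε, M.gradInner_recon hε]
    · rw [hint.map_add, (M.isRecon_recon hε v).2, (M.isRecon_recon hε w).2, ← hint.map_add]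
      rfl
  · intro a v
    refine (M.existsUnique_isRecon hε (a • v)).unique (M.isRecon_recon hε _) ⟨fun z _ => ?_, ?_⟩
    · rw [hg.map_smul_left, hr.map_smul_left, M.gradInner_recon hε]
    · rw [hint.map_smul, (M.isRecon_recon hε v).2, ← hint.map_smul]
      rfl


/-! ### Bilinearity of the discrete forms -/

lemma exists_plane (K : M.cells) (F : M.intFaces) :
    ∃ c : ℝ, ∀ x ∈ (F : Set (Pt (n + 1))), ⟪M.faceNormal K F, x⟫_ℝ = c := by
  obtain ⟨c, hc⟩ := M.planar F
  unfold faceNormal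
  split_ifs
  · exact ⟨c, hc⟩
  · exact ⟨-c, fun x hx => by rw [inner_neg_left, hc x hx]⟩

/-- The jump `v_F - v_K` on a face of a cell. -/
def jump {K : M.cells} (F : M.facesOf K) (v : M.LocalSpace k K) (x : Pt (n + 1)) : ℝ :=
  (v.2.1 F : Pt (n + 1) → ℝ) x - (v.1 : Pt (n + 1) → ℝ) x

/-- The jump `γ_F - ∂ₙ v_K` of the normal derivative on a face of a cell. -/
def normalJump {K : M.cells} (F : M.facesOf K) (v : M.LocalSpace k K) (x : Pt (n + 1)) : ℝ :=
  (v.2.2 F : Pt (n + 1) → ℝ) x - dn (M.faceNormal K F) v.1 x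

lemma isFamily_fst (K : M.cells) :
    IsFamily fun v : M.LocalSpace k K => (v.1 : Pt (n + 1) → ℝ) :=
  (isFamily_poly_id (k + 2)).comp isLinearMap_fst

lemma isFamily_jump {K : M.cells} (F : M.facesOf K) : IsFamily (M.jump (k := k) F) :=
  ((isFamily_facePoly_id (k + 2) (M.normal F)).comp (isLinearMap_snd_fst_apply F)).sub
    (M.isFamily_fst K)

lemma isFamily_normalJump {K : M.cells} (F : M.facesOf K) : IsFamily (M.normalJump (k := k) F) :=
  ((isFamily_facePoly_id k (M.normal F)).comp (isLinearMap_snd_snd_apply F)).sub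
    ((isFamily_poly (T := fun f => dn (M.faceNormal K F) f) (lin_dn _) (continuous_dn_ev _)
      (k + 2)).comp isLinearMap_fst)

lemma isBilin_face (F : M.intFaces) {V W : Type*} [AddCommGroup V] [Module ℝ V] [AddCommGroup W]
    [Module ℝ W] {A : V → Pt (n + 1) → ℝ} {B : W → Pt (n + 1) → ℝ} (hA : IsFamily A)
    (hB : IsFamily B) : IsBilin fun v w => surfInner F (A v) (B w) :=
  isBilin_surfInner (M.isBounded_face F) (M.measurableSet_face F) (M.surf_face_lt_top F) hA hB

lemma isFaceProj_normalJump {K : M.cells} (F : M.facesOf K) (v : M.LocalSpace k K) :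
    IsFaceProj k F (M.normal F) (M.normalJump F v) (faceProj k F (M.normal F) (M.normalJump F v)) :=
  isFaceProj_faceProj (existsUnique_isFaceProj k (M.norm_normal F) (M.planar F).choose_spec
    (M.isBounded_face F) (M.measurableSet_face F) (M.surf_face_ne_zero F) (M.surf_face_lt_top F)
    (M.isFamily_normalJump F) v)

lemma isFamily_faceProj_normalJump {K : M.cells} (F : M.facesOf K) :
    IsFamily fun v : M.LocalSpace k K =>
      (faceProj k F (M.normal F) (M.normalJump F v) : Pt (n + 1) → ℝ) :=
  (isFamily_facePoly_id k (M.normal F)).comp (isLinearMap_faceProj k (M.norm_normal F)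
    (M.planar F).choose_spec (M.isBounded_face F) (M.measurableSet_face F) (M.surf_face_ne_zero F)
    (M.surf_face_lt_top F) (M.isFamily_normalJump F))

lemma isBilin_stabBdry (ε : ℝ) (K : M.cells) :
    IsBilin fun v w : M.LocalSpace k K => M.stabBdry ε K v.1 w.1 := by
  have hg : IsFamily fun v : M.LocalSpace k K => gradient (v.1 : Pt (n + 1) → ℝ) :=
    (isFamily_poly (T := fun f => gradient f) lin_gradient continuous_gradient_ev (k + 2)).comp
      isLinearMap_fst
  exact ((isBilin_surfInner (M.isBounded_bdry K) (M.measurableSet_bdry K) (M.surf_bdry_lt_top K)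
    (M.isFamily_fst K) (M.isFamily_fst K)).const_mul _).add
    ((isBilin_surfInnerVec (M.isBounded_bdry K) (M.measurableSet_bdry K) (M.surf_bdry_lt_top K)
      hg hg).const_mul _)

lemma isBilin_localForm {ε : ℝ} (hε : 0 ≤ ε) (K : M.cells) :
    IsBilin fun v w : M.LocalSpace k K => M.localForm ε v w :=
  (((isBilin_gradInner ε (M.isBounded_cell K) (k + 2)).comp (M.isLinearMap_recon hε K)
    (M.isLinearMap_recon hε K)).add
    (((IsBilin.sum _ fun F => M.isBilin_face _ (M.isFamily_jump F) (M.isFamily_jump F)).const_mul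
      _).add ((IsBilin.sum _ fun F => M.isBilin_face _ (M.isFamily_faceProj_normalJump F)
        (M.isFamily_normalJump F)).const_mul _))).add (M.isBilin_stabBdry ε K)

/-- The bilinear form whose quadratic form is the local energy. -/
def localEnergyForm (ε : ℝ) {K : M.cells} (v w : M.LocalSpace k K) : ℝ :=
  gradInner ε (K : Set (Pt (n + 1))) v.1 w.1
  + M.sigma ε K * (M.diam K)⁻¹ * (∑ F : M.facesOf K, surfInner F (M.jump F v) (M.jump F w))
  + M.sigma ε K * M.diam K * (∑ F : M.facesOf K, surfInner F (M.normalJump F v) (M.normalJump F w))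
  + M.stabBdry ε K v.1 w.1

lemma localEnergyForm_self (ε : ℝ) {K : M.cells} (v : M.LocalSpace k K) :
    M.localEnergyForm ε v v = M.localEnergy ε v := by
  simp only [localEnergyForm, localEnergy, surfInner, jump, normalJump, sq]

lemma isBilin_localEnergyForm (ε : ℝ) (K : M.cells) :
    IsBilin fun v w : M.LocalSpace k K => M.localEnergyForm ε v w :=
  ((((isBilin_gradInner ε (M.isBounded_cell K) (k + 2)).comp isLinearMap_fst isLinearMap_fst).add
    ((IsBilin.sum _ fun F => M.isBilin_face _ (M.isFamily_jump F) (M.isFamily_jump F)).const_mul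
      _)).add ((IsBilin.sum _ fun F => M.isBilin_face _ (M.isFamily_normalJump F)
        (M.isFamily_normalJump F)).const_mul _)).add (M.isBilin_stabBdry ε K)

lemma isLinearMap_localize (K : M.cells) :
    IsLinearMap ℝ fun v : M.Space k => M.localize v K :=
  ⟨fun v w => by
    refine Prod.ext rfl (Prod.ext rfl (funext fun F => ?_))
    exact smul_add _ _ _,
   fun r v => by
    refine Prod.ext rfl (Prod.ext rfl (funext fun F => ?_))
    exact smul_comm _ r (v.2.2 F)⟩

lemma isBilin_form {ε : ℝ} (hε : 0 ≤ ε) : IsBilin fun v w : M.Space k => M.form ε v w :=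
  IsBilin.sum _ fun K => (M.isBilin_localForm hε K).comp (M.isLinearMap_localize K)
    (M.isLinearMap_localize K)

lemma isBilin_energyForm (ε : ℝ) :
    IsBilin fun v w : M.Space k => ∑ K, M.localEnergyForm ε (M.localize v K) (M.localize w K) :=
  IsBilin.sum _ fun K => (M.isBilin_localEnergyForm ε K).comp (M.isLinearMap_localize K)
    (M.isLinearMap_localize K)

/-! ### Positivity of the discrete form -/

lemma surfInner_self_nonneg {d : ℕ} (S : Set (Pt d)) (f : Pt d → ℝ) : 0 ≤ surfInner S f f :=
  integral_nonneg fun _ => mul_self_nonneg _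

/-- The defining property of the projection is tested with the projection itself; it turns the
normal derivative stabilisation into a square. -/
lemma surfInner_faceProj {K : M.cells} (F : M.facesOf K) (v : M.LocalSpace k K) :
    surfInner (F : Set (Pt (n + 1))) (faceProj k F (M.normal F) (M.normalJump F v))
        (M.normalJump F v) =
      surfInner (F : Set (Pt (n + 1))) (faceProj k F (M.normal F) (M.normalJump F v))
        (faceProj k F (M.normal F) (M.normalJump F v)) := by
  rw [M.isFaceProj_normalJump F v]
  simp only [surfInner, mul_comm]

lemma surfInner_faceProj_nonneg {K : M.cells} (F : M.facesOf K) (v : M.LocalSpace k K) :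
    0 ≤ surfInner (F : Set (Pt (n + 1))) (faceProj k F (M.normal F) (M.normalJump F v))
      (M.normalJump F v) := by
  rw [surfInner_faceProj]
  exact surfInner_self_nonneg _ _

lemma stabInt_self_nonneg (ε : ℝ) {K : M.cells} (v : M.LocalSpace k K) : 0 ≤ M.stabInt ε v v :=
  have h := M.diam_pos K
  have hs := M.sigma_pos ε K
  add_nonneg (mul_nonneg (by positivity) (Finset.sum_nonneg fun _ _ => surfInner_self_nonneg _ _))
    (mul_nonneg (by positivity) (Finset.sum_nonneg fun F _ => M.surfInner_faceProj_nonneg F v))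

lemma surfInnerVec_self_nonneg {d : ℕ} (S : Set (Pt d)) (f : Pt d → Pt d) :
    0 ≤ surfInnerVec S f f :=
  integral_nonneg fun _ => real_inner_self_nonneg

lemma stabBdry_self_nonneg {ε : ℝ} (hε : 0 ≤ ε) (K : M.cells) (v : Pt (n + 1) → ℝ) :
    0 ≤ M.stabBdry ε K v v :=
  have h := M.diam_pos K
  have hs := M.sigma_pos ε K
  add_nonneg (mul_nonneg (by positivity) (surfInner_self_nonneg _ _))
    (mul_nonneg (by positivity) (surfInnerVec_self_nonneg _ _))

lemma localForm_self_nonneg {ε : ℝ} (hε : 0 ≤ ε) {K : M.cells} (v : M.LocalSpace k K) :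
    0 ≤ M.localForm ε v v :=
  add_nonneg (add_nonneg (gradInner_self_nonneg hε _ _) (M.stabInt_self_nonneg ε v))
    (M.stabBdry_self_nonneg hε K _)

lemma form_self_nonneg {ε : ℝ} (hε : 0 ≤ ε) (v : M.Space k) : 0 ≤ M.form ε v v :=
  Finset.sum_nonneg fun K _ => M.localForm_self_nonneg hε (M.localize v K)

/-- The kernel of the local form. -/
structure IsLocalKernel (ε : ℝ) {K : M.cells} (v : M.LocalSpace k K) : Prop where
  recon : gradInner ε (K : Set (Pt (n + 1))) (M.recon ε v) (M.recon ε v) = 0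
  jump : ∀ F : M.facesOf K, ∀ᵐ x ∂(surf (n + 1)).restrict (F : Set (Pt (n + 1))), M.jump F v x = 0
  normalJump : ∀ F : M.facesOf K, ∀ r : facePoly (n + 1) k (M.normal F),
    surfInner F (M.normalJump F v) r = 0
  bdry : ∀ᵐ x ∂(surf (n + 1)).restrict (M.bdry K), (v.1 : Pt (n + 1) → ℝ) x = 0
  bdry_gradient : ε ≠ 0 →
    ∀ᵐ x ∂(surf (n + 1)).restrict (M.bdry K), gradient (v.1 : Pt (n + 1) → ℝ) x = 0

/-- All terms of the local form are nonnegative, so each vanishes. Their weights are positive,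
except that of the boundary gradient penalty, which is a multiple of ε. -/
lemma isLocalKernel_of_localForm_self {ε : ℝ} (hε : 0 ≤ ε) {K : M.cells} (v : M.LocalSpace k K)
    (h : M.localForm ε v v = 0) : M.IsLocalKernel ε v := by
  have hd := M.diam_pos K
  have hs := M.sigma_pos ε K
  have h1 := gradInner_self_nonneg hε (K : Set (Pt (n + 1))) (M.recon ε v)
  have h2 := M.stabInt_self_nonneg ε v
  have h3 := M.stabBdry_self_nonneg hε K v.1
  unfold localForm at h
  have e1 : gradInner ε (K : Set (Pt (n + 1))) (M.recon ε v) (M.recon ε v) = 0 := by linarith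
  have e2 : M.stabInt ε v v = 0 := by linarith
  have e3 : M.stabBdry ε K v.1 v.1 = 0 := by linarith
  have n1 : ∀ F : M.facesOf K, 0 ≤ surfInner F (M.jump F v) (M.jump F v) :=
    fun F => surfInner_self_nonneg _ _
  have n2 := fun F : M.facesOf K => M.surfInner_faceProj_nonneg F v
  obtain ⟨e4, e5⟩ := (add_eq_zero_iff_of_nonneg
    (mul_nonneg (by positivity) (Finset.sum_nonneg fun F _ => n1 F))
    (mul_nonneg (by positivity) (Finset.sum_nonneg fun F _ => n2 F))).1 e2
  rw [mul_eq_zero, or_iff_right (by positivity),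
    Finset.sum_eq_zero_iff_of_nonneg fun F _ => n1 F] at e4
  rw [mul_eq_zero, or_iff_right (by positivity),
    Finset.sum_eq_zero_iff_of_nonneg fun F _ => n2 F] at e5
  obtain ⟨e6, e7⟩ := (add_eq_zero_iff_of_nonneg
    (mul_nonneg (by positivity) (surfInner_self_nonneg _ _))
    (mul_nonneg (by positivity) (surfInnerVec_self_nonneg _ _))).1 e3
  rw [mul_eq_zero, or_iff_right (by positivity)] at e6
  refine ⟨e1, fun F => ?_, fun F r => ?_, ?_, fun hε0 => ?_⟩
  · exact ae_eq_zero_of_surfInner_self (M.isBounded_face F) (M.measurableSet_face F)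
      (M.surf_face_lt_top F) ((M.isFamily_jump F).cont v) (e4 F (Finset.mem_univ F))
  · have h0 := e5 F (Finset.mem_univ F)
    rw [surfInner_faceProj] at h0
    have := facePoly_eq_zero_of_surfInner (M.norm_normal F) (M.planar F).choose_spec
      (M.isBounded_face F) (M.measurableSet_face F) (M.surf_face_ne_zero F) (M.surf_face_lt_top F)
      _ h0
    rw [← M.isFaceProj_normalJump F v r, this]
    simp [surfInner]
  · exact ae_eq_zero_of_surfInner_self (M.isBounded_bdry K) (M.measurableSet_bdry K)
      (M.surf_bdry_lt_top K) (continuous_poly v.1) e6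
  · rw [mul_eq_zero, or_iff_right (by positivity), surfInnerVec,
      setIntegral_eq_zero_iff_of_nonneg_ae (Filter.Eventually.of_forall fun x =>
        real_inner_self_nonneg) ?_] at e7
    · filter_upwards [e7] with x hx using inner_self_eq_zero.1 hx
    · have hc : Continuous (gradient (v.1 : Pt (n + 1) → ℝ)) :=
        poly_prop (P := fun f => Continuous (gradient f)) continuous_gradient_ev v.1
      exact integrableOn_surf (M.isBounded_bdry K) (M.measurableSet_bdry K) (M.surf_bdry_lt_top K)
        (hc.inner hc)

end Mesh

/-! ### Green's identities on a cell, and the reconstruction on the kernel. -/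

lemma pderiv_comm {d : ℕ} (i j : Fin d) (p : MvPolynomial (Fin d) ℝ) :
    MvPolynomial.pderiv i (MvPolynomial.pderiv j p) =
      MvPolynomial.pderiv j (MvPolynomial.pderiv i p) := by
  have h : ⁅(MvPolynomial.pderiv i : Derivation ℝ (MvPolynomial (Fin d) ℝ)
      (MvPolynomial (Fin d) ℝ)), (MvPolynomial.pderiv j : Derivation ℝ (MvPolynomial (Fin d) ℝ)
      (MvPolynomial (Fin d) ℝ))⁆ = 0 := by
    -- The commutator of two derivations is a derivation, so it suffices to check it on the
    -- variables.
    refine MvPolynomial.derivation_ext fun k => ?_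
    rw [Derivation.commutator_apply]
    simp [MvPolynomial.pderiv_X, Pi.single_apply, apply_ite]
  have := congrArg (fun D => D p) h
  simpa [Derivation.commutator_apply, sub_eq_zero] using this

lemma pderiv_lapPoly {d : ℕ} (i : Fin d) (p : MvPolynomial (Fin d) ℝ) :
    MvPolynomial.pderiv i (lapPoly p) = lapPoly (MvPolynomial.pderiv i p) := by
  simp only [lapPoly, LinearMap.coe_mk, AddHom.coe_mk, map_sum]
  exact Finset.sum_congr rfl fun j _ => by rw [pderiv_comm i j, pderiv_comm i j]

lemma dn_ev {d : ℕ} (N : Pt d) (p : MvPolynomial (Fin d) ℝ) (x : Pt d) :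
    dn N (ev p) x = ∑ i, N i * ev (MvPolynomial.pderiv i p) x := by
  simp [dn, gradient_ev, PiLp.inner_apply, mul_comm]

lemma inner_gradient_ev {d : ℕ} (p q : MvPolynomial (Fin d) ℝ) (x : Pt d) :
    ⟪gradient (ev p) x, gradient (ev q) x⟫_ℝ =
      ∑ i, ev (MvPolynomial.pderiv i p) x * ev (MvPolynomial.pderiv i q) x := by
  simp [gradient_ev, PiLp.inner_apply, mul_comm]

lemma hessInner_ev {d : ℕ} (p q : MvPolynomial (Fin d) ℝ) (x : Pt d) :
    hessInner (ev p) (ev q) x = ∑ j, ⟪gradient (ev (MvPolynomial.pderiv j p)) x,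
      gradient (ev (MvPolynomial.pderiv j q)) x⟫_ℝ := by
  simp only [inner_gradient_ev]
  rw [Finset.sum_comm]
  simp [hessInner, hess_ev, PiLp.inner_apply, mul_comm]

lemma inner_eq_normal_add_tangential {d : ℕ} {N : Pt d} (hN : ‖N‖ = 1) (g h : Pt d) :
    ⟪g, h⟫_ℝ = ⟪N, g⟫_ℝ * ⟪N, h⟫_ℝ + ⟪g - ⟪N, g⟫_ℝ • N, h - ⟪N, h⟫_ℝ • N⟫_ℝ := by
  simp only [inner_sub_left, inner_sub_right, real_inner_smul_left, real_inner_smul_right,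
    real_inner_self_eq_norm_sq, hN, real_inner_comm N g]
  ring

/-- The tangential derivative of a polynomial that vanishes on a plane. -/
lemma dt_eq_zero {d : ℕ} {N : Pt d} {c : ℝ} {p : MvPolynomial (Fin d) ℝ} (hN : ‖N‖ = 1)
    (hp : ∀ x, ⟪N, x⟫_ℝ = c → ev p x = 0) {x : Pt d} (hx : ⟪N, x⟫_ℝ = c) : dt N (ev p) x = 0 := by
  set τ := dt N (ev p) x with hτ
  have hNτ : ⟪N, τ⟫_ℝ = 0 := by
    rw [hτ, dt, inner_sub_right, real_inner_smul_right, real_inner_self_eq_norm_sq, hN, dn]; ring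
  -- Moving along the tangential gradient τ itself stays in the plane, where p vanishes; the
  -- derivative along this line is |τ|², which is therefore 0.
  have hline : HasDerivAt (fun s : ℝ => x + s • τ) τ 0 := by
    simpa using ((hasDerivAt_id (0 : ℝ)).smul_const τ).const_add x
  have hf : HasFDerivAt (ev p) (innerSL ℝ (gradient (ev p) x)) (x + (0 : ℝ) • τ) := by
    rw [zero_smul, add_zero]
    exact (hasFDerivAt_ev p x).differentiableAt.hasGradientAt.hasFDerivAt
  have h1 := hf.comp_hasDerivAt (0 : ℝ) hline
  have h2 : (ev p ∘ fun s : ℝ => x + s • τ) = fun _ => 0 := funext fun s => hp _ (by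
    rw [inner_add_right, real_inner_smul_right, hNτ, hx]; ring)
  rw [h2] at h1
  have h3 := h1.unique (hasDerivAt_const (0 : ℝ) (0 : ℝ))
  rw [innerSL_apply_apply] at h3
  have h4 : gradient (ev p) x = τ + dn N (ev p) x • N := by rw [hτ, dt]; abel
  rw [h4, inner_add_left, real_inner_smul_left, hNτ, mul_zero, add_zero] at h3
  exact inner_self_eq_zero.1 h3

namespace Mesh

variable {n : ℕ} {Ω : Set (Pt (n + 1))} (M : Mesh (n + 1) Ω) {k : ℕ}

lemma mem_facesOf {K : M.cells} {F : M.intFaces} :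
    F ∈ M.facesOf K ↔ (F : Set (Pt (n + 1))) ⊆ frontier (K : Set (Pt (n + 1))) := by
  simp [facesOf]

lemma isOutwardNormalAt_faceNormal (K : M.cells) (F : M.facesOf K) :
    ∀ᵐ x ∂(surf (n + 1)).restrict (F : Set (Pt (n + 1))),
      IsOutwardNormalAt (K : Set (Pt (n + 1))) x (M.faceNormal K F) := by
  filter_upwards [M.ae_normal F] with x hx
  unfold faceNormal
  rcases (M.subset_frontier_iff F K).1 (M.mem_facesOf.1 F.2) with h | h
  · rw [if_pos h]; have := hx.1; rwa [← h] at this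
  · rw [if_neg fun h' => M.left_ne_right F (h'.symm.trans h)]; have := hx.2; rwa [← h] at this

/-- The part of the boundary of a cell outside of its interior faces lies on the boundary of the
domain. -/
lemma mem_bdry_of_notMem_faces {K : M.cells} {x : Pt (n + 1)}
    (hx : x ∈ frontier (K : Set (Pt (n + 1)))) (h : ∀ F : M.facesOf K, x ∉ (F : Set (Pt (n + 1)))) :
    x ∈ M.bdry K := by
  refine ⟨hx, closure_mono (M.cell_subset K K.2) (frontier_subset_closure hx), fun hi => ?_⟩
  have : x ∈ closure (frontier (K : Set (Pt (n + 1))) ∩ Ω) :=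
    subset_closure ⟨hx, interior_subset hi⟩
  rw [M.interior_boundary K K.2] at this
  simp only [Set.mem_iUnion] at this
  obtain ⟨F, hF, hFK, hxF⟩ := this
  exact h ⟨⟨F, hF⟩, M.mem_facesOf.2 hFK⟩ hxF

/-- The divergence theorem on a cell for polynomials that vanish on the boundary of the domain. -/
lemma integral_pderiv_cell (K : M.cells) {p : MvPolynomial (Fin (n + 1)) ℝ}
    (hp : ∀ᵐ x ∂(surf (n + 1)).restrict (M.bdry K), ev p x = 0) (i : Fin (n + 1)) :
    ∫ x in (K : Set (Pt (n + 1))), ev (MvPolynomial.pderiv i p) x =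
      ∑ F : M.facesOf K, M.faceNormal K F i * ∫ x in (F : Set (Pt (n + 1))), ev p x ∂surf (n + 1) := by
  choose c hc using fun F : M.facesOf K => M.exists_plane K F
  refine integral_pderiv (M.isOpen_cell K) (M.isBounded_cell K)
    (fun F : M.facesOf K => (F : Set (Pt (n + 1)))) (fun F => M.faceNormal K F) c
    (fun F => M.face_closed _ F.1.2) (fun F => M.mem_facesOf.1 F.2) (fun F => M.norm_faceNormal K F)
    hc (fun F F' h => M.face_overlap _ F.1.2 _ F'.1.2 fun h' => h (Subtype.ext (Subtype.ext h')))
    (M.isOutwardNormalAt_faceNormal K) p ?_ i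
  rw [ae_restrict_iff' (M.measurableSet_bdry K), ae_iff] at hp
  refine measure_mono_null (fun x hx => ?_) hp
  exact fun h => hx.2.1 (h (M.mem_bdry_of_notMem_faces hx.1 hx.2.2))

/-- Green's first identity on a cell. -/
lemma integral_inner_gradient (K : M.cells) {p : MvPolynomial (Fin (n + 1)) ℝ}
    (hp : ∀ᵐ x ∂(surf (n + 1)).restrict (M.bdry K), ev p x = 0) (q : MvPolynomial (Fin (n + 1)) ℝ) :
    ∫ x in (K : Set (Pt (n + 1))), ⟪gradient (ev p) x, gradient (ev q) x⟫_ℝ =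
      ∑ F : M.facesOf K, surfInner (F : Set (Pt (n + 1))) (ev p) (dn (M.faceNormal K F) (ev q)) -
      ∫ x in (K : Set (Pt (n + 1))), ev p x * lap (ev q) x := by
  -- The divergence theorem for the field p ∇q, one component at a time. Each component inherits the
  -- zeros of p on ∂K ∩ ∂Ω.
  have h1 : ∀ i, ∫ x in (K : Set (Pt (n + 1))),
      ev (MvPolynomial.pderiv i (p * MvPolynomial.pderiv i q)) x = _ := fun i =>
    M.integral_pderiv_cell K (p := p * MvPolynomial.pderiv i q) (by
      filter_upwards [hp] with x hx; rw [ev_mul, hx, zero_mul]) i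
  have h2 : ∀ F : M.facesOf K, surfInner (F : Set (Pt (n + 1))) (ev p)
      (dn (M.faceNormal K F) (ev q)) = ∑ i, M.faceNormal K F i *
        ∫ x in (F : Set (Pt (n + 1))), ev (p * MvPolynomial.pderiv i q) x ∂surf (n + 1) := by
    intro F
    simp only [← integral_const_mul]
    rw [← integral_finsetSum, surfInner]
    · refine integral_congr_ae (Filter.Eventually.of_forall fun x => ?_)
      simp only [dn_ev, ev_mul, Finset.mul_sum]
      exact Finset.sum_congr rfl fun _ _ => by ring
    · exact fun i _ => (integrableOn_surf (M.isBounded_face F) (M.measurableSet_face F)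
        (M.surf_face_lt_top F) (continuous_ev _)).const_mul _
  simp only [h2]
  rw [Finset.sum_comm, ← Finset.sum_congr rfl fun i _ => h1 i, ← integral_finsetSum,
    ← integral_sub]
  · refine integral_congr_ae (Filter.Eventually.of_forall fun x => ?_)
    simp only [inner_gradient_ev, lap_ev, ev_sum, MvPolynomial.pderiv_mul, ev_add, ev_mul,
      Finset.sum_add_distrib, Finset.mul_sum]
    ring
  · exact integrable_finsetSum _ fun i _ =>
      integrableOn_of_bounded (M.isBounded_cell K) (continuous_ev _)
  · rw [lap_ev]
    exact integrableOn_of_bounded (M.isBounded_cell K) ((continuous_ev _).mul (continuous_ev _))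
  · exact fun i _ => integrableOn_of_bounded (M.isBounded_cell K) (continuous_ev _)

/-- Green's first identity is applied to each pair ∂_j p, ∂_j q, which uses ∇p = 0 on ∂K ∩ ∂Ω. The
volume terms add up to ∫ ∇p · ∇Δq, which is integrated by parts again using p = 0 there. On a face,
Σ_j ∂_j p ∂ₙ∂_j q = ∇p · ∇²q n splits into its normal and tangential parts. -/
lemma integral_hessInner (K : M.cells) {p : MvPolynomial (Fin (n + 1)) ℝ}
    (hp : ∀ᵐ x ∂(surf (n + 1)).restrict (M.bdry K), ev p x = 0)
    (hp' : ∀ᵐ x ∂(surf (n + 1)).restrict (M.bdry K), gradient (ev p) x = 0)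
    (q : MvPolynomial (Fin (n + 1)) ℝ) :
    ∫ x in (K : Set (Pt (n + 1))), hessInner (ev p) (ev q) x =
      ∑ F : M.facesOf K, (surfInner (F : Set (Pt (n + 1))) (dn (M.faceNormal K F) (ev p))
          (dnn (M.faceNormal K F) (ev q)) + surfInnerVec (F : Set (Pt (n + 1)))
          (dt (M.faceNormal K F) (ev p)) (dnt (M.faceNormal K F) (ev q))) -
      (∑ F : M.facesOf K, surfInner (F : Set (Pt (n + 1))) (ev p)
        (dn (M.faceNormal K F) (lap (ev q))) -
      ∫ x in (K : Set (Pt (n + 1))), ev p x * lap (lap (ev q)) x) := by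
  have hb := M.isBounded_cell K
  have h1 : ∀ j, ∫ x in (K : Set (Pt (n + 1))), ⟪gradient (ev (MvPolynomial.pderiv j p)) x,
      gradient (ev (MvPolynomial.pderiv j q)) x⟫_ℝ = _ := fun j =>
    M.integral_inner_gradient K (p := MvPolynomial.pderiv j p) (by
      filter_upwards [hp'] with x hx
      have := congrArg (fun y : Pt (n + 1) => y j) (gradient_ev p x)
      rw [hx] at this
      simpa using this.symm) (MvPolynomial.pderiv j q)
  have h2 : ∀ F : M.facesOf K,
      ∑ j, surfInner (F : Set (Pt (n + 1))) (ev (MvPolynomial.pderiv j p))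
        (dn (M.faceNormal K F) (ev (MvPolynomial.pderiv j q))) =
      surfInner (F : Set (Pt (n + 1))) (dn (M.faceNormal K F) (ev p))
          (dnn (M.faceNormal K F) (ev q)) + surfInnerVec (F : Set (Pt (n + 1)))
          (dt (M.faceNormal K F) (ev p)) (dnt (M.faceNormal K F) (ev q)) := by
    intro F
    have hi : ∀ {f : Pt (n + 1) → ℝ}, Continuous f → IntegrableOn f F (surf (n + 1)) := fun hf =>
      integrableOn_surf (M.isBounded_face F) (M.measurableSet_face F) (M.surf_face_lt_top F) hf
    unfold surfInner surfInnerVec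
    rw [← integral_finsetSum, ← integral_add]
    · refine integral_congr_ae (Filter.Eventually.of_forall fun x => ?_)
      have := inner_eq_normal_add_tangential (M.norm_faceNormal K F) (gradient (ev p) x)
        (hess (ev q) x (M.faceNormal K F))
      refine Eq.trans ?_ this
      simp only [gradient_ev, hess_ev, PiLp.inner_apply, dn_ev]
      simp [mul_comm]
    · exact hi ((continuous_dn_ev _ p).mul (continuous_dnn_ev _ q))
    · exact hi ((continuous_dt_ev _ p).inner (continuous_dnt_ev _ q))
    · exact fun j _ => hi ((continuous_ev _).mul (continuous_dn_ev _ _))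
  have h3 : ∑ j, ∫ x in (K : Set (Pt (n + 1))), ev (MvPolynomial.pderiv j p) x *
      lap (ev (MvPolynomial.pderiv j q)) x = ∫ x in (K : Set (Pt (n + 1))),
        ⟪gradient (ev p) x, gradient (ev (lapPoly q)) x⟫_ℝ := by
    rw [← integral_finsetSum]
    · refine integral_congr_ae (Filter.Eventually.of_forall fun x => ?_)
      simp only [inner_gradient_ev, lap_ev', pderiv_lapPoly]
    · intro j _
      rw [lap_ev']
      exact integrableOn_of_bounded hb ((continuous_ev _).mul (continuous_ev _))
  simp only [hessInner_ev]
  rw [integral_finsetSum _ fun j _ => integrableOn_of_bounded hb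
    ((continuous_gradient_ev _).inner (continuous_gradient_ev _))]
  simp only [h1, Finset.sum_sub_distrib]
  rw [Finset.sum_comm, Finset.sum_congr rfl fun F _ => h2 F, h3,
    M.integral_inner_gradient K hp]
  simp only [lap_ev']

/-- On the kernel of the local form, the reconstruction reproduces the energy inner product with the
cell component. -/
lemma IsLocalKernel.reconRHS_eq {ε : ℝ} {K : M.cells} {v : M.LocalSpace k K}
    (h : M.IsLocalKernel ε v) (w : poly (n + 1) (k + 2)) :
    M.reconRHS ε v w = gradInner ε (K : Set (Pt (n + 1))) v.1 w := by
  obtain ⟨p, hp⟩ := exists_ev v.1.2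
  obtain ⟨q, hqd, hq⟩ := mem_poly_iff.1 w.2
  have hb := M.isBounded_cell K
  have hbd : ∀ᵐ x ∂(surf (n + 1)).restrict (M.bdry K), ev p x = 0 := by
    simpa only [hp] using h.bdry
  -- on a face, the face component coincides with the cell component
  have hface : ∀ F : M.facesOf K, ∀ x ∈ (F : Set (Pt (n + 1))),
      (v.2.1 F : Pt (n + 1) → ℝ) x = ev p x ∧
      dt (M.faceNormal K F) (v.2.1 F) x = dt (M.faceNormal K F) (ev p) x := by
    intro F x hx
    obtain ⟨c, hc⟩ := M.exists_plane K F
    obtain ⟨r, hr⟩ := exists_ev (v.2.1 F).2.1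
    -- Vanishing a.e. on F is upgraded to vanishing on the whole supporting plane, so that the jump
    -- may be differentiated tangentially.
    have hz : ∀ x, ⟪M.faceNormal K F, x⟫_ℝ = c → ev (r - p) x = 0 := fun x hx => by
      refine ev_eq_zero_of_ae (M.norm_faceNormal K F) hc (M.measurableSet_face F)
        (M.surf_face_ne_zero F) ?_ hx
      filter_upwards [h.jump F] with x hx
      rw [Mesh.jump, hp, hr] at hx
      rw [ev_sub, hx]
    rw [hr]
    constructor
    · have := hz x (hc x hx)
      rw [ev_sub] at this
      linarith
    · have := dt_eq_zero (M.norm_faceNormal K F) hz (hc x hx)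
      rw [(lin_dt (M.faceNormal K F) x).map_sub, sub_eq_zero] at this
      exact this
  have hsurf : ∀ (F : M.facesOf K) (f : Pt (n + 1) → ℝ),
      surfInner (F : Set (Pt (n + 1))) (v.2.1 F) f = surfInner (F : Set (Pt (n + 1))) (ev p) f :=
    fun F f => setIntegral_congr_fun (M.measurableSet_face F) fun x hx => by
      simp only [(hface F x hx).1]
  have hsurfv : ∀ (F : M.facesOf K) (f : Pt (n + 1) → Pt (n + 1)),
      surfInnerVec (F : Set (Pt (n + 1))) (dt (M.faceNormal K F) (v.2.1 F)) f =
        surfInnerVec (F : Set (Pt (n + 1))) (dt (M.faceNormal K F) (ev p)) f :=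
    fun F f => setIntegral_congr_fun (M.measurableSet_face F) fun x hx => by
      simp only [(hface F x hx).2]
  -- Two derivatives of w leave degree at most k. Extended from F constantly along the normal, ∂ₙₙw
  -- is an element of ℙ^k(F), hence orthogonal to γ - ∂ₙv_K.
  have hnn : ∀ F : M.facesOf K,
      surfInner (F : Set (Pt (n + 1))) (v.2.2 F) (dnn (M.faceNormal K F) (ev q)) =
        surfInner (F : Set (Pt (n + 1))) (dn (M.faceNormal K F) (ev p))
          (dnn (M.faceNormal K F) (ev q)) := by
    intro F
    obtain ⟨c, hc⟩ := M.planar F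
    let N := M.faceNormal K F
    let r : MvPolynomial (Fin (n + 1)) ℝ := ∑ j, ∑ i, (N j * N i) •
      MvPolynomial.pderiv i (MvPolynomial.pderiv j q)
    have hrd : r.totalDegree ≤ k := by
      refine MvPolynomial.totalDegree_finsetSum_le fun j _ =>
        MvPolynomial.totalDegree_finsetSum_le fun i _ =>
          (MvPolynomial.totalDegree_smul_le _ _).trans ?_
      have h1 := totalDegree_pderiv_le j q
      have h2 := totalDegree_pderiv_le i (MvPolynomial.pderiv j q)
      omega
    have hr : ∀ x, dnn N (ev q) x = ev r x := by
      intro x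
      simp only [dnn, hess_ev, PiLp.inner_apply, r, ev_sum, ev_smul]
      refine Finset.sum_congr rfl fun j _ => ?_
      simp [N, mul_assoc, mul_comm, Finset.mul_sum]
    obtain ⟨s, hs⟩ := exists_facePoly (M.norm_normal F) c hrd
    have h0 := h.normalJump F s
    have hi : ∀ {f : Pt (n + 1) → ℝ}, Continuous f → IntegrableOn f F (surf (n + 1)) := fun hf =>
      integrableOn_surf (M.isBounded_face F) (M.measurableSet_face F) (M.surf_face_lt_top F) hf
    rw [← sub_eq_zero, ← h0, surfInner, surfInner, surfInner, ← integral_sub]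
    · refine setIntegral_congr_fun (M.measurableSet_face F) fun x hx => ?_
      simp only [Mesh.normalJump, hp]
      rw [hs x (hc x hx), ← hr]
      ring
    · exact hi ((continuous_facePoly _).mul (continuous_dnn_ev _ q))
    · exact hi ((continuous_dn_ev _ p).mul (continuous_dnn_ev _ q))
  rw [reconRHS, gradInner, hp, hq]
  simp only [hsurf, hsurfv, hnn]
  rw [M.integral_inner_gradient K hbd]
  have h1 : ∫ x in (K : Set (Pt (n + 1))), ev p x * (ε * lap (lap (ev q)) x) =
      ε * ∫ x in (K : Set (Pt (n + 1))), ev p x * lap (lap (ev q)) x := by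
    rw [← integral_const_mul]
    exact integral_congr_ae (Filter.Eventually.of_forall fun x => by ring)
  rw [h1]
  -- For ε = 0 the kernel gives no control of the gradient on ∂K ∩ ∂Ω, but the fourth-order terms
  -- disappear.
  rcases eq_or_ne ε 0 with rfl | hε
  · simp only [zero_mul]; ring
  · have hbd' : ∀ᵐ x ∂(surf (n + 1)).restrict (M.bdry K), gradient (ev p) x = 0 := by
      simpa only [hp] using h.bdry_gradient hε
    rw [M.integral_hessInner K hbd hbd']
    simp only [Finset.sum_sub_distrib, Finset.sum_add_distrib]
    ring

end Mesh

/-! ### Triviality of the kernel of the global form. -/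

lemma gradInner_const_left {d : ℕ} (ε : ℝ) (S : Set (Pt d)) (v : Pt d → ℝ) (a : ℝ) :
    gradInner ε S (fun _ => a) v = 0 := by
  have h : gradient (fun _ : Pt d => a) = 0 := funext fun x => by simp [gradient]
  simp [gradInner, hessInner, hess, h]

namespace Mesh

variable {n : ℕ} {Ω : Set (Pt (n + 1))} (M : Mesh (n + 1) Ω) {k : ℕ}

/-- With w = v_K, the energy of v_K equals its energy product with the reconstruction, and the
latter is constant. -/
lemma IsLocalKernel.exists_const {ε : ℝ} (hε : 0 ≤ ε) {K : M.cells} {v : M.LocalSpace k K}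
    (h : M.IsLocalKernel ε v) : ∃ a, (v.1 : Pt (n + 1) → ℝ) = fun _ => a := by
  refine exists_const_of_gradInner_self hε (M.isOpen_cell K) (M.isBounded_cell K)
    (M.cell_nonempty K K.2) v.1 ?_
  obtain ⟨b, hb⟩ := exists_const_of_gradInner_self hε (M.isOpen_cell K) (M.isBounded_cell K)
    (M.cell_nonempty K K.2) _ h.recon
  rw [← h.reconRHS_eq, ← M.gradInner_recon hε, hb, gradInner_const_left]

lemma faceNormal_left (F : M.intFaces) : M.faceNormal (M.left F) F = M.normal F := by
  rw [faceNormal, if_pos rfl]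

lemma faceNormal_right (F : M.intFaces) : M.faceNormal (M.right F) F = -M.normal F := by
  rw [faceNormal, if_neg (M.left_ne_right F).symm]

lemma mem_facesOf_left (F : M.intFaces) : F ∈ M.facesOf (M.left F) :=
  M.mem_facesOf.2 (M.face_subset_left F)

lemma mem_facesOf_right (F : M.intFaces) : F ∈ M.facesOf (M.right F) :=
  M.mem_facesOf.2 ((M.subset_frontier_iff F _).2 (Or.inr rfl))

/-- A sum over the faces of all cells, as a sum over all interior faces. -/
lemma sum_cells_facesOf (f : M.cells → M.intFaces → ℝ) :
    ∑ K, ∑ F : M.facesOf K, f K F = ∑ F, (f (M.left F) F + f (M.right F) F) := by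
  classical
  have h1 : ∀ K, ∑ F : M.facesOf K, f K F = ∑ F, if F ∈ M.facesOf K then f K F else 0 := fun K => by
    rw [Finset.sum_coe_sort (M.facesOf K) (fun F => f K F), ← Finset.sum_filter]
    congr 1
    ext F
    simp
  simp only [h1]
  rw [Finset.sum_comm]
  refine Finset.sum_congr rfl fun F _ => ?_
  rw [← Finset.sum_filter, ← Finset.sum_pair (f := fun K => f K F) (M.left_ne_right F)]
  congr 1
  ext K
  simp [mem_facesOf, M.subset_frontier_iff]

/-- A function which is constant on each cell, continuous across the interior faces, and which
vanishes on the boundary of the domain, is zero. -/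
lemma eq_zero_of_face_continuous {c : M.cells → ℝ} (hc : ∀ F, c (M.left F) = c (M.right F))
    (hb : ∀ K, ∀ᵐ _x ∂(surf (n + 1)).restrict (M.bdry K), c K = 0) (K : M.cells) : c K = 0 := by
  -- The divergence theorem for the field c_K² x₀ e₀; the square makes all summands of the final sum
  -- nonnegative. The hypothesis `hb` is void on cells whose boundary part is null, and there the
  -- divergence theorem sees no boundary term either.
  have h1 : ∀ K : M.cells, c K ^ 2 * volume.real (K : Set (Pt (n + 1))) =
      ∑ F : M.facesOf K, M.faceNormal K F 0 *
        ∫ x in (F : Set (Pt (n + 1))), ev (MvPolynomial.C (c K ^ 2) * MvPolynomial.X 0) x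
          ∂surf (n + 1) := by
    intro K
    rw [← M.integral_pderiv_cell K ?_ 0]
    · have : MvPolynomial.pderiv 0 (MvPolynomial.C (c K ^ 2) * MvPolynomial.X (0 : Fin (n + 1))) =
          MvPolynomial.C (c K ^ 2) := by
        rw [MvPolynomial.pderiv_C_mul, MvPolynomial.pderiv_X_self, mul_one]
      rw [this]
      simp only [ev_C, setIntegral_const, smul_eq_mul, mul_comm]
    · filter_upwards [hb K] with x hx
      simp [hx]
  have h2 : ∑ K : M.cells, c K ^ 2 * volume.real (K : Set (Pt (n + 1))) = 0 := by
    simp only [h1]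
    rw [M.sum_cells_facesOf fun K F => M.faceNormal K F 0 *
      ∫ x in (F : Set (Pt (n + 1))), ev (MvPolynomial.C (c K ^ 2) * MvPolynomial.X 0) x
        ∂surf (n + 1)]
    refine Finset.sum_eq_zero fun F _ => ?_
    -- Opposite normals and equal values: the two contributions of a face cancel.
    rw [M.faceNormal_left, M.faceNormal_right, hc F]
    simp
  rw [Finset.sum_eq_zero_iff_of_nonneg fun K _ => by positivity] at h2
  have h3 := h2 K (Finset.mem_univ K)
  exact pow_eq_zero_iff two_ne_zero |>.1
    ((mul_eq_zero.1 h3).resolve_right (M.volume_real_cell_pos K).ne')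

lemma eq_of_ae_face (F : M.intFaces) {a b : ℝ}
    (h : ∀ᵐ _x ∂(surf (n + 1)).restrict (F : Set (Pt (n + 1))), a = b) : a = b := by
  by_contra hab
  rw [ae_iff] at h
  simp only [hab, not_false_eq_true, Set.ofPred_true, Measure.restrict_apply_univ] at h
  exact M.surf_face_ne_zero F h

theorem eq_zero_of_form_self {ε : ℝ} (hε : 0 ≤ ε) (v : M.Space k) (h : M.form ε v v = 0) :
    v = 0 := by
  unfold form at h
  rw [Finset.sum_eq_zero_iff_of_nonneg fun K _ => M.localForm_self_nonneg hε _] at h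
  have hk : ∀ K, M.IsLocalKernel ε (M.localize v K) := fun K =>
    M.isLocalKernel_of_localForm_self hε _ (h K (Finset.mem_univ K))
  choose c hc using fun K => (hk K).exists_const M hε
  have hc' : ∀ K, (v.1 K : Pt (n + 1) → ℝ) = fun _ => c K := hc
  have hj : ∀ (K : M.cells) (F : M.intFaces), F ∈ M.facesOf K →
      ∀ᵐ x ∂(surf (n + 1)).restrict (F : Set (Pt (n + 1))), (v.2.1 F : Pt (n + 1) → ℝ) x = c K := by
    intro K F hF
    filter_upwards [(hk K).jump ⟨F, hF⟩] with x hx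
    rw [Mesh.jump, hc K] at hx
    exact sub_eq_zero.1 hx
  have h0 : ∀ K, c K = 0 := by
    refine M.eq_zero_of_face_continuous (fun F => M.eq_of_ae_face F ?_) fun K => ?_
    · filter_upwards [hj _ F (M.mem_facesOf_left F), hj _ F (M.mem_facesOf_right F)] with x h1 h2
      rw [← h1, h2]
    · filter_upwards [(hk K).bdry] with x hx
      rwa [hc K] at hx
  have e1 : v.1 = 0 := funext fun K => Subtype.ext (by rw [hc', h0]; rfl)
  refine Prod.ext e1 (Prod.ext (funext fun F => ?_) (funext fun F => ?_))
  · refine facePoly_eq_zero (M.norm_normal F) (M.planar F).choose_spec (M.measurableSet_face F)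
      (M.surf_face_ne_zero F) _ ?_
    filter_upwards [hj _ F (M.mem_facesOf_left F)] with x hx
    rw [hx, h0]
  -- Since v_K is constant, γ_F itself is orthogonal to ℙ^k(F), and in particular to itself. The
  -- left cell is used because the orientation sign is 1 there.
  · refine facePoly_eq_zero_of_surfInner (M.norm_normal F) (M.planar F).choose_spec
      (M.isBounded_face F) (M.measurableSet_face F) (M.surf_face_ne_zero F) (M.surf_face_lt_top F)
      _ ?_
    rw [← (hk (M.left F)).normalJump ⟨F, M.mem_facesOf_left F⟩ (v.2.2 F)]
    congr 1
    funext x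
    have hg : gradient ((M.localize v (M.left F)).1 : Pt (n + 1) → ℝ) x = 0 := by
      rw [hc]; simp [gradient]
    rw [Mesh.normalJump, dn, hg, inner_zero_right, sub_zero]
    change _ = (⟪M.normal F, M.faceNormal (M.left F) F⟫_ℝ • v.2.2 F : facePoly _ _ _).1 x
    rw [M.faceNormal_left, real_inner_self_eq_norm_sq, M.norm_normal, one_pow, one_smul]

end Mesh

/-! ### The outward normal -/

section OutwardNormal

variable {d : ℕ} {S : Set (Pt d)}

lemma IsOutwardNormalAt.outwardNormal_eq {x N : Pt d} (h : IsOutwardNormalAt S x N) :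
    outwardNormal S x = N := by
  have h' : ∃ ν, IsOutwardNormalAt S x ν := ⟨N, h⟩
  rw [outwardNormal, dif_pos h']
  exact h'.choose_spec.unique h

lemma norm_outwardNormal_le (S : Set (Pt d)) (x : Pt d) : ‖outwardNormal S x‖ ≤ 1 := by
  by_cases h : ∃ ν, IsOutwardNormalAt S x ν
  · obtain ⟨ν, h⟩ := h
    rw [h.outwardNormal_eq, h.1]
  · rw [outwardNormal, dif_neg h, norm_zero]
    exact zero_le_one

/-- Near a regular boundary point, the outward normal is the normalised gradient of a `C²`
function. -/
lemma IsOutwardNormalAt.exists_eventually {x N : Pt d} (hS : IsOpen S)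
    (h : IsOutwardNormalAt S x N) : ∃ g : Pt d → Pt d, ContinuousAt g x ∧
      ∀ᶠ y in 𝓝 x, y ∈ frontier S → IsOutwardNormalAt S y (g y) := by
  obtain ⟨hN, ρ, hρ, h0, ⟨c, hc, hg⟩, hev⟩ := h
  have hgc : ContinuousAt (gradient ρ) x := by
    have h1 : ContinuousAt (fderiv ℝ ρ) x :=
      (hρ.fderiv_right (m := 0) (by norm_num)).continuousAt
    exact (InnerProductSpace.toDual ℝ (Pt d)).symm.continuous.continuousAt.comp h1
  have hne : gradient ρ x ≠ 0 := by
    rw [hg]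
    exact smul_ne_zero hc.ne' (norm_ne_zero_iff.1 (by rw [hN]; exact one_ne_zero))
  refine ⟨fun y => ‖gradient ρ y‖⁻¹ • gradient ρ y,
    (hgc.norm.inv₀ (norm_ne_zero_iff.2 hne)).smul hgc, ?_⟩
  have hev2 : ∀ᶠ y in 𝓝 x, ContDiffAt ℝ 2 ρ y := hρ.eventually (by simp)
  filter_upwards [hev.eventually_nhds, hgc.eventually_ne hne, hev2] with y hy hy0 hyd hyS
  have hpos : 0 < ‖gradient ρ y‖ := norm_pos_iff.2 hy0
  have hcont := hyd.continuousAt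
  refine ⟨by rw [norm_smul, norm_inv, norm_norm, inv_mul_cancel₀ hpos.ne'], ρ, hyd, ?_,
    ⟨‖gradient ρ y‖, hpos, by rw [smul_smul, mul_inv_cancel₀ hpos.ne', one_smul]⟩, hy⟩
  rw [hS.frontier_eq] at hyS
  -- At a nearby boundary point ρ must vanish: ρ < 0 would put the point in S, and ρ > 0 would keep
  -- S away from it.
  refine le_antisymm (le_of_not_gt fun hlt => ?_) (not_lt.1 fun hlt => hyS.2 (hy.self_of_nhds.2 hlt))
  obtain ⟨z, ⟨hz1, hz2⟩, hz3⟩ := mem_closure_iff_nhds.1 hyS.1 _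
    (hy.and (hcont.tendsto.eventually (lt_mem_nhds hlt)))
  exact lt_asymm hz2 (hz1.1 hz3)

/-- The regular points form a relatively open subset of the frontier, of full measure, and by
uniqueness the normal agrees near each of them with a normalised gradient; so it is continuous on
that subset. -/
lemma IsPiecewiseC2Domain.aestronglyMeasurable_outwardNormal (h : IsPiecewiseC2Domain S) :
    AEStronglyMeasurable (outwardNormal S) ((surf d).restrict (frontier S)) := by
  set Reg : Set (Pt d) := {x ∈ frontier S | ∃ ν, IsOutwardNormalAt S x ν} with hReg
  have hopen : IsOpen (Reg ∪ (frontier S)ᶜ) := by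
    rw [isOpen_iff_mem_nhds]
    rintro x (⟨hx, ν, hν⟩ | hx)
    · obtain ⟨g, -, hg⟩ := hν.exists_eventually h.isOpen
      filter_upwards [hg] with y hy
      by_cases hyS : y ∈ frontier S
      · exact Or.inl ⟨hyS, _, hy hyS⟩
      · exact Or.inr hyS
    · filter_upwards [isClosed_frontier.isOpen_compl.mem_nhds hx] with y hy using Or.inr hy
  have hm : MeasurableSet Reg := by
    have : Reg = frontier S ∩ (Reg ∪ (frontier S)ᶜ) := by
      ext x
      simp only [hReg, Set.mem_inter_iff, Set.mem_union, Set.mem_compl_iff, Set.mem_sep_iff]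
      tauto
    rw [this]
    exact isClosed_frontier.measurableSet.inter hopen.measurableSet
  have hcont : ContinuousOn (outwardNormal S) Reg := by
    rintro x ⟨hx, ν, hν⟩
    obtain ⟨g, hgc, hg⟩ := hν.exists_eventually h.isOpen
    refine hgc.continuousWithinAt.congr_of_eventuallyEq ?_
      (hg.self_of_nhds hx).outwardNormal_eq
    filter_upwards [hg.filter_mono nhdsWithin_le_nhds, self_mem_nhdsWithin] with y hy hyR
    exact (hy hyR.1).outwardNormal_eq
  have hae : (frontier S : Set (Pt d)) =ᵐ[surf d] Reg := by
    have := (ae_restrict_iff' isClosed_frontier.measurableSet).1 h.ae_normal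
    filter_upwards [this] with x hx
    exact propext ⟨fun hxS => ⟨hxS, hx hxS⟩, fun hxR => hxR.1⟩
  rw [Measure.restrict_congr_set hae]
  exact hcont.aestronglyMeasurable hm

end OutwardNormal

/-! ### Linearity of the discrete linear form -/

lemma continuous_hess_ev_clm {d : ℕ} (p : MvPolynomial (Fin d) ℝ) : Continuous (hess (ev p)) :=
  continuous_clm_apply.2 fun _ => continuous_hess_ev p continuous_const

lemma integrable_inner_of_bounded {X E : Type*} [MeasurableSpace X] [NormedAddCommGroup E]
    [InnerProductSpace ℝ E] {μ : Measure X} {g h : X → E} (hg : Integrable g μ)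
    (hh : AEStronglyMeasurable h μ) {C : ℝ} (hC : ∀ᵐ x ∂μ, ‖h x‖ ≤ C) :
    Integrable (fun x => ⟪g x, h x⟫_ℝ) μ := by
  refine (hg.norm.mul_const C).mono' (hg.1.inner hh) ?_
  filter_upwards [hC] with x hx
  exact (norm_inner_le_norm _ _).trans (mul_le_mul_of_nonneg_left hx (norm_nonneg _))

lemma integrable_mul_of_bounded {X : Type*} [MeasurableSpace X] {μ : Measure X} {g h : X → ℝ}
    (hg : Integrable g μ) (hh : AEStronglyMeasurable h μ) {C : ℝ} (hC : ∀ᵐ x ∂μ, ‖h x‖ ≤ C) :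
    Integrable (fun x => g x * h x) μ := by
  simpa [mul_comm] using integrable_inner_of_bounded hg hh hC

lemma exists_bound_of_continuous {d : ℕ} {E : Type*} [NormedAddCommGroup E] {S : Set (Pt d)}
    (hb : Bornology.IsBounded S) {f : Pt d → E} (hf : Continuous f) :
    ∃ C, ∀ x ∈ S, ‖f x‖ ≤ C :=
  let ⟨C, hC⟩ := hb.isCompact_closure.exists_bound_of_continuousOn hf.continuousOn
  ⟨C, fun x hx => hC x (subset_closure hx)⟩

namespace Mesh

variable {n : ℕ} {Ω : Set (Pt (n + 1))} (M : Mesh (n + 1) Ω) {k : ℕ}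

lemma integrable_bdry_of_memLp {E : Type*} [NormedAddCommGroup E] {g : Pt (n + 1) → E}
    (hg : MemLp g 2 ((surf (n + 1)).restrict (frontier Ω))) (K : M.cells) :
    Integrable g ((surf (n + 1)).restrict (M.bdry K)) := by
  have : IsFiniteMeasure ((surf (n + 1)).restrict (M.bdry K)) :=
    ⟨by simpa using M.surf_bdry_lt_top K⟩
  have h : MemLp g 2 ((surf (n + 1)).restrict (M.bdry K)) :=
    hg.mono_measure (Measure.restrict_mono Set.inter_subset_right le_rfl)
  exact h.integrable (by norm_num)

lemma aestronglyMeasurable_outwardNormal_bdry (K : M.cells) :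
    AEStronglyMeasurable (outwardNormal (K : Set (Pt (n + 1))))
      ((surf (n + 1)).restrict (M.bdry K)) :=
  (M.cell_domain K K.2).aestronglyMeasurable_outwardNormal.mono_measure
    (Measure.restrict_mono Set.inter_subset_left le_rfl)

/-- Additivity of the integrals requires integrability. Square integrable data are integrable on
bounded cells and on boundary parts of finite area, and the factors that contain w are bounded, as
polynomials and normals are. -/
theorem isLinearMap_linForm {ε : ℝ} (hε : 0 ≤ ε) {f gD gN : Pt (n + 1) → ℝ}
    (h : IsAdmissibleData Ω ε f gD gN) :
    IsLinearMap ℝ fun w : M.Space k => M.linForm ε f gD gN w := by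
  refine IsLinearMap.finsetSum _ fun K => ?_
  have hn := M.aestronglyMeasurable_outwardNormal_bdry K
  have hn1 := norm_outwardNormal_le (K : Set (Pt (n + 1)))
  have hK : IsLinearMap ℝ fun w : M.Space k => w.1 K := ⟨fun _ _ => rfl, fun _ _ => rfl⟩
  have hR : IsLinearMap ℝ fun w : M.Space k => M.recon ε (M.localize w K) :=
    (M.isLinearMap_recon hε K).comp' (M.isLinearMap_localize K)
  have hbd : ∀ {E : Type} [NormedAddCommGroup E] {g : Pt (n + 1) → E}, Continuous g →
      ∃ C, ∀ᵐ x ∂(surf (n + 1)).restrict (M.bdry K), ‖g x‖ ≤ C := fun hg =>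
    let ⟨C, hC⟩ := exists_bound_of_continuous (M.isBounded_bdry K) hg
    ⟨C, ae_restrict_of_forall_mem (M.measurableSet_bdry K) hC⟩
  refine ((isLinearMap_integral (fun w => ?_) fun x => ?_).add'
    (isLinearMap_integral (fun w => ?_) fun x => ?_)).add' ?_
  · have : IsFiniteMeasure (volume.restrict (K : Set (Pt (n + 1)))) :=
      ⟨by simpa using (M.isBounded_cell K).measure_lt_top⟩
    obtain ⟨C, hC⟩ := exists_bound_of_continuous (M.isBounded_cell K) (continuous_poly (w.1 K))
    exact integrable_mul_of_bounded ((h.source.mono_measure (Measure.restrict_mono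
      (M.cell_subset K K.2) le_rfl)).integrable (by norm_num))
      (continuous_poly (w.1 K)).aestronglyMeasurable
      (ae_restrict_of_forall_mem (M.isOpen_cell K).measurableSet hC)
  · exact ((isLinearMap_poly (T := fun f => f x) (lin_eval x)).comp' hK).const_mul (f x)
  · obtain ⟨p, hp⟩ := exists_ev (w.1 K).2
    obtain ⟨q, hq⟩ := exists_ev (M.recon ε (M.localize w K)).2
    have hc1 : Continuous fun x => M.sigma ε K * (M.diam K)⁻¹ * ev p x :=
      continuous_const.mul (continuous_ev p)
    -- Both normal derivatives are gathered into one inner product of the merely measurable normal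
    -- with a continuous field.
    have hc2 : Continuous fun x => ε • gradient (lap (ev q)) x - gradient (ev q) x := by
      rw [lap_ev']
      exact ((continuous_gradient_ev _).const_smul ε).sub (continuous_gradient_ev q)
    obtain ⟨C₁, hC₁⟩ := hbd hc1
    obtain ⟨C₂, hC₂⟩ := hbd hc2
    rw [hp, hq]
    have he : (fun x => M.sigma ε K * (M.diam K)⁻¹ * ev p x +
        ε * dn (outwardNormal (K : Set (Pt (n + 1))) x) (lap (ev q)) x -
        dn (outwardNormal (K : Set (Pt (n + 1))) x) (ev q) x) = fun x =>
        M.sigma ε K * (M.diam K)⁻¹ * ev p x + ⟪outwardNormal (K : Set (Pt (n + 1))) x,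
          ε • gradient (lap (ev q)) x - gradient (ev q) x⟫_ℝ := by
      funext x
      rw [inner_sub_right, real_inner_smul_right, dn, dn, add_sub_assoc]
    refine integrable_mul_of_bounded (C := C₁ + C₂) (M.integrable_bdry_of_memLp h.dirichlet K) ?_ ?_
    · rw [he]
      exact hc1.aestronglyMeasurable.add (hn.inner hc2.aestronglyMeasurable)
    · filter_upwards [hC₁, hC₂] with x h1 h2
      rw [congrFun he x]
      refine norm_add_le_of_le h1 ((norm_inner_le_norm _ _).trans ?_)
      exact (mul_le_of_le_one_left (norm_nonneg _) (hn1 x)).trans h2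
  · set N := outwardNormal (K : Set (Pt (n + 1))) x
    exact (((((isLinearMap_poly (T := fun f => f x) (lin_eval x)).comp' hK).const_mul _).add'
      (((isLinearMap_poly (T := fun f => dn N (lap f) x) (lin_dn_lap N x)).comp' hR).const_mul
        ε)).sub' ((isLinearMap_poly (T := fun f => dn N f x) (lin_dn N x)).comp' hR)).const_mul _
  · rcases eq_or_ne ε 0 with h0 | h0
    -- For ε = 0 this term is identically zero, so neither the Neumann datum nor the tangential
    -- gradient has to be integrable.
    · simp only [h0, zero_mul]
      exact ⟨fun _ _ => (add_zero 0).symm, fun r _ => (smul_zero r).symm⟩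
    refine (isLinearMap_integral (fun w => ?_) fun x => ?_).const_mul ε
    · obtain ⟨p, hp⟩ := exists_ev (w.1 K).2
      obtain ⟨q, hq⟩ := exists_ev (M.recon ε (M.localize w K)).2
      have hc1 : Continuous fun x => (M.diam K)⁻¹ • gradient (ev p) x :=
        (continuous_const_smul (M.diam K)⁻¹).comp (continuous_gradient_ev p)
      have hc2 := continuous_hess_ev_clm q
      obtain ⟨C₁, hC₁⟩ := hbd hc1
      obtain ⟨C₂, hC₂⟩ := hbd hc2
      rw [hp, hq]
      refine integrable_inner_of_bounded (C := C₁ + C₂) (Integrable.add ?_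
        (M.integrable_bdry_of_memLp (h.dirichlet_grad h0) K)) (hc1.aestronglyMeasurable.sub ?_) ?_
      · have hgN := M.integrable_bdry_of_memLp (h.neumann h0) K
        refine hgN.norm.mono' (hgN.1.smul hn) (Filter.Eventually.of_forall fun x => ?_)
        rw [norm_smul]
        exact mul_le_of_le_one_right (norm_nonneg _) (hn1 x)
      · exact isBoundedBilinearMap_apply.continuous.comp_aestronglyMeasurable₂
          hc2.aestronglyMeasurable hn
      · filter_upwards [hC₁, hC₂] with x h1 h2
        refine norm_sub_le_of_le h1 ((ContinuousLinearMap.le_opNorm _ _).trans ?_)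
        exact (mul_le_of_le_one_right (norm_nonneg _) (hn1 x)).trans h2
    · exact ((((isLinearMap_poly (T := fun f => gradient f x) (lin_gradient x)).comp' hK).const_smul
        _).sub' ((isLinearMap_poly (T := fun f => hess f x (outwardNormal (K : Set (Pt (n + 1))) x))
          (lin_hess x _)).comp' hR)).inner_right _

end Mesh

end HHO

end

/-! ### Well-posedness of the discrete problem. -/

theorem corollary4p2 {d : ℕ} (hd : d = 2 ∨ d = 3) {Ω : Set (HHO.Pt d)}
    (hΩ : HHO.IsPiecewiseC2Domain Ω) (M : HHO.Mesh d Ω) (k : ℕ) (ε : ℝ) (hε : 0 ≤ ε) :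
    (∀ (K : M.cells) (v : M.LocalSpace k K), ∃! R, M.IsRecon ε v R) ∧
    ∃ C : ℝ, 0 < C ∧ ∀ f gD gN : HHO.Pt d → ℝ, HHO.IsAdmissibleData Ω ε f gD gN →
      (∃! u : M.Space k, M.IsDiscreteSolution ε f gD gN u) ∧
      ∀ u : M.Space k, M.IsDiscreteSolution ε f gD gN u →
        ∀ m : ℝ, 0 ≤ m → (∀ w : M.Space k, |M.linForm ε f gD gN w| ≤ m * M.energyNorm ε w) →
          M.energyNorm ε u ≤ C * m := by
  obtain ⟨n, rfl⟩ : ∃ n, d = n + 1 := by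
    rcases hd with rfl | rfl
    exacts [⟨1, rfl⟩, ⟨2, rfl⟩]
  refine ⟨fun K v => M.existsUnique_isRecon hε v, ?_⟩
  -- The constant depends only on the two quadratic forms, so it is fixed before the data.
  obtain ⟨C, hC, hE⟩ := (M.isBilin_form (k := k) hε).exists_bound (M.isBilin_energyForm ε)
    (M.form_self_nonneg hε) (M.eq_zero_of_form_self hε)
  simp only [M.localEnergyForm_self] at hE
  refine ⟨C, hC, fun f gD gN h => ⟨(M.isBilin_form hε).existsUnique (M.eq_zero_of_form_self hε)
    (M.isLinearMap_linForm hε h), fun u hu m hm hℓ => ?_⟩⟩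
  -- Testing with u gives ‖u‖² ≤ C m ‖u‖, and dividing by ‖u‖ requires it to be positive.
  rcases le_or_gt (M.energyNorm ε u) 0 with h0 | h0
  · exact h0.trans (mul_nonneg hC.le hm)
  · have h1 : M.energyNorm ε u ^ 2 ≤ C * M.form ε u u := by
      rw [HHO.Mesh.energyNorm, Real.sq_sqrt (Real.sqrt_pos.1 h0).le]
      exact hE u
    rw [hu u] at h1
    have h2 := (le_abs_self _).trans (hℓ u)
    refine le_of_mul_le_mul_right ?_ h0
    calc M.energyNorm ε u * M.energyNorm ε u ≤ C * M.linForm ε f gD gN u := by rwa [← sq]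
      _ ≤ C * (m * M.energyNorm ε u) := mul_le_mul_of_nonneg_left h2 hC.le
      _ = C * m * M.energyNorm ε u := by ring
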